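/- Let $k$ be a complete non-Archimedean valued field. All Banach spaces are $k$-Banach spaces whose norm satisfies the strong triangle inequality, morphisms are bounded linear maps, $\hat\otimes$ is the completed projective (non-Archimedean) tensor product, and $\coprod^{\leq 1}_n E_n$ denotes the Banach space of families $(x_n)$, $x_n\in E_n$, with $\|x_n\|\to 0$, with the norm $\sup_n\|x_n\|$. Let $k\{t\}=\coprod^{\leq 1}_{n\ge 0}k\,t^n$ be the Banach bialgebra with $t^m\cdot t^n=t^{m+n}$, $\Delta(t^n)=t^n\otimes t^n$, $\varepsilon(t^n)=1$. A *pre-braiding* on a Banach space $X$ is a bounded map $c:X\hat\otimes X\to X\hat\otimes X$, not necessarily invertible, with $(c\otimes 1)(1\otimes c)(c\otimes 1)=(1\otimes c)(c\otimes 1)(1\otimes c)$. A *pre-braided Banach Hopf algebra* is a Banach space with algebra and coalgebra structures and a pre-braiding $c$ such that multiplication, unit, comultiplication and counit commute with $c$ in the usual sense, $\Delta$ and $\varepsilon$ are algebra homomorphisms (for the multiplication $(\mu\otimes\mu)(1\otimes c\otimes 1)$ on $X\hat\otimes X$), and the identity has a convolution inverse. It is *analytically graded* if it is a $k\{t\}$-comodule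 such that all structure maps are comodule homomorphisms, where $c$ is required to be a homomorphism of $k\{t\}\hat\otimes k\{t\}$-comodules up to interchanging the two factors $k\{t\}$ (so $c$ maps bidegree $(m,n)$ to bidegree $(n,m)$); its degree $n$ part is $X(n)=\{x: x\mapsto t^n\otimes x\}$ under the coaction, and $P(X)=\{x:\Delta(x)=1\otimes x+x\otimes 1\}$. An *analytic Nichols algebra* of a Banach space $V$ with pre-braiding $c$ is an analytically graded pre-braided Banach Hopf algebra $R$ that is flat ($R\hat\otimes -$ preserves kernels), with $R(0)\cong k$, with $P(R)=R(1)\cong V$ as pre-braided Banach spaces, and which is generated by $R(1)$ as a Banach algebra (no proper closed subalgebra contains $R(1)$). **Proposition.** Let $V$ be a Banach space with a pre-braiding $c$ of norm at most $1$. Then an analytic Nichols algebra of $V$ exists. More precisely: 1. The Banach space $T(V)=\coprod^{\leq1}_{n\ge0}V^{\hat\otimes n}$ carries an analytically graded pre-braided Banach Hopf algebra structure in which the multiplication is concatenation, the unit is $k=V^{\hat\otimes 0}\to T(V)$, $\Delta(v)=1\otimes v+v\otimes 1$ for $v\in V$, the pre-braiding $\tilde c$ restricts to the maps $c_{n,m}:V^{\hat\otimes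 n}\hat\otimes V^{\hat\otimes m}\to V^{\hat\otimes m}\hat\otimes V^{\hat\otimes n}$ obtained from $c$ by moving factors past each other, and $V^{\hat\otimes n}$ has degree $n$. 2. Among the closed two-sided ideals $I$ of $T(V)$ that are homogeneous ($x\in I$ implies that all homogeneous components of $x$ are in $I$), are contained in $\coprod^{\leq 1}_{n\ge 2}V^{\hat\otimes n}$, and are coideals ($\varepsilon(I)=0$ and $\Delta(I)\subset\overline{I\hat\otimes T(V)+T(V)\hat\otimes I}$), there is a largest one, $I(V)$. 3. All the structure of $T(V)$, including the pre-braiding $\tilde c$, descends to the quotient $T(V)/I(V)$ with the quotient norm, and $T(V)/I(V)$ is an analytic Nichols algebra of $V$. -/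

import Mathlib

open CategoryTheory MonoidalCategory Filter Topology
open scoped TensorProduct

universe u

noncomputable section

/-- A non-Archimedean Banach space over `k`, equipped with a specific norm. -/
structure BanNA (k : Type u) [NormedField k] where
  carrier : Type u
  [group : NormedAddCommGroup carrier]
  [space : NormedSpace k carrier]
  [ultra : IsUltrametricDist carrier]
  [complete : CompleteSpace carrier]

namespace BanNA

attribute [instance] BanNA.group BanNA.space BanNA.ultra BanNA.complete

instance (k : Type u) [NormedField k] : CoeSort (BanNA k) (Type u) := ⟨BanNA.carrier⟩

variable {k : Type u} [NormedField k]

/-- Bounded linear transformations. The bound is part of the data since over a trivially valued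
field it does not follow from continuity. -/
@[ext]
structure Hom (A B : BanNA k) where
  lin : A →ₗ[k] B
  bound : ∃ C : ℝ, ∀ x, ‖lin x‖ ≤ C * ‖x‖

instance : Category (BanNA k) where
  Hom A B := Hom A B
  id A := ⟨LinearMap.id, 1, fun x => by simp⟩
  comp f g := ⟨g.lin ∘ₗ f.lin, by
    obtain ⟨C, hC⟩ := f.bound
    obtain ⟨D, hD⟩ := g.bound
    refine ⟨|D| * C, fun x => (hD _).trans ?_⟩
    calc D * ‖f.lin x‖ ≤ |D| * ‖f.lin x‖ :=
          mul_le_mul_of_nonneg_right (le_abs_self D) (norm_nonneg _)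
      _ ≤ |D| * (C * ‖x‖) := mul_le_mul_of_nonneg_left (hC x) (abs_nonneg D)
      _ = |D| * C * ‖x‖ := by ring⟩

instance (A B : BanNA k) : CoeFun (A ⟶ B) (fun _ => A → B) := ⟨fun f => Hom.lin f⟩

@[ext]
theorem hom_ext {A B : BanNA k} {f g : A ⟶ B} (h : ∀ x, f x = g x) : f = g :=
  Hom.ext (LinearMap.ext h)

@[simp] theorem id_apply {A : BanNA k} (x : A) : (𝟙 A : A ⟶ A) x = x := rfl

@[simp] theorem comp_apply {A B C : BanNA k} (f : A ⟶ B) (g : B ⟶ C) (x : A) :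
    (f ≫ g) x = g (f x) := rfl

theorem hom_continuous {A B : BanNA k} (f : A ⟶ B) : Continuous f := by
  obtain ⟨C, hC⟩ := Hom.bound f
  exact AddMonoidHomClass.continuous_of_bound (Hom.lin f) C hC

/-! ### The completed tensor product -/

section Projective

variable (A B : Type u) [NormedAddCommGroup A] [NormedSpace k A]
  [NormedAddCommGroup B] [NormedSpace k B]

variable (k) in
/-- The algebraic tensor product, to be equipped with the (non-Archimedean) projective
seminorm. -/
def AlgTensor : Type u := A ⊗[k] B

instance : AddCommGroup (AlgTensor k A B) := inferInstanceAs (AddCommGroup (A ⊗[k] B))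
instance : Module k (AlgTensor k A B) := inferInstanceAs (Module k (A ⊗[k] B))

variable {A B}

/-- `M` bounds some representation `t = ∑ aᵢ ⊗ bᵢ`, i.e. `maxᵢ ‖aᵢ‖ ‖bᵢ‖ ≤ M`. -/
def RepBound (t : AlgTensor k A B) (M : ℝ) : Prop :=
  0 ≤ M ∧ ∃ l : List (A × B), (l.map fun p => (p.1 ⊗ₜ[k] p.2 : A ⊗[k] B)).sum = t ∧
    ∀ p ∈ l, ‖p.1‖ * ‖p.2‖ ≤ M

theorem RepBound.mono {t : AlgTensor k A B} {M N : ℝ} (h : RepBound t M) (hMN : M ≤ N) :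
    RepBound t N := by
  obtain ⟨h0, l, hl, hb⟩ := h
  exact ⟨h0.trans hMN, l, hl, fun p hp => (hb p hp).trans hMN⟩

theorem RepBound.add {s t : AlgTensor k A B} {M : ℝ} (hs : RepBound s M) (ht : RepBound t M) :
    RepBound (s + t) M := by
  obtain ⟨h0, l, hl, hb⟩ := hs
  obtain ⟨-, l', hl', hb'⟩ := ht
  refine ⟨h0, l ++ l', ?_, fun p hp => ?_⟩
  · rw [List.map_append, List.sum_append, hl, hl']; rfl
  · rcases List.mem_append.1 hp with h | h
    exacts [hb p h, hb' p h]

theorem RepBound.smul {t : AlgTensor k A B} {M : ℝ} (ht : RepBound t M) (c : k) :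
    RepBound (c • t) (‖c‖ * M) := by
  obtain ⟨h0, l, hl, hb⟩ := ht
  refine ⟨by positivity, l.map fun p => (c • p.1, p.2), ?_, fun p hp => ?_⟩
  · rw [← hl, List.map_map]
    have : ∀ l : List (A × B),
        (l.map ((fun p => (p.1 ⊗ₜ[k] p.2 : A ⊗[k] B)) ∘ fun p => (c • p.1, p.2))).sum =
          c • (l.map fun p => (p.1 ⊗ₜ[k] p.2 : A ⊗[k] B)).sum := by
      intro l
      induction l with
      | nil => simp
      | cons a l ih => simp only [List.map_cons, List.sum_cons, ih, smul_add]; rfl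
    exact this l
  · obtain ⟨q, hq, rfl⟩ := List.mem_map.1 hp
    simp only [norm_smul, mul_assoc]
    exact mul_le_mul_of_nonneg_left (hb q hq) (norm_nonneg _)

theorem exists_repBound (t : AlgTensor k A B) : ∃ M, RepBound t M := by
  induction t using TensorProduct.induction_on with
  | zero => exact ⟨0, le_rfl, [], rfl, by simp⟩
  | tmul a b => exact ⟨‖a‖ * ‖b‖, by positivity, [(a, b)], by simp, by simp⟩
  | add s t hs ht =>
    obtain ⟨M, hM⟩ := hs
    obtain ⟨N, hN⟩ := ht
    exact ⟨max M N, (hM.mono (le_max_left _ _)).add (hN.mono (le_max_right _ _))⟩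

/-- The projective seminorm `‖t‖ = inf { maxᵢ ‖aᵢ‖ ‖bᵢ‖ : t = ∑ aᵢ ⊗ bᵢ }`. -/
def projNorm (t : AlgTensor k A B) : ℝ := sInf {M | RepBound t M}

theorem projNorm_le {t : AlgTensor k A B} {M : ℝ} (h : RepBound t M) : projNorm t ≤ M :=
  csInf_le ⟨0, fun _ hM => hM.1⟩ h

theorem projNorm_nonneg (t : AlgTensor k A B) : 0 ≤ projNorm t :=
  Real.sInf_nonneg fun _ hM => hM.1

theorem repBound_of_lt {t : AlgTensor k A B} {M : ℝ} (h : projNorm t < M) : RepBound t M := by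
  obtain ⟨N, hN, hlt⟩ := exists_lt_of_csInf_lt (exists_repBound t) h
  exact RepBound.mono hN hlt.le

theorem projNorm_add_le_max (s t : AlgTensor k A B) :
    projNorm (s + t) ≤ max (projNorm s) (projNorm t) :=
  le_of_forall_gt_imp_ge_of_dense fun _ hM => projNorm_le <|
    (repBound_of_lt ((le_max_left _ _).trans_lt hM)).add
      (repBound_of_lt ((le_max_right _ _).trans_lt hM))

theorem projNorm_smul_le (c : k) (t : AlgTensor k A B) : projNorm (c • t) ≤ ‖c‖ * projNorm t := by
  refine le_of_forall_pos_le_add fun ε hε => ?_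
  have h := (repBound_of_lt (t := t) (M := projNorm t + ε / (‖c‖ + 1))
    (by have := norm_nonneg c; have : 0 < ε / (‖c‖ + 1) := by positivity
        linarith)).smul c
  refine (projNorm_le h).trans ?_
  rw [mul_add]
  have : ‖c‖ * (ε / (‖c‖ + 1)) ≤ ε := by
    rw [← mul_div_assoc, div_le_iff₀ (by have := norm_nonneg c; positivity)]
    nlinarith [norm_nonneg c]
  linarith

theorem projNorm_zero : projNorm (0 : AlgTensor k A B) = 0 :=
  le_antisymm (projNorm_le ⟨le_rfl, [], rfl, by simp⟩) (projNorm_nonneg _)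

variable (k A B) in
def projSeminorm : AddGroupSeminorm (AlgTensor k A B) where
  toFun := projNorm
  map_zero' := projNorm_zero
  add_le' s t := (projNorm_add_le_max s t).trans
    (max_le_add_of_nonneg (projNorm_nonneg _) (projNorm_nonneg _))
  neg' t := by
    have h : ∀ t : AlgTensor k A B, projNorm (-t) ≤ projNorm t := fun t => by
      have := projNorm_smul_le (-1 : k) t
      rwa [neg_one_smul, norm_neg, norm_one, one_mul] at this
    exact le_antisymm (h t) (by simpa using h (-t))

instance : SeminormedAddCommGroup (AlgTensor k A B) :=
  AddGroupSeminorm.toSeminormedAddCommGroup (projSeminorm k A B)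

theorem algTensor_norm_def (t : AlgTensor k A B) : ‖t‖ = projNorm t := rfl

instance : NormedSpace k (AlgTensor k A B) where
  norm_smul_le := projNorm_smul_le

instance : IsUltrametricDist (AlgTensor k A B) :=
  IsUltrametricDist.isUltrametricDist_of_forall_norm_add_le_max_norm projNorm_add_le_max

end Projective

theorem isUltrametricDist_completion (E : Type u) [SeminormedAddCommGroup E]
    [IsUltrametricDist E] : IsUltrametricDist (UniformSpace.Completion E) := by
  refine IsUltrametricDist.isUltrametricDist_of_forall_norm_add_le_max_norm fun x y => ?_
  induction x, y using UniformSpace.Completion.induction_on₂ with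
  | hp => exact isClosed_le (by fun_prop) (by fun_prop)
  | ih x y =>
    rw [← UniformSpace.Completion.coe_add]
    simpa only [UniformSpace.Completion.norm_coe] using IsUltrametricDist.norm_add_le_max x y

/-- The completed tensor product of non-Archimedean Banach spaces: the completion of the algebraic
tensor product with respect to the projective seminorm. -/
def tensor (A B : BanNA k) : BanNA k :=
  letI := isUltrametricDist_completion (AlgTensor k A B)
  ⟨UniformSpace.Completion (AlgTensor k A B)⟩

/-- The canonical map from the algebraic tensor product to the completed one. -/
def ofAlg (A B : BanNA k) : A ⊗[k] B →ₗ[k] tensor A B :=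
  (UniformSpace.Completion.toComplₗᵢ : AlgTensor k A B →ₗᵢ[k] _).toLinearMap

/-- Pure tensors. -/
def ptmul {A B : BanNA k} (a : A) (b : B) : tensor A B := ofAlg A B (a ⊗ₜ[k] b)

theorem denseRange_ofAlg (A B : BanNA k) : DenseRange (ofAlg A B) :=
  UniformSpace.Completion.denseRange_coe (α := AlgTensor k A B)

theorem norm_ofAlg_le {A B : BanNA k} {t : A ⊗[k] B} {M : ℝ} (h : RepBound t M) :
    ‖ofAlg A B t‖ ≤ M :=
  (UniformSpace.Completion.norm_coe (E := AlgTensor k A B) t).trans_le (projNorm_le h)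

theorem norm_ptmul_le {A B : BanNA k} (a : A) (b : B) : ‖ptmul a b‖ ≤ ‖a‖ * ‖b‖ :=
  norm_ofAlg_le ⟨by positivity, [(a, b)], by simp, by simp⟩

/-- Bounded maps out of a completed tensor product agree if they agree on pure tensors. -/
theorem ptensor_ext {A B X : BanNA k} {f g : tensor A B ⟶ X}
    (h : ∀ a b, f (ptmul a b) = g (ptmul a b)) : f = g := by
  ext x
  refine congrFun ((denseRange_ofAlg A B).equalizer (hom_continuous f) (hom_continuous g) ?_) x
  have : Hom.lin f ∘ₗ ofAlg A B = Hom.lin g ∘ₗ ofAlg A B := TensorProduct.ext' h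
  exact funext fun t => LinearMap.congr_fun this t

theorem norm_lift_le {A B : BanNA k} {X : BanNA k} (f : A →ₗ[k] B →ₗ[k] X) {C : ℝ} (hC : 0 ≤ C)
    (h : ∀ a b, ‖f a b‖ ≤ C * (‖a‖ * ‖b‖)) (t : AlgTensor k A B) :
    ‖TensorProduct.lift f t‖ ≤ C * ‖t‖ := by
  have key : ∀ M, RepBound t M → ‖TensorProduct.lift f t‖ ≤ C * M := by
    rintro M ⟨h0, l, rfl, hb⟩
    induction l with
    | nil => simpa using mul_nonneg hC h0
    | cons p l ih =>
      simp only [List.map_cons, List.sum_cons, map_add, TensorProduct.lift.tmul]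
      refine (IsUltrametricDist.norm_add_le_max _ _).trans (max_le ?_ ?_)
      · exact (h _ _).trans (mul_le_mul_of_nonneg_left (hb p (by simp)) hC)
      · exact ih fun q hq => hb q (by simp [hq])
  refine le_of_forall_pos_le_add fun ε hε => ?_
  refine (key _ (repBound_of_lt (M := ‖t‖ + ε / (C + 1)) ?_)).trans ?_
  · have : 0 < ε / (C + 1) := by positivity
    rw [algTensor_norm_def]; linarith
  · rw [mul_add]
    have : C * (ε / (C + 1)) ≤ ε := by
      rw [← mul_div_assoc, div_le_iff₀ (by positivity)]; nlinarith
    linarith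

/-- The universal property of the completed tensor product: a bounded bilinear map extends. -/
theorem exists_lift {A B X : BanNA k} (f : A →ₗ[k] B →ₗ[k] X) {C : ℝ} (hC : 0 ≤ C)
    (h : ∀ a b, ‖f a b‖ ≤ C * (‖a‖ * ‖b‖)) :
    ∃ F : tensor A B ⟶ X, (∀ a b, F (ptmul a b) = f a b) ∧ ∀ x, ‖F x‖ ≤ C * ‖x‖ := by
  let g : NormedAddGroupHom (AlgTensor k A B) X :=
    { toFun := TensorProduct.lift f
      map_add' := fun s t => map_add (TensorProduct.lift f) s t
      bound' := ⟨C, norm_lift_le f hC h⟩ }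
  let G : NormedAddGroupHom (UniformSpace.Completion (AlgTensor k A B)) X := g.extension
  have hG : ∀ t : A ⊗[k] B, G (ofAlg A B t) = TensorProduct.lift f t := g.extension_coe
  have hsmul : ∀ (c : k) (x : tensor A B), G (c • x) = c • G x := fun c x => by
    refine (denseRange_ofAlg A B).induction_on
      (p := fun x : tensor A B => G (c • x) = c • G x) x
      (isClosed_eq (G.continuous.comp ?_) (G.continuous.const_smul c)) fun t => ?_
    · exact continuous_const_smul (T := tensor A B) c
    · rw [← map_smul, hG, hG, map_smul]
  refine ⟨⟨{ toFun := G, map_add' := map_add G, map_smul' := hsmul }, G.bound'⟩,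
    fun a b => (hG _).trans (TensorProduct.lift.tmul a b), fun x => ?_⟩
  change ‖G x‖ ≤ C * ‖x‖
  refine (denseRange_ofAlg A B).induction_on (p := fun x : tensor A B => ‖G x‖ ≤ C * ‖x‖) x
    (isClosed_le G.continuous.norm (continuous_norm.const_mul C)) fun t => ?_
  rw [hG]
  refine (norm_lift_le f hC h t).trans_eq ?_
  exact congrArg (C * ·) (UniformSpace.Completion.norm_coe (E := AlgTensor k A B) t).symm

/-- The bounded linear map on a completed tensor product induced by a bounded bilinear map. -/
def lift {A B X : BanNA k} (f : A → B → X) (hadd : ∀ a a' b, f (a + a') b = f a b + f a' b)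
    (hsmul : ∀ (c : k) a b, f (c • a) b = c • f a b)
    (hadd' : ∀ a b b', f a (b + b') = f a b + f a b')
    (hsmul' : ∀ (c : k) a b, f a (c • b) = c • f a b)
    (C : ℝ) (hC : 0 ≤ C) (h : ∀ a b, ‖f a b‖ ≤ C * (‖a‖ * ‖b‖)) : tensor A B ⟶ X :=
  (exists_lift (LinearMap.mk₂ k f hadd hsmul hadd' hsmul') hC h).choose

theorem lift_ptmul {A B X : BanNA k} (f : A → B → X) (hadd hsmul hadd' hsmul') (C : ℝ)
    (hC : 0 ≤ C) (h : ∀ a b, ‖f a b‖ ≤ C * (‖a‖ * ‖b‖)) (a : A) (b : B) :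
    lift f hadd hsmul hadd' hsmul' C hC h (ptmul a b) = f a b :=
  (exists_lift (LinearMap.mk₂ k f hadd hsmul hadd' hsmul') hC h).choose_spec.1 a b

theorem norm_lift_apply_le {A B X : BanNA k} (f : A → B → X) (hadd hsmul hadd' hsmul') (C : ℝ)
    (hC : 0 ≤ C) (h : ∀ a b, ‖f a b‖ ≤ C * (‖a‖ * ‖b‖)) (x : tensor A B) :
    ‖lift f hadd hsmul hadd' hsmul' C hC h x‖ ≤ C * ‖x‖ :=
  (exists_lift (LinearMap.mk₂ k f hadd hsmul hadd' hsmul') hC h).choose_spec.2 x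

theorem ptmul_add {A B : BanNA k} (a : A) (b b' : B) : ptmul a (b + b') = ptmul a b + ptmul a b' := by
  simp only [ptmul, TensorProduct.tmul_add, map_add]

theorem add_ptmul {A B : BanNA k} (a a' : A) (b : B) : ptmul (a + a') b = ptmul a b + ptmul a' b := by
  simp only [ptmul, TensorProduct.add_tmul, map_add]

theorem smul_ptmul {A B : BanNA k} (c : k) (a : A) (b : B) : ptmul (c • a) b = c • ptmul a b := by
  rw [ptmul, ptmul, ← map_smul, TensorProduct.smul_tmul']

theorem ptmul_smul {A B : BanNA k} (c : k) (a : A) (b : B) : ptmul a (c • b) = c • ptmul a b := by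
  simp only [ptmul, TensorProduct.tmul_smul, map_smul]

theorem exists_bound {A B : BanNA k} (f : A ⟶ B) : ∃ C : ℝ, 0 ≤ C ∧ ∀ x, ‖f x‖ ≤ C * ‖x‖ := by
  obtain ⟨C, hC⟩ := Hom.bound f
  exact ⟨|C|, abs_nonneg C, fun x =>
    (hC x).trans (mul_le_mul_of_nonneg_right (le_abs_self C) (norm_nonneg x))⟩

theorem map_add' {A B : BanNA k} (f : A ⟶ B) (x y : A) : f (x + y) = f x + f y :=
  map_add (Hom.lin f) x y

theorem map_smul' {A B : BanNA k} (f : A ⟶ B) (c : k) (x : A) : f (c • x) = c • f x :=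
  map_smul (Hom.lin f) c x

theorem exists_bound_tensorMap {A A' B B' : BanNA k} (f : A ⟶ A') (g : B ⟶ B') :
    ∃ C : ℝ, 0 ≤ C ∧ ∀ a b, ‖ptmul (f a) (g b)‖ ≤ C * (‖a‖ * ‖b‖) := by
  obtain ⟨C, hC, hf⟩ := exists_bound f
  obtain ⟨D, hD, hg⟩ := exists_bound g
  refine ⟨C * D, by positivity, fun a b => (norm_ptmul_le _ _).trans ?_⟩
  calc ‖f a‖ * ‖g b‖ ≤ (C * ‖a‖) * (D * ‖b‖) :=
        mul_le_mul (hf a) (hg b) (norm_nonneg _) (by positivity)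
    _ = C * D * (‖a‖ * ‖b‖) := by ring

/-- The tensor product of two bounded linear maps. -/
def tensorMap {A A' B B' : BanNA k} (f : A ⟶ A') (g : B ⟶ B') : tensor A B ⟶ tensor A' B' :=
  lift (fun a b => ptmul (f a) (g b))
    (fun a a' b => by simp only [map_add', add_ptmul])
    (fun c a b => by simp only [map_smul', smul_ptmul])
    (fun a b b' => by simp only [map_add', ptmul_add])
    (fun c a b => by simp only [map_smul', ptmul_smul])
    (exists_bound_tensorMap f g).choose (exists_bound_tensorMap f g).choose_spec.1
    (exists_bound_tensorMap f g).choose_spec.2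

@[simp] theorem tensorMap_ptmul {A A' B B' : BanNA k} (f : A ⟶ A') (g : B ⟶ B') (a : A) (b : B) :
    tensorMap f g (ptmul a b) = ptmul (f a) (g b) :=
  lift_ptmul _ _ _ _ _ _ _ _ a b

/-- For fixed `c`, the bounded map `a ⊗ b ↦ a ⊗ (b ⊗ c)`. -/
def assocAux (A B : BanNA k) {C : BanNA k} (c : C) :
    tensor A B ⟶ tensor A (tensor B C) :=
  lift (fun a b => ptmul a (ptmul b c))
    (fun a a' b => by simp only [add_ptmul])
    (fun r a b => by simp only [smul_ptmul])
    (fun a b b' => by simp only [add_ptmul, ptmul_add])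
    (fun r a b => by simp only [smul_ptmul, ptmul_smul])
    ‖c‖ (norm_nonneg c)
    (fun a b => (norm_ptmul_le _ _).trans (by
      calc ‖a‖ * ‖ptmul b c‖ ≤ ‖a‖ * (‖b‖ * ‖c‖) :=
            mul_le_mul_of_nonneg_left (norm_ptmul_le b c) (norm_nonneg a)
        _ = ‖c‖ * (‖a‖ * ‖b‖) := by ring))

@[simp] theorem assocAux_ptmul {A B C : BanNA k} (a : A) (b : B) (c : C) :
    assocAux A B c (ptmul a b) = ptmul a (ptmul b c) := lift_ptmul _ _ _ _ _ _ _ _ a b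

theorem norm_assocAux_le {A B C : BanNA k} (c : C) (x : tensor A B) :
    ‖assocAux A B c x‖ ≤ ‖c‖ * ‖x‖ := norm_lift_apply_le _ _ _ _ _ _ _ _ x

/-- The map `a ↦ a ⊗ b` for fixed `b`. -/
def tmulRight (A : BanNA k) {B : BanNA k} (b : B) : A ⟶ tensor A B :=
  ⟨{ toFun := fun a => ptmul a b
     map_add' := fun a a' => add_ptmul a a' b
     map_smul' := fun c a => smul_ptmul c a b }, ‖b‖, fun a =>
    (norm_ptmul_le a b).trans_eq (mul_comm _ _)⟩

/-- The map `b ↦ a ⊗ b` for fixed `a`. -/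
def tmulLeft {A : BanNA k} (B : BanNA k) (a : A) : B ⟶ tensor A B :=
  ⟨{ toFun := fun b => ptmul a b
     map_add' := fun b b' => ptmul_add a b b'
     map_smul' := fun c b => ptmul_smul c a b }, ‖a‖, fun b => norm_ptmul_le a b⟩

theorem ptensor_ext_left {A B C X : BanNA k} {f g : tensor (tensor A B) C ⟶ X}
    (h : ∀ a b c, f (ptmul (ptmul a b) c) = g (ptmul (ptmul a b) c)) : f = g :=
  ptensor_ext fun x c => by
    have : tmulRight (tensor A B) c ≫ f = tmulRight (tensor A B) c ≫ g :=
      ptensor_ext fun a b => h a b c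
    exact congrArg (fun F : tensor A B ⟶ X => F x) this

theorem ptensor_ext_right {A B C X : BanNA k} {f g : tensor A (tensor B C) ⟶ X}
    (h : ∀ a b c, f (ptmul a (ptmul b c)) = g (ptmul a (ptmul b c))) : f = g :=
  ptensor_ext fun a x => by
    have : tmulLeft (tensor B C) a ≫ f = tmulLeft (tensor B C) a ≫ g :=
      ptensor_ext fun b c => h a b c
    exact congrArg (fun F : tensor B C ⟶ X => F x) this

theorem ptensor_ext_left₂ {A B C D X : BanNA k} {f g : tensor (tensor (tensor A B) C) D ⟶ X}
    (h : ∀ a b c d, f (ptmul (ptmul (ptmul a b) c) d) = g (ptmul (ptmul (ptmul a b) c) d)) : f = g :=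
  ptensor_ext fun x d => by
    have : tmulRight (tensor (tensor A B) C) d ≫ f = tmulRight (tensor (tensor A B) C) d ≫ g :=
      ptensor_ext_left fun a b c => h a b c d
    exact congrArg (fun F : tensor (tensor A B) C ⟶ X => F x) this

/-- The symmetry `a ⊗ b ↦ b ⊗ a`. -/
def swap (A B : BanNA k) : tensor A B ⟶ tensor B A :=
  lift (fun a b => ptmul b a) (fun a a' b => ptmul_add b a a') (fun c a b => ptmul_smul c b a)
    (fun a b b' => add_ptmul b b' a) (fun c a b => smul_ptmul c b a) 1 zero_le_one
    (fun a b => (norm_ptmul_le b a).trans_eq (by ring))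

@[simp] theorem swap_ptmul {A B : BanNA k} (a : A) (b : B) : swap A B (ptmul a b) = ptmul b a :=
  lift_ptmul _ _ _ _ _ _ _ _ a b

/-- The map `(a ⊗ b) ⊗ c ↦ a ⊗ (b ⊗ c)`. -/
def assocHom (A B C : BanNA k) : tensor (tensor A B) C ⟶ tensor A (tensor B C) :=
  lift (fun x c => assocAux A B c x)
    (fun x y c => map_add' _ x y) (fun r x c => map_smul' _ r x)
    (fun x c c' => by
      have : assocAux A B (c + c') =
          (⟨Hom.lin (assocAux A B c) + Hom.lin (assocAux A B c'), by
            refine ⟨‖c‖ + ‖c'‖, fun x => (norm_add_le _ _).trans ?_⟩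
            rw [add_mul]
            exact add_le_add (norm_assocAux_le c x) (norm_assocAux_le c' x)⟩ :
            tensor A B ⟶ tensor A (tensor B C)) := ptensor_ext fun a b => by
        change _ = assocAux A B c (ptmul a b) + assocAux A B c' (ptmul a b)
        simp only [assocAux_ptmul, ptmul_add]
      exact congrArg (fun F : tensor A B ⟶ tensor A (tensor B C) => F x) this)
    (fun r x c => by
      have : assocAux A B (r • c) =
          (⟨r • Hom.lin (assocAux A B c), by
            refine ⟨‖r‖ * ‖c‖, fun x => ?_⟩
            change ‖r • assocAux A B c x‖ ≤ _
            rw [norm_smul, mul_assoc]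
            exact mul_le_mul_of_nonneg_left (norm_assocAux_le c x) (norm_nonneg r)⟩ :
            tensor A B ⟶ tensor A (tensor B C)) := ptensor_ext fun a b => by
        change _ = r • assocAux A B c (ptmul a b)
        simp only [assocAux_ptmul, ptmul_smul]
      exact congrArg (fun F : tensor A B ⟶ tensor A (tensor B C) => F x) this)
    1 zero_le_one (fun x c => (norm_assocAux_le c x).trans_eq (by ring))

@[simp] theorem assocHom_ptmul {A B C : BanNA k} (a : A) (b : B) (c : C) :
    assocHom A B C (ptmul (ptmul a b) c) = ptmul a (ptmul b c) :=
  (lift_ptmul _ _ _ _ _ _ _ _ (ptmul a b) c).trans (assocAux_ptmul a b c)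

def assocInv (A B C : BanNA k) : tensor A (tensor B C) ⟶ tensor (tensor A B) C :=
  swap _ _ ≫ assocHom B C A ≫ swap _ _ ≫ assocHom C A B ≫ swap _ _

@[simp] theorem assocInv_ptmul {A B C : BanNA k} (a : A) (b : B) (c : C) :
    assocInv A B C (ptmul a (ptmul b c)) = ptmul (ptmul a b) c := by
  simp [assocInv]


section Unit

variable [IsUltrametricDist k] [CompleteSpace k]

variable (k) in
/-- The base field as a Banach space. -/
def unit : BanNA k := ⟨k⟩

/-- An element of the unit object, as a scalar. -/
def unitVal (c : unit k) : k := c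

variable (k) in
def unitOne : unit k := (1 : k)

theorem unitVal_smul_unitOne (c : unit k) : unitVal c • unitOne k = c := mul_one (M := k) c

def lunit (A : BanNA k) : tensor (unit k) A ⟶ A :=
  lift (fun c a => unitVal c • a) (fun c c' a => add_smul (unitVal c) (unitVal c') a)
    (fun r c a => mul_smul r (unitVal c) a)
    (fun c a a' => smul_add _ a a') (fun r c a => smul_comm _ r a) 1 zero_le_one
    (fun c a => by rw [one_mul]; exact norm_smul_le _ a)

@[simp] theorem lunit_ptmul {A : BanNA k} (c : unit k) (a : A) :
    lunit A (ptmul c a) = unitVal c • a := lift_ptmul _ _ _ _ _ _ _ _ c a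

def lunitIso (A : BanNA k) : tensor (unit k) A ≅ A where
  hom := lunit A
  inv := tmulLeft A (unitOne k)
  hom_inv_id := ptensor_ext fun c a => by
    simp only [comp_apply, lunit_ptmul, id_apply]
    change ptmul (unitOne k) (unitVal c • a) = _
    rw [ptmul_smul, ← smul_ptmul, unitVal_smul_unitOne]
  inv_hom_id := hom_ext fun a => (lunit_ptmul (unitOne k) a).trans (one_smul k a)

def swapIso (A B : BanNA k) : tensor A B ≅ tensor B A where
  hom := swap A B
  inv := swap B A
  hom_inv_id := ptensor_ext fun a b => by simp
  inv_hom_id := ptensor_ext fun a b => by simp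

def assocIso (A B C : BanNA k) : tensor (tensor A B) C ≅ tensor A (tensor B C) where
  hom := assocHom A B C
  inv := assocInv A B C
  hom_inv_id := ptensor_ext_left fun a b c => by simp
  inv_hom_id := ptensor_ext_right fun a b c => by simp

instance : MonoidalCategoryStruct (BanNA k) where
  tensorObj := tensor
  whiskerLeft A _ _ f := tensorMap (𝟙 A) f
  whiskerRight f B := tensorMap f (𝟙 B)
  tensorHom f g := tensorMap f g
  tensorUnit := unit k
  associator := assocIso
  leftUnitor := lunitIso
  rightUnitor A := swapIso A (unit k) ≪≫ lunitIso A

/-- The pure tensor `a ⊗ b` in the completed tensor product. -/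
def tmul {A B : BanNA k} (a : A) (b : B) : (A ⊗ B : BanNA k) := ptmul a b

/-- An element of the unit object, as a scalar. -/
def toScalar (c : (𝟙_ (BanNA k) : BanNA k)) : k := c

theorem tmul_add {A B : BanNA k} (a : A) (b b' : B) : tmul a (b + b') = tmul a b + tmul a b' :=
  ptmul_add a b b'

theorem add_tmul {A B : BanNA k} (a a' : A) (b : B) : tmul (a + a') b = tmul a b + tmul a' b :=
  add_ptmul a a' b

theorem smul_tmul {A B : BanNA k} (c : k) (a : A) (b : B) : tmul (c • a) b = c • tmul a b :=
  smul_ptmul c a b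

theorem tmul_smul {A B : BanNA k} (c : k) (a : A) (b : B) : tmul a (c • b) = c • tmul a b :=
  ptmul_smul c a b

theorem norm_tmul_le {A B : BanNA k} (a : A) (b : B) : ‖tmul a b‖ ≤ ‖a‖ * ‖b‖ :=
  norm_ptmul_le a b

/-- Bounded maps out of a completed tensor product agree if they agree on pure tensors. -/
theorem tensor_ext {A B X : BanNA k} {f g : A ⊗ B ⟶ X}
    (h : ∀ a b, f (tmul a b) = g (tmul a b)) : f = g := ptensor_ext h

theorem tensor_ext_left {A B C X : BanNA k} {f g : (A ⊗ B) ⊗ C ⟶ X}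
    (h : ∀ a b c, f (tmul (tmul a b) c) = g (tmul (tmul a b) c)) : f = g := ptensor_ext_left h

theorem tensor_ext_right {A B C X : BanNA k} {f g : A ⊗ B ⊗ C ⟶ X}
    (h : ∀ a b c, f (tmul a (tmul b c)) = g (tmul a (tmul b c))) : f = g := ptensor_ext_right h

theorem tensor_ext_left₂ {A B C D X : BanNA k} {f g : ((A ⊗ B) ⊗ C) ⊗ D ⟶ X}
    (h : ∀ a b c d, f (tmul (tmul (tmul a b) c) d) = g (tmul (tmul (tmul a b) c) d)) : f = g :=
  ptensor_ext_left₂ h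

@[simp] theorem tensorHom_tmul {A A' B B' : BanNA k} (f : A ⟶ A') (g : B ⟶ B') (a : A) (b : B) :
    (f ⊗ₘ g) (tmul a b) = tmul (f a) (g b) := tensorMap_ptmul f g a b

@[simp] theorem whiskerLeft_tmul (A : BanNA k) {B B' : BanNA k} (g : B ⟶ B') (a : A) (b : B) :
    (A ◁ g) (tmul a b) = tmul a (g b) := tensorMap_ptmul (𝟙 A) g a b

@[simp] theorem whiskerRight_tmul {A A' : BanNA k} (f : A ⟶ A') (B : BanNA k) (a : A) (b : B) :
    (f ▷ B) (tmul a b) = tmul (f a) b := tensorMap_ptmul f (𝟙 B) a b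

@[simp] theorem associator_hom_tmul {A B C : BanNA k} (a : A) (b : B) (c : C) :
    (α_ A B C).hom (tmul (tmul a b) c) = tmul a (tmul b c) := assocHom_ptmul a b c

@[simp] theorem associator_inv_tmul {A B C : BanNA k} (a : A) (b : B) (c : C) :
    (α_ A B C).inv (tmul a (tmul b c)) = tmul (tmul a b) c := assocInv_ptmul a b c

@[simp] theorem leftUnitor_hom_tmul {A : BanNA k} (c : (𝟙_ (BanNA k) : BanNA k)) (a : A) :
    (λ_ A).hom (tmul c a) = toScalar c • a := lunit_ptmul c a

@[simp] theorem rightUnitor_hom_tmul {A : BanNA k} (a : A) (c : (𝟙_ (BanNA k) : BanNA k)) :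
    (ρ_ A).hom (tmul a c) = toScalar c • a :=
  (congrArg (lunit A) (swap_ptmul a c)).trans (lunit_ptmul c a)

instance : MonoidalCategory (BanNA k) :=
  MonoidalCategory.ofTensorHom
    (id_tensorHom_id := fun A B => tensor_ext fun a b => by simp)
    (id_tensorHom := fun A B B' f => rfl)
    (tensorHom_id := fun f B => rfl)
    (tensorHom_comp_tensorHom := fun f f' g g' => tensor_ext fun a b => by simp)
    (associator_naturality := fun f g h => tensor_ext_left fun a b c => by simp)
    (leftUnitor_naturality := fun f => tensor_ext fun c a => by simp)
    (rightUnitor_naturality := fun f => tensor_ext fun a c => by simp)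
    (pentagon := fun A B C D => tensor_ext_left₂ fun a b c d => by simp)
    (triangle := fun A B => tensor_ext_left fun a c b => by simp [smul_tmul, tmul_smul])

/-- The symmetry `a ⊗ b ↦ b ⊗ a` of the category of Banach spaces. -/
def symm (A B : BanNA k) : A ⊗ B ≅ B ⊗ A := swapIso A B

@[simp] theorem symm_hom_tmul {A B : BanNA k} (a : A) (b : B) :
    (symm A B).hom (tmul a b) = tmul b a := swap_ptmul a b

@[simp] theorem symm_inv_tmul {A B : BanNA k} (b : B) (a : A) :
    (symm A B).inv (tmul b a) = tmul a b := swap_ptmul b a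

instance : SymmetricCategory (BanNA k) where
  braiding := symm
  braiding_naturality_right A _ _ f := tensor_ext fun a b => by simp
  braiding_naturality_left f B := tensor_ext fun a b => by simp
  hexagon_forward A B C := tensor_ext_left fun a b c => by simp
  hexagon_reverse A B C := tensor_ext_right fun a b c => by simp
  symmetry A B := tensor_ext fun a b => by simp

@[simp] theorem braiding_hom_tmul {A B : BanNA k} (a : A) (b : B) :
    (β_ A B).hom (tmul a b) = tmul b a := swap_ptmul a b

end Unit

/-! ### Contracting coproducts -/

section ContrCoprod

/-- The families `(xₙ)` with `lim ‖xₙ‖ = 0`, inside the bounded families with the sup norm. -/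
def c0Sum (E : ℕ → BanNA k) : Submodule k (lp (fun n => E n) ⊤) where
  carrier := {x | Tendsto (fun n => ‖x n‖) cofinite (𝓝 0)}
  zero_mem' := by simp
  add_mem' {x y} hx hy := by
    refine squeeze_zero (fun n => norm_nonneg _) (fun n => norm_add_le (x n) (y n)) ?_
    simpa using Tendsto.add hx hy
  smul_mem' c x hx := by
    have : Tendsto (fun n => ‖c‖ * ‖x n‖) cofinite (𝓝 0) := by simpa using Tendsto.const_mul ‖c‖ hx
    exact this.congr fun n => (norm_smul c (x n)).symm

theorem isClosed_c0Sum (E : ℕ → BanNA k) : IsClosed (c0Sum E : Set (lp (fun n => E n) ⊤)) := by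
  refine isClosed_of_closure_subset fun x hx => ?_
  change Tendsto (fun n => ‖x n‖) cofinite (𝓝 0)
  rw [Metric.tendsto_nhds]
  intro ε hε
  obtain ⟨y, hy, hxy⟩ := Metric.mem_closure_iff.1 hx (ε / 2) (by positivity)
  have hy' : Tendsto (fun n => ‖y n‖) cofinite (𝓝 0) := hy
  filter_upwards [Metric.tendsto_nhds.1 hy' (ε / 2) (by positivity)] with n hn
  have h1 : ‖(x - y) n‖ ≤ ‖x - y‖ := lp.norm_apply_le_norm (by simp) _ n
  rw [dist_eq_norm] at hxy
  have h2 : ‖x n‖ ≤ ‖(x - y) n‖ + ‖y n‖ := by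
    simpa using norm_add_le ((x - y) n) (y n)
  simp only [dist_zero_right, norm_norm] at hn ⊢
  linarith

theorem isUltrametricDist_c0Sum (E : ℕ → BanNA k) : IsUltrametricDist (c0Sum E) := by
  refine IsUltrametricDist.isUltrametricDist_of_forall_norm_add_le_max_norm fun x y => ?_
  change ‖(x : lp (fun n => E n) ⊤) + y‖ ≤ max ‖(x : lp (fun n => E n) ⊤)‖ ‖(y : lp (fun n => E n) ⊤)‖
  rw [lp.norm_eq_ciSup]
  refine ciSup_le fun n => ?_
  exact (IsUltrametricDist.norm_add_le_max _ _).trans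
    (max_le_max (lp.norm_apply_le_norm (by simp) _ n) (lp.norm_apply_le_norm (by simp) _ n))

/-- The contracting coproduct `∐^{≤1} Eₙ`: families with `lim ‖xₙ‖ = 0` and the sup norm. -/
def contrCoprod (E : ℕ → BanNA k) : BanNA k :=
  letI := isUltrametricDist_c0Sum E
  letI : CompleteSpace (c0Sum E) := (isClosed_c0Sum E).completeSpace_coe
  ⟨c0Sum E⟩

variable {E : ℕ → BanNA k}

/-- The `n`-th component of an element of a contracting coproduct. -/
def coord (x : contrCoprod E) (n : ℕ) : E n := x.1 n

theorem coord_ext {x y : contrCoprod E} (h : ∀ n, coord x n = coord y n) : x = y :=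
  Subtype.ext (lp.ext (funext h))

theorem coord_add (x y : contrCoprod E) (n : ℕ) : coord (x + y) n = coord x n + coord y n := rfl

theorem coord_smul (c : k) (x : contrCoprod E) (n : ℕ) : coord (c • x) n = c • coord x n := rfl

theorem norm_coord_le (x : contrCoprod E) (n : ℕ) : ‖coord x n‖ ≤ ‖x‖ :=
  lp.norm_apply_le_norm (by simp) x.1 n

theorem norm_le_of_coord {x : contrCoprod E} {C : ℝ} (h : ∀ n, ‖coord x n‖ ≤ C) : ‖x‖ ≤ C :=
  (lp.norm_eq_ciSup x.1).trans_le (ciSup_le h)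

theorem tendsto_coord (x : contrCoprod E) : Tendsto (fun n => ‖coord x n‖) cofinite (𝓝 0) := x.2

theorem single_mem_c0Sum (E : ℕ → BanNA k) (n : ℕ) (a : E n) :
    lp.single (E := fun n => E n) ⊤ n a ∈ c0Sum E := by
  refine tendsto_nhds_of_eventually_eq ?_
  refine (Set.finite_singleton n).subset fun m hm => ?_
  by_contra hmn
  refine hm ?_
  change ‖lp.single (E := fun n => E n) ⊤ n a m‖ = 0
  rw [lp.single_apply_ne (E := fun n => E n) ⊤ n a hmn, norm_zero]

/-- The inclusion of the `n`-th summand of a contracting coproduct. -/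
def incl (E : ℕ → BanNA k) (n : ℕ) : E n ⟶ contrCoprod E :=
  ⟨{ toFun := fun a => (⟨lp.single ⊤ n a, single_mem_c0Sum E n a⟩ : c0Sum E)
     map_add' := fun a b => Subtype.ext (lp.single_add (E := fun n => E n) ⊤ n a b)
     map_smul' := fun c a => Subtype.ext (lp.single_smul (𝕜 := k) (E := fun n => E n) ⊤ n c a) }, 1, fun a => by
      rw [one_mul]
      exact (lp.norm_single (E := fun n => E n) ENNReal.zero_lt_top n a).le⟩

theorem norm_incl (n : ℕ) (a : E n) : ‖incl E n a‖ = ‖a‖ :=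
  lp.norm_single (E := fun n => E n) ENNReal.zero_lt_top n a

@[simp] theorem coord_incl_self (n : ℕ) (a : E n) : coord (incl E n a) n = a :=
  lp.single_apply_self (E := fun n => E n) ⊤ n a

theorem coord_incl_ne {n m : ℕ} (a : E n) (h : m ≠ n) : coord (incl E n a) m = 0 :=
  lp.single_apply_ne (E := fun n => E n) ⊤ n a h

/-- The projection to the `n`-th summand. -/
def proj (E : ℕ → BanNA k) (n : ℕ) : contrCoprod E ⟶ E n :=
  ⟨{ toFun := fun x => coord x n
     map_add' := fun _ _ => rfl
     map_smul' := fun _ _ => rfl }, 1, fun x => by rw [one_mul]; exact norm_coord_le x n⟩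

theorem proj_apply (n : ℕ) (x : contrCoprod E) : proj E n x = coord x n := rfl

theorem summable_of_tendsto {X : BanNA k} {f : ℕ → X}
    (h : Tendsto (fun n => ‖f n‖) cofinite (𝓝 0)) : Summable f :=
  NonarchimedeanAddGroup.summable_of_tendsto_cofinite_zero (tendsto_zero_iff_norm_tendsto_zero.2 h)

theorem hasSum_incl (x : contrCoprod E) : HasSum (fun n => incl E n (coord x n)) x := by
  have h1 : Summable (fun n => incl E n (coord x n)) := summable_of_tendsto <| by
    simpa only [norm_incl] using tendsto_coord x
  convert h1.hasSum
  refine coord_ext fun m => ?_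
  have h2 := h1.hasSum.map (Hom.lin (proj E m)) (hom_continuous (proj E m))
  refine (HasSum.unique h2 ?_).symm
  convert hasSum_ite_eq m (coord x m) using 1
  funext n
  change coord (incl E n (coord x n)) m = _
  by_cases hnm : n = m
  · subst hnm; simp
  · rw [coord_incl_ne _ (Ne.symm hnm), if_neg hnm]

/-- Bounded maps out of a contracting coproduct agree if they agree on all summands. -/
theorem contrCoprod_ext {X : BanNA k} {f g : contrCoprod E ⟶ X}
    (h : ∀ n a, f (incl E n a) = g (incl E n a)) : f = g := by
  ext x
  have hf := (hasSum_incl x).map (Hom.lin f) (hom_continuous f)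
  have hg := (hasSum_incl x).map (Hom.lin g) (hom_continuous g)
  refine hf.unique ?_
  convert hg using 1
  funext n
  exact h n _

theorem tendsto_of_bound {X : BanNA k} (f : ∀ n, E n → X) {C : ℝ}
    (h : ∀ n a, ‖f n a‖ ≤ C * ‖a‖) (x : contrCoprod E) : Summable fun n => f n (coord x n) :=
  summable_of_tendsto <| squeeze_zero (fun _ => norm_nonneg _) (fun n => h n _) <| by
    simpa using (tendsto_coord x).const_mul C

/-- The universal property of the contracting coproduct: a uniformly bounded family of maps
induces a bounded map. -/
def desc {X : BanNA k} (f : ∀ n, E n ⟶ X) (C : ℝ) (hC : 0 ≤ C)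
    (h : ∀ n a, ‖f n a‖ ≤ C * ‖a‖) : contrCoprod E ⟶ X :=
  ⟨{ toFun := fun x => ∑' n, f n (coord x n)
     map_add' := fun x y => by
      simp only [coord_add, map_add']
      exact (tendsto_of_bound (fun n => f n) h x).tsum_add (tendsto_of_bound (fun n => f n) h y)
     map_smul' := fun c x => by
      simp only [coord_smul, map_smul', RingHom.id_apply]
      exact (tendsto_of_bound (fun n => f n) h x).tsum_const_smul c }, C, fun x =>
    IsUltrametricDist.norm_tsum_le_of_forall_le_of_nonneg (by positivity) fun n =>
      (h n _).trans (mul_le_mul_of_nonneg_left (norm_coord_le x n) hC)⟩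

@[simp] theorem desc_incl {X : BanNA k} (f : ∀ n, E n ⟶ X) (C : ℝ) (hC : 0 ≤ C)
    (h : ∀ n a, ‖f n a‖ ≤ C * ‖a‖) (n : ℕ) (a : E n) : desc f C hC h (incl E n a) = f n a := by
  refine (tsum_eq_single n fun m hm => ?_).trans (by rw [coord_incl_self])
  rw [coord_incl_ne a hm]
  exact map_zero (Hom.lin (f m))

theorem norm_desc_le {X : BanNA k} (f : ∀ n, E n ⟶ X) (C : ℝ) (hC : 0 ≤ C)
    (h : ∀ n a, ‖f n a‖ ≤ C * ‖a‖) (x : contrCoprod E) : ‖desc f C hC h x‖ ≤ C * ‖x‖ :=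
  IsUltrametricDist.norm_tsum_le_of_forall_le_of_nonneg (by positivity) fun n =>
    (h n _).trans (mul_le_mul_of_nonneg_left (norm_coord_le x n) hC)

end ContrCoprod

/-! ### Quotients -/

theorem isUltrametricDist_quotient {X : BanNA k} (I : Submodule k X) :
    IsUltrametricDist (X ⧸ I) := by
  refine IsUltrametricDist.isUltrametricDist_of_forall_norm_add_le_max_norm fun x y => ?_
  refine le_of_forall_gt_imp_ge_of_dense fun M hM => ?_
  obtain ⟨a, rfl, ha⟩ := Submodule.Quotient.norm_mk_lt x
    (sub_pos.2 ((le_max_left _ _).trans_lt hM))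
  obtain ⟨b, rfl, hb⟩ := Submodule.Quotient.norm_mk_lt y
    (sub_pos.2 ((le_max_right _ _).trans_lt hM))
  rw [add_sub_cancel] at ha hb
  rw [← Submodule.Quotient.mk_add]
  exact (Submodule.Quotient.norm_mk_le I (a + b)).trans
    ((IsUltrametricDist.norm_add_le_max a b).trans (max_le ha.le hb.le))

/-- The quotient of a Banach space by a closed subspace, with the quotient norm. -/
def quotient {X : BanNA k} (I : Submodule k X) (hI : IsClosed (I : Set X)) : BanNA k :=
  letI := isUltrametricDist_quotient I
  ⟨X ⧸ I⟩

/-- The quotient map. -/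
def quotientMap {X : BanNA k} (I : Submodule k X) (hI : IsClosed (I : Set X)) :
    X ⟶ quotient I hI :=
  ⟨I.mkQ, 1, fun x => by rw [one_mul]; exact Submodule.Quotient.norm_mk_le I x⟩

variable [IsUltrametricDist k] [CompleteSpace k]

/-! ### The bialgebra `k{t}` -/

section Disk

variable (k) in
/-- `k{t} = ∐^{≤1} k · tⁿ`. -/
def disk : BanNA k := contrCoprod fun _ : ℕ => 𝟙_ (BanNA k)

variable (k) in
/-- The morphism `k ⟶ k{t}`, `1 ↦ tⁿ`. -/
def tPow (n : ℕ) : 𝟙_ (BanNA k) ⟶ disk k :=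
  incl (fun _ : ℕ => 𝟙_ (BanNA k)) n

variable (k) in
/-- The element `1` of the unit object. -/
def sOne : (𝟙_ (BanNA k) : BanNA k) := (1 : k)

theorem toScalar_smul_sOne (c : (𝟙_ (BanNA k) : BanNA k)) : toScalar c • sOne k = c :=
  mul_one (M := k) c

theorem norm_sOne : ‖sOne k‖ = 1 := norm_one (α := k)

@[simp] theorem leftUnitor_inv_apply {A : BanNA k} (a : A) :
    (λ_ A).inv a = tmul (sOne k) a := rfl

@[simp] theorem rightUnitor_inv_apply {A : BanNA k} (a : A) :
    (ρ_ A).inv a = tmul a (sOne k) :=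
  swap_ptmul (unitOne k) a

variable (k) in
/-- The element `tⁿ` of `k{t}`. -/
def tElt (n : ℕ) : disk k := tPow k n (sOne k)

theorem tPow_apply (n : ℕ) (c : (𝟙_ (BanNA k) : BanNA k)) :
    tPow k n c = toScalar c • tElt k n := by
  rw [tElt, ← map_smul', toScalar_smul_sOne]

theorem norm_tElt (n : ℕ) : ‖tElt k n‖ = 1 := (norm_incl (E := fun _ : ℕ => 𝟙_ (BanNA k)) n _).trans norm_sOne

/-- Bounded maps out of `k{t}` agree if they agree on the powers of `t`. -/
theorem disk_ext {X : BanNA k} {f g : disk k ⟶ X} (h : ∀ n, f (tElt k n) = g (tElt k n)) :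
    f = g := contrCoprod_ext fun n c => by
  change f (tPow k n c) = g (tPow k n c)
  rw [tPow_apply, map_smul', map_smul', h]

theorem disk_apply_ext {X : BanNA k} {f g : disk k ⟶ X} (h : ∀ n, f (tElt k n) = g (tElt k n))
    (x : disk k) : f x = g x := by rw [disk_ext h]

/-- The counit `tⁿ ↦ 1` of `k{t}`. -/
def diskCounit : disk k ⟶ 𝟙_ (BanNA k) :=
  desc (fun _ => 𝟙 _) 1 zero_le_one fun _ a => (one_mul ‖a‖).ge

@[simp] theorem diskCounit_tElt (n : ℕ) : diskCounit (tElt k n) = sOne k :=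
  desc_incl (E := fun _ : ℕ => 𝟙_ (BanNA k)) _ _ _ _ n _

theorem norm_toScalar (c : (𝟙_ (BanNA k) : BanNA k)) : ‖toScalar c‖ = ‖c‖ := rfl

/-- The bounded map `k ⟶ X`, `c ↦ c • x`. -/
def pt {X : BanNA k} (x : X) : 𝟙_ (BanNA k) ⟶ X :=
  ⟨{ toFun := fun c => toScalar c • x
     map_add' := fun c d => add_smul (toScalar c) (toScalar d) x
     map_smul' := fun r c => mul_smul r (toScalar c) x }, ‖x‖, fun c =>
    (norm_smul_le (toScalar c) _).trans_eq (mul_comm _ _)⟩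

/-- The bounded map `k{t} ⟶ X`, `tⁿ ↦ xₙ`, for a bounded sequence `x`. -/
def diskDesc {X : BanNA k} (x : ℕ → X) (C : ℝ) (hC : 0 ≤ C) (h : ∀ n, ‖x n‖ ≤ C) : disk k ⟶ X :=
  desc (fun n => pt (x n)) C hC fun n a => (norm_smul_le (toScalar a) _).trans <| by
    rw [mul_comm]; exact mul_le_mul_of_nonneg_right (h n) (norm_nonneg a)

@[simp] theorem diskDesc_tElt {X : BanNA k} (x : ℕ → X) (C : ℝ) (hC : 0 ≤ C)
    (h : ∀ n, ‖x n‖ ≤ C) (n : ℕ) : diskDesc x C hC h (tElt k n) = x n :=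
  (desc_incl (E := fun _ : ℕ => 𝟙_ (BanNA k)) _ _ _ _ n _).trans (one_smul k (x n))

/-- The comultiplication `tⁿ ↦ tⁿ ⊗ tⁿ` of `k{t}`. -/
def diskComul : disk k ⟶ disk k ⊗ disk k :=
  diskDesc (fun n => tmul (tElt k n) (tElt k n)) 1 zero_le_one fun n =>
    (norm_tmul_le _ _).trans (by rw [norm_tElt, one_mul])

@[simp] theorem diskComul_tElt (n : ℕ) :
    diskComul (tElt k n) = tmul (tElt k n) (tElt k n) := diskDesc_tElt _ _ _ _ n

/-- Multiplication by `tᵐ` on `k{t}`. -/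
def shift (m : ℕ) : disk k ⟶ disk k :=
  diskDesc (fun n => tElt k (m + n)) 1 zero_le_one fun _ => (norm_tElt _).le

theorem norm_diskDesc_le {X : BanNA k} (x : ℕ → X) (C : ℝ) (hC : 0 ≤ C) (h : ∀ n, ‖x n‖ ≤ C)
    (y : disk k) : ‖diskDesc x C hC h y‖ ≤ C * ‖y‖ := norm_desc_le _ _ _ _ y

theorem norm_shift_le (m : ℕ) (x : disk k) : ‖shift m x‖ ≤ ‖x‖ :=
  (norm_diskDesc_le _ _ _ _ x).trans_eq (one_mul _)

/-- For fixed `y`, the map `x ↦ x y` on `k{t}`. -/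
def diskMulRight (y : disk k) : disk k ⟶ disk k :=
  diskDesc (fun m => shift m y) ‖y‖ (norm_nonneg y) fun m => norm_shift_le m y

theorem norm_diskMulRight_le (y x : disk k) : ‖diskMulRight y x‖ ≤ ‖y‖ * ‖x‖ :=
  norm_diskDesc_le _ _ _ _ x

/-- The multiplication of `k{t}`, `tᵐ ⊗ tⁿ ↦ tᵐ⁺ⁿ`. -/
def diskMul : disk k ⊗ disk k ⟶ disk k :=
  lift (fun x y => diskMulRight y x)
    (fun x x' y => map_add' _ x x') (fun c x y => map_smul' _ c x)
    (fun x y y' => by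
      have : diskMulRight (y + y') = (⟨Hom.lin (diskMulRight y) + Hom.lin (diskMulRight y'), by
          refine ⟨‖y‖ + ‖y'‖, fun x => (norm_add_le _ _).trans ?_⟩
          rw [add_mul]
          exact add_le_add (norm_diskMulRight_le y x) (norm_diskMulRight_le y' x)⟩ :
          disk k ⟶ disk k) := disk_ext fun m => by
        change _ = diskMulRight y (tElt k m) + diskMulRight y' (tElt k m)
        simp only [diskMulRight, diskDesc_tElt, map_add']
      exact congrArg (fun F : disk k ⟶ disk k => F x) this)
    (fun c x y => by
      have : diskMulRight (c • y) = (⟨c • Hom.lin (diskMulRight y), by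
          refine ⟨‖c‖ * ‖y‖, fun x => ?_⟩
          change ‖c • diskMulRight y x‖ ≤ _
          rw [norm_smul, mul_assoc]
          exact mul_le_mul_of_nonneg_left (norm_diskMulRight_le _ x) (norm_nonneg c)⟩ :
          disk k ⟶ disk k) := disk_ext fun m => by
        change _ = c • diskMulRight y (tElt k m)
        simp only [diskMulRight, diskDesc_tElt, map_smul']
      exact congrArg (fun F : disk k ⟶ disk k => F x) this)
    1 zero_le_one fun x y => (norm_diskMulRight_le _ x).trans_eq (by ring)

@[simp] theorem diskMul_tElt (m n : ℕ) :
    diskMul (tmul (tElt k m) (tElt k n)) = tElt k (m + n) :=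
  (lift_ptmul _ _ _ _ _ _ _ _ _ _).trans
    ((diskDesc_tElt _ _ _ _ m).trans (diskDesc_tElt _ _ _ _ n))

/-- The bounded map `a ↦ a ⊗ b`. -/
def tmulR (A : BanNA k) {B : BanNA k} (b : B) : A ⟶ A ⊗ B := tmulRight A b

/-- The bounded map `b ↦ a ⊗ b`. -/
def tmulL {A : BanNA k} (B : BanNA k) (a : A) : B ⟶ A ⊗ B := tmulLeft B a

theorem tmulR_apply {A B : BanNA k} (a : A) (b : B) : tmulR A b a = tmul a b := rfl

theorem tmulL_apply {A B : BanNA k} (a : A) (b : B) : tmulL B a b = tmul a b := rfl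

instance : MonObj (disk k) where
  one := tPow k 0
  mul := diskMul
  one_mul := tensor_ext fun c x => by
    simp only [comp_apply, whiskerRight_tmul, leftUnitor_hom_tmul, tPow_apply, smul_tmul,
      map_smul']
    congr 1
    exact disk_apply_ext (f := tmulL (disk k) (tElt k 0) ≫ diskMul) (g := 𝟙 _)
      (fun n => by simp [tmulL_apply]) x
  mul_one := tensor_ext fun x c => by
    simp only [comp_apply, whiskerLeft_tmul, rightUnitor_hom_tmul, tPow_apply, tmul_smul,
      map_smul']
    congr 1
    exact disk_apply_ext (f := tmulR (disk k) (tElt k 0) ≫ diskMul) (g := 𝟙 _)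
      (fun n => by simp [tmulR_apply]) x
  mul_assoc := tensor_ext_left fun x y z => by
    refine disk_apply_ext (f := tmulR (disk k) y ≫ tmulR (disk k ⊗ disk k) z ≫ diskMul ▷ _ ≫
      diskMul) (g := tmulR (disk k) y ≫ tmulR (disk k ⊗ disk k) z ≫ (α_ _ _ _).hom ≫
      _ ◁ diskMul ≫ diskMul) (fun l => ?_) x
    refine disk_apply_ext (f := tmulL (disk k) (tElt k l) ≫ tmulR (disk k ⊗ disk k) z ≫
      diskMul ▷ _ ≫ diskMul) (g := tmulL (disk k) (tElt k l) ≫ tmulR (disk k ⊗ disk k) z ≫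
      (α_ _ _ _).hom ≫ _ ◁ diskMul ≫ diskMul) (fun m => ?_) y
    refine disk_apply_ext (f := tmulL (disk k) (tmul (tElt k l) (tElt k m)) ≫
      diskMul ▷ _ ≫ diskMul) (g := tmulL (disk k) (tmul (tElt k l) (tElt k m)) ≫
      (α_ _ _ _).hom ≫ _ ◁ diskMul ≫ diskMul) (fun n => ?_) z
    simp [tmulL_apply, add_assoc]

instance : ComonObj (disk k) where
  counit := diskCounit
  comul := diskComul
  counit_comul := disk_ext fun n => by
    simp only [comp_apply, diskComul_tElt, whiskerRight_tmul]
    rw [diskCounit_tElt, leftUnitor_inv_apply]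
  comul_counit := disk_ext fun n => by
    simp only [comp_apply, diskComul_tElt, whiskerLeft_tmul]
    rw [diskCounit_tElt, rightUnitor_inv_apply]
  comul_assoc := disk_ext fun n => by simp

end Disk

/-! ### The Banach tensor algebra -/

section TensorAlgebra

/-- The completed tensor powers `V^{⊗̂n}`. -/
def tensorPow (V : BanNA k) : ℕ → BanNA k
  | 0 => 𝟙_ (BanNA k)
  | n + 1 => tensorPow V n ⊗ V

/-- The canonical map `V^{⊗̂n} ⊗̂ V^{⊗̂m} ⟶ V^{⊗̂(n+m)}`. -/
def tensorPowMul (V : BanNA k) (n : ℕ) : ∀ m : ℕ, tensorPow V n ⊗ tensorPow V m ⟶ tensorPow V (n + m)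
  | 0 => (ρ_ (tensorPow V n)).hom
  | m + 1 => (α_ (tensorPow V n) (tensorPow V m) V).inv ≫ tensorPowMul V n m ▷ V

/-- The map `V^{⊗̂n} ⊗̂ V ⟶ V ⊗̂ V^{⊗̂n}` obtained by moving the last factor past the others with
the help of `c`. -/
def braidPow₁ {V : BanNA k} (c : V ⊗ V ⟶ V ⊗ V) : ∀ n : ℕ, tensorPow V n ⊗ V ⟶ V ⊗ tensorPow V n
  | 0 => (λ_ V).hom ≫ (ρ_ V).inv
  | n + 1 => (α_ (tensorPow V n) V V).hom ≫ tensorPow V n ◁ c ≫ (α_ (tensorPow V n) V V).inv ≫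
      braidPow₁ c n ▷ V ≫ (α_ V (tensorPow V n) V).hom

/-- The map `c_{n,m} : V^{⊗̂n} ⊗̂ V^{⊗̂m} ⟶ V^{⊗̂m} ⊗̂ V^{⊗̂n}` induced by `c`. -/
def braidPow {V : BanNA k} (c : V ⊗ V ⟶ V ⊗ V) (n : ℕ) :
    ∀ m : ℕ, tensorPow V n ⊗ tensorPow V m ⟶ tensorPow V m ⊗ tensorPow V n
  | 0 => (ρ_ (tensorPow V n)).hom ≫ (λ_ (tensorPow V n)).inv
  | m + 1 => (α_ (tensorPow V n) (tensorPow V m) V).inv ≫ braidPow c n m ▷ V ≫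
      (α_ (tensorPow V m) (tensorPow V n) V).hom ≫ tensorPow V m ◁ braidPow₁ c n ≫
      (α_ (tensorPow V m) V (tensorPow V n)).inv

/-- The Banach tensor algebra `T(V) = ∐^{≤1} V^{⊗̂n}`, as a Banach space. -/
def tensorAlg (V : BanNA k) : BanNA k := contrCoprod (tensorPow V)

/-- The inclusion `V ≅ V^{⊗̂1} ⟶ T(V)`. -/
def inclV (V : BanNA k) : V ⟶ tensorAlg V := (λ_ V).inv ≫ incl (tensorPow V) 1

end TensorAlgebra

/-! ### Pre-braided Hopf algebras -/

section Hopf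

open MonObj ComonObj

/-- A pre-braiding: a solution of the hexagon (braid) equation, not necessarily invertible. -/
def IsPreBraiding {V : BanNA k} (c : V ⊗ V ⟶ V ⊗ V) : Prop :=
  c ▷ V ≫ (α_ V V V).hom ≫ V ◁ c ≫ (α_ V V V).inv ≫ c ▷ V ≫ (α_ V V V).hom =
    (α_ V V V).hom ≫ V ◁ c ≫ (α_ V V V).inv ≫ c ▷ V ≫ (α_ V V V).hom ≫ V ◁ c

/-- The map `Id ⊗ c ⊗ Id` on `(X ⊗̂ X) ⊗̂ (X ⊗̂ X)`. -/
def midMap {X : BanNA k} (c : X ⊗ X ⟶ X ⊗ X) : (X ⊗ X) ⊗ (X ⊗ X) ⟶ (X ⊗ X) ⊗ (X ⊗ X) :=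
  (α_ X X (X ⊗ X)).hom ≫ X ◁ (α_ X X X).inv ≫ X ◁ (c ▷ X) ≫ X ◁ (α_ X X X).hom ≫
    (α_ X X (X ⊗ X)).inv

/-- An algebra and coalgebra `X` with `c : X ⊗̂ X ⟶ X ⊗̂ X` is a pre-braided Banach bialgebra. -/
structure IsPreBraidedBialgebra (X : BanNA k) [MonObj X] [ComonObj X]
    (c : X ⊗ X ⟶ X ⊗ X) : Prop where
  preBraiding : IsPreBraiding c
  one_left : η[X] ▷ X ≫ c = (λ_ X).hom ≫ (ρ_ X).inv ≫ X ◁ η[X]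
  one_right : X ◁ η[X] ≫ c = (ρ_ X).hom ≫ (λ_ X).inv ≫ η[X] ▷ X
  mul_left : μ[X] ▷ X ≫ c = (α_ X X X).hom ≫ X ◁ c ≫ (α_ X X X).inv ≫ c ▷ X ≫
    (α_ X X X).hom ≫ X ◁ μ[X]
  mul_right : X ◁ μ[X] ≫ c = (α_ X X X).inv ≫ c ▷ X ≫ (α_ X X X).hom ≫ X ◁ c ≫
    (α_ X X X).inv ≫ μ[X] ▷ X
  counit_left : c ≫ ε[X] ▷ X ≫ (λ_ X).hom = X ◁ ε[X] ≫ (ρ_ X).hom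
  counit_right : c ≫ X ◁ ε[X] ≫ (ρ_ X).hom = ε[X] ▷ X ≫ (λ_ X).hom
  comul_left : Δ[X] ▷ X ≫ (α_ X X X).hom ≫ X ◁ c ≫ (α_ X X X).inv ≫ c ▷ X ≫ (α_ X X X).hom =
    c ≫ X ◁ Δ[X]
  comul_right : X ◁ Δ[X] ≫ (α_ X X X).inv ≫ c ▷ X ≫ (α_ X X X).hom ≫ X ◁ c ≫ (α_ X X X).inv =
    c ≫ Δ[X] ▷ X
  mul_comul : μ[X] ≫ Δ[X] = (Δ[X] ⊗ₘ Δ[X]) ≫ midMap c ≫ (μ[X] ⊗ₘ μ[X])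
  one_comul : η[X] ≫ Δ[X] = (λ_ (𝟙_ (BanNA k))).inv ≫ (η[X] ⊗ₘ η[X])
  one_counit : η[X] ≫ ε[X] = 𝟙 (𝟙_ (BanNA k))
  mul_counit : μ[X] ≫ ε[X] = (ε[X] ⊗ₘ ε[X]) ≫ (λ_ (𝟙_ (BanNA k))).hom

/-- A coaction of `k{t}`, i.e. an analytic grading. -/
structure IsCoaction {X : BanNA k} (ρ : X ⟶ disk k ⊗ X) : Prop where
  coassoc : ρ ≫ disk k ◁ ρ = ρ ≫ Δ[disk k] ▷ X ≫ (α_ (disk k) (disk k) X).hom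
  counit : ρ ≫ ε[disk k] ▷ X = (λ_ X).inv

/-- The coaction of `k{t} ⊗̂ k{t}` on `X ⊗̂ X`. -/
def coaction₂ {X : BanNA k} (ρ : X ⟶ disk k ⊗ X) : X ⊗ X ⟶ (disk k ⊗ disk k) ⊗ (X ⊗ X) :=
  (ρ ⊗ₘ ρ) ≫ tensorμ (disk k) X (disk k) X

/-- An analytically graded pre-braided Banach Hopf algebra structure on the Banach space `X`.
As the pre-braiding interchanges the two tensor factors, it is a comodule homomorphism over
`k{t} ⊗̂ k{t}` up to the interchange of the two factors `k{t}`; that is, it maps the part of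
bidegree `(m, n)` to the part of bidegree `(n, m)`. -/
structure GradedHopf (X : BanNA k) where
  [mon : MonObj X]
  [comon : ComonObj X]
  /-- the pre-braiding -/
  braid : X ⊗ X ⟶ X ⊗ X
  /-- the coaction defining the analytic grading -/
  coact : X ⟶ disk k ⊗ X
  /-- the antipode -/
  antipode : X ⟶ X
  bialgebra : IsPreBraidedBialgebra X braid
  antipode_left : Δ[X] ≫ antipode ▷ X ≫ μ[X] = ε[X] ≫ η[X]
  antipode_right : Δ[X] ≫ X ◁ antipode ≫ μ[X] = ε[X] ≫ η[X]
  isCoaction : IsCoaction coact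
  one_graded : η[X] ≫ coact = (λ_ (𝟙_ (BanNA k))).inv ≫ (η[disk k] ⊗ₘ η[X])
  mul_graded : μ[X] ≫ coact = coaction₂ coact ≫ (μ[disk k] ⊗ₘ μ[X])
  counit_graded : coact ≫ disk k ◁ ε[X] = ε[X] ≫ (λ_ (𝟙_ (BanNA k))).inv ≫ η[disk k] ▷ 𝟙_ (BanNA k)
  comul_graded : coact ≫ disk k ◁ Δ[X] = Δ[X] ≫ coaction₂ coact ≫ μ[disk k] ▷ (X ⊗ X)
  braid_graded : braid ≫ coaction₂ coact =
    coaction₂ coact ≫ ((β_ (disk k) (disk k)).hom ⊗ₘ braid)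
  antipode_graded : antipode ≫ coact = coact ≫ disk k ◁ antipode

namespace GradedHopf

variable {X Y : BanNA k} (H : GradedHopf X)

def one : X := H.mon.one (1 : k)

def mul (x y : X) : X := H.mon.mul (tmul x y)

def comul : X ⟶ X ⊗ X := H.comon.comul

def counit : X ⟶ 𝟙_ (BanNA k) := H.comon.counit

/-- The graded piece `X(n)`: the equaliser of the coaction and of `x ↦ tⁿ ⊗ x`. -/
def piece (n : ℕ) : Set X := {x | H.coact x = tmul (tElt k n) x}

/-- The primitive subspace `P(X)`. -/
def primitives : Set X := {x | H.comul x = tmul H.one x + tmul x H.one}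

/-- `X` is generated as a Banach algebra by `W`: no proper closed subalgebra contains `W`;
equivalently, every bounded algebra homomorphism whose image contains `W` has dense image. -/
def GeneratedBy (W : Set X) : Prop :=
  ∀ S : Submodule k X, IsClosed (S : Set X) → H.one ∈ S → (∀ x ∈ S, ∀ y ∈ S, H.mul x y ∈ S) →
    W ⊆ S → S = ⊤

/-- Morphisms of analytically graded pre-braided Banach Hopf algebras. -/
structure IsHom (H : GradedHopf X) (K : GradedHopf Y) (f : X ⟶ Y) : Prop where
  one : H.mon.one ≫ f = K.mon.one
  mul : H.mon.mul ≫ f = (f ⊗ₘ f) ≫ K.mon.mul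
  counit : f ≫ K.comon.counit = H.comon.counit
  comul : f ≫ K.comon.comul = H.comon.comul ≫ (f ⊗ₘ f)
  braid : H.braid ≫ (f ⊗ₘ f) = (f ⊗ₘ f) ≫ K.braid
  antipode : H.antipode ≫ f = f ≫ K.antipode
  coact : f ≫ K.coact = H.coact ≫ disk k ◁ f

end GradedHopf

end Hopf

/-! ### Analytic Nichols algebras -/

section Nichols

/-- Strict monomorphisms: bounded linear isomorphisms onto a closed subspace. -/
def IsStrictMono {A B : BanNA k} (i : A ⟶ B) : Prop := ∃ C : ℝ, ∀ x, ‖x‖ ≤ C * ‖i x‖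

/-- `i` is a kernel of `f`. -/
def IsKernelOf {K A B : BanNA k} (i : K ⟶ A) (f : A ⟶ B) : Prop :=
  IsStrictMono i ∧ Set.range i = {x | f x = 0}

/-- `X` is flat: `X ⊗̂ -` preserves the kernels of all morphisms. -/
def IsFlat (X : BanNA k) : Prop :=
  ∀ ⦃K A B : BanNA k⦄ (i : K ⟶ A) (f : A ⟶ B), IsKernelOf i f → IsKernelOf (X ◁ i) (X ◁ f)

/-- The analytically graded pre-braided Hopf algebra `R` is an analytic Nichols algebra of the
pre-braided Banach space `(V, c)`. -/
structure IsAnalyticNichols {V : BanNA k} (c : V ⊗ V ⟶ V ⊗ V) {X : BanNA k}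
    (R : GradedHopf X) : Prop where
  flat : IsFlat X
  piece_zero : ∃ i : 𝟙_ (BanNA k) ⟶ X, IsStrictMono i ∧ Set.range i = R.piece 0
  primitives_eq : R.primitives = R.piece 1
  piece_one : ∃ i : V ⟶ X, IsStrictMono i ∧ Set.range i = R.piece 1 ∧
    c ≫ (i ⊗ₘ i) = (i ⊗ₘ i) ≫ R.braid
  generated : R.GeneratedBy (R.piece 1)

/-- `T` is the analytically graded pre-braided Hopf algebra structure on `T(V)` induced by `c`:
the multiplication is concatenation, `V` consists of primitive elements, the pre-braiding restricts
to the maps `c_{n,m}`, and `V^{⊗̂n}` has degree `n`. (These properties determine `T`.) -/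
structure IsTensorHopf {V : BanNA k} (c : V ⊗ V ⟶ V ⊗ V) (T : GradedHopf (tensorAlg V)) :
    Prop where
  one : T.mon.one = incl (tensorPow V) 0
  mul : ∀ n m, (incl (tensorPow V) n ⊗ₘ incl (tensorPow V) m) ≫ T.mon.mul =
    tensorPowMul V n m ≫ incl (tensorPow V) (n + m)
  comul : ∀ v : V, T.comul (inclV V v) = tmul T.one (inclV V v) + tmul (inclV V v) T.one
  braid : ∀ n m, (incl (tensorPow V) n ⊗ₘ incl (tensorPow V) m) ≫ T.braid =
    braidPow c n m ≫ (incl (tensorPow V) m ⊗ₘ incl (tensorPow V) n)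
  coact : ∀ n, incl (tensorPow V) n ≫ T.coact =
    (λ_ (tensorPow V n)).inv ≫ (tPow k n ⊗ₘ incl (tensorPow V) n)

/-- `I` is a closed homogeneous ideal of `T(V)`, contained in `∐_{n ≥ 2} V^{⊗̂n}`, that is also a
coideal. -/
structure IsNicholsIdeal {V : BanNA k} (T : GradedHopf (tensorAlg V))
    (I : Submodule k (tensorAlg V)) : Prop where
  closed : IsClosed (I : Set (tensorAlg V))
  homogeneous : ∀ x ∈ I, ∀ n, incl (tensorPow V) n (coord x n) ∈ I
  degree_ge_two : ∀ x ∈ I, coord x 0 = 0 ∧ coord x 1 = 0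
  mul_left : ∀ a, ∀ x ∈ I, T.mul a x ∈ I
  mul_right : ∀ x ∈ I, ∀ a, T.mul x a ∈ I
  counit : ∀ x ∈ I, T.counit x = 0
  comul : ∀ x ∈ I, T.comul x ∈ closure (Submodule.span k
    {z | ∃ a b, (a ∈ I ∨ b ∈ I) ∧ z = tmul a b} : Set (tensorAlg V ⊗ tensorAlg V : BanNA k))

end Nichols

end BanNA

end

set_option linter.unusedSimpArgs false
set_option linter.unusedSectionVars false

/-! ### Morphisms acting on the head of a right-nested tensor product -/

namespace Tail

universe v w

variable {C : Type w} [Category.{v} C] [MonoidalCategory C]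

/-! Everything on T(V) is built by recursion on words. Product, pre-braiding, comultiplication,
counit and antipode are each fixed by their value on the empty word and by the effect of appending
one letter. Since `c` has norm at most 1, every component is a contraction, so the components
assemble to bounded maps on the contracting coproduct. The Hopf axioms follow by induction on word
length, carried out in an arbitrary preadditive monoidal category for the abstract recursion
`Tail.Data`; the braid equation for `c` enters once, in `B_braid`.

The largest ideal is exhibited explicitly: it is the kernel of the quantum symmetrizer 𝔖, given by 𝔖
= ηε + μ(𝔖 ⊗ 1)d with d = (1 ⊗ π₁)Δ, where π₁ is the projection to degree one. Words are free, so
the last letter can be split off, and 𝔖x = 0 forces (𝔖 ⊗ 1)dx = 0 (`𝔖_δ`). Together with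
coassociativity and the braided Leibniz rule for d this makes the kernel a coideal (`comul_ker`) and
an ideal (`mul_ker`). Conversely, if J is an admissible ideal, then Δ sends J into the closure of J
⊗ T + T ⊗ J, and J has no component in degree one; induction on the degree gives 𝔖 = 0 on J
(`isGreatest_nicholsIdeal`).

The analytic input is that every non-Archimedean Banach space is flat and that tensoring preserves
injective maps, even those without closed range (`whiskerLeft_injective`, `isFlat`). Each element of
a completed tensor product comes from a nearly orthogonal sum of lines in one factor, and tensoring
with such a sum can be done line by line.

Let q be the quotient map by the kernel of 𝔖. Then 𝔖 is q followed by an injective map ι, which need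
not be strict. As ι ⊗ ι is again injective, q ⊗ q and 𝔖 ⊗ 𝔖 have the same kernel
(`tensorHom_toNichols_eq_zero_iff`). Since 𝔖 ⊗ 𝔖 commutes with the pre-braiding and (𝔖 ⊗ 𝔖)Δ kills
the ideal, the pre-braiding and Δ descend; the antipode descends by induction on the degree
(`toNichols_antipode_degProj`). If q(x) is primitive, applying ι ⊗ ι to its coproduct and reading
off degrees shows that 𝔖x is the degree one part of x, so primitives have degree one. -/

def t22 {X Y Z U : C} (f : X ⊗ Y ⟶ Z ⊗ U) (W : C) : X ⊗ (Y ⊗ W) ⟶ Z ⊗ (U ⊗ W) :=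
  (α_ X Y W).inv ≫ f ▷ W ≫ (α_ Z U W).hom

/-- In `t22`, `t21` and so on, the two digits count the tensor factors that the head map consumes
and produces, with 0 for the unit object. The tail `W` is not touched. Keeping all objects
right-nested hides the associators, so that equations between such maps read like equations between
strings. -/
def t21 {X Y Z : C} (f : X ⊗ Y ⟶ Z) (W : C) : X ⊗ (Y ⊗ W) ⟶ Z ⊗ W :=
  (α_ X Y W).inv ≫ f ▷ W

def t12 {X Y Z : C} (f : X ⟶ Y ⊗ Z) (W : C) : X ⊗ W ⟶ Y ⊗ (Z ⊗ W) :=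
  f ▷ W ≫ (α_ Y Z W).hom

def t01 {X : C} (f : 𝟙_ C ⟶ X) (W : C) : W ⟶ X ⊗ W := (λ_ W).inv ≫ f ▷ W

def t10 {X : C} (f : X ⟶ 𝟙_ C) (W : C) : X ⊗ W ⟶ W := f ▷ W ≫ (λ_ W).hom

def t11 {X Y : C} (f : X ⟶ Y) (W : C) : X ⊗ W ⟶ Y ⊗ W := f ▷ W

/-! ### Rewriting inside composites and under whiskering; naturality in the tail -/

theorem whisk {P X Y Y' Z : C} {f : X ⟶ Y} {g : Y ⟶ Z} {f' : X ⟶ Y'} {g' : Y' ⟶ Z}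
    (h : f ≫ g = f' ≫ g') : P ◁ f ≫ P ◁ g = P ◁ f' ≫ P ◁ g' := by
  simp only [← MonoidalCategory.whiskerLeft_comp, h]

/-- This and its variants turn an equation between composites into a rewrite rule that applies in
the middle of a longer composite, possibly whiskered. They are terms rather than attributes because
the equations are fields of a structure variable. -/
theorem comp_eq {X Y Z Q : C} {f : X ⟶ Y} {g : Y ⟶ Z} {k : X ⟶ Z} (e : f ≫ g = k) (h : Z ⟶ Q) :
    f ≫ g ≫ h = k ≫ h := by
  rw [← e, Category.assoc]

theorem whisk_eq (P : C) {X Y Z : C} {f : X ⟶ Y} {g : Y ⟶ Z} {k : X ⟶ Z} (e : f ≫ g = k) :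
    P ◁ f ≫ P ◁ g = P ◁ k := by
  rw [← e, MonoidalCategory.whiskerLeft_comp]

theorem comp_eq₃ {X Y Y' Z Q : C} {f : X ⟶ Y} {g : Y ⟶ Y'} {g' : Y' ⟶ Z} {k : X ⟶ Z}
    (e : f ≫ g ≫ g' = k) (h : Z ⟶ Q) : f ≫ g ≫ g' ≫ h = k ≫ h := by
  rw [← e, Category.assoc, Category.assoc]

theorem whisk_eq₃ (P : C) {X Y Y' Z : C} {f : X ⟶ Y} {g : Y ⟶ Y'} {g' : Y' ⟶ Z} {k : X ⟶ Z}
    (e : f ≫ g ≫ g' = k) : P ◁ f ≫ P ◁ g ≫ P ◁ g' = P ◁ k := by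
  rw [← e, MonoidalCategory.whiskerLeft_comp, MonoidalCategory.whiskerLeft_comp]

theorem comp_congr {X Y Y' Z Q : C} {f : X ⟶ Y} {g : Y ⟶ Z} {f' : X ⟶ Y'} {g' : Y' ⟶ Z}
    (e : f ≫ g = f' ≫ g') (h : Z ⟶ Q) : f ≫ g ≫ h = f' ≫ g' ≫ h := by
  rw [← Category.assoc, e, Category.assoc]

/-- Bifunctoriality: head and tail maps commute. As simp rules, this family moves head maps to the
front and tail maps to the back, which gives a normal form for the inductions below. The index ₁
marks the version under one more whiskering. -/
theorem t22_nat {X Y Z U : C} (f : X ⊗ Y ⟶ Z ⊗ U) {W W' : C} (g : W ⟶ W') :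
    X ◁ Y ◁ g ≫ t22 f W' = t22 f W ≫ Z ◁ U ◁ g := by
  simp only [t22, Category.assoc, associator_inv_naturality_right_assoc, whisker_exchange_assoc,
    associator_naturality_right]

theorem t22_nat_assoc {X Y Z U : C} (f : X ⊗ Y ⟶ Z ⊗ U) {W W' R : C} (g : W ⟶ W')
    (h : Z ⊗ ( U ⊗ ( W')) ⟶ R) :
    X ◁ Y ◁ g ≫ t22 f W' ≫ h = t22 f W ≫ Z ◁ U ◁ g ≫ h :=
  comp_congr (t22_nat f g) h

theorem t22_nat₁ {X Y Z U : C} (f : X ⊗ Y ⟶ Z ⊗ U) {P W W' : C} (g : W ⟶ W') :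
    P ◁ X ◁ Y ◁ g ≫ P ◁ t22 f W' = P ◁ t22 f W ≫ P ◁ Z ◁ U ◁ g :=
  whisk (t22_nat f g)

theorem t22_nat₁_assoc {X Y Z U : C} (f : X ⊗ Y ⟶ Z ⊗ U) {P W W' R : C} (g : W ⟶ W')
    (h : P ⊗ ( Z ⊗ ( U ⊗ ( W'))) ⟶ R) :
    P ◁ X ◁ Y ◁ g ≫ P ◁ t22 f W' ≫ h = P ◁ t22 f W ≫ P ◁ Z ◁ U ◁ g ≫ h :=
  comp_congr (t22_nat₁ f g) h

theorem t21_nat {X Y Z : C} (f : X ⊗ Y ⟶ Z) {W W' : C} (g : W ⟶ W') :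
    X ◁ Y ◁ g ≫ t21 f W' = t21 f W ≫ Z ◁ g := by
  simp only [t21, Category.assoc, associator_inv_naturality_right_assoc, whisker_exchange]

theorem t21_nat_assoc {X Y Z : C} (f : X ⊗ Y ⟶ Z) {W W' R : C} (g : W ⟶ W')
    (h : Z ⊗ ( W') ⟶ R) :
    X ◁ Y ◁ g ≫ t21 f W' ≫ h = t21 f W ≫ Z ◁ g ≫ h :=
  comp_congr (t21_nat f g) h

theorem t12_nat {X Y Z : C} (f : X ⟶ Y ⊗ Z) {W W' : C} (g : W ⟶ W') :
    X ◁ g ≫ t12 f W' = t12 f W ≫ Y ◁ Z ◁ g := by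
  simp only [t12, Category.assoc, whisker_exchange_assoc, associator_naturality_right]

theorem t12_nat_assoc {X Y Z : C} (f : X ⟶ Y ⊗ Z) {W W' R : C} (g : W ⟶ W')
    (h : Y ⊗ ( Z ⊗ ( W')) ⟶ R) :
    X ◁ g ≫ t12 f W' ≫ h = t12 f W ≫ Y ◁ Z ◁ g ≫ h :=
  comp_congr (t12_nat f g) h

theorem t01_nat {X : C} (f : 𝟙_ C ⟶ X) {W W' : C} (g : W ⟶ W') :
    g ≫ t01 f W' = t01 f W ≫ X ◁ g := by
  simp only [t01, Category.assoc, leftUnitor_inv_naturality_assoc, whisker_exchange]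

theorem t01_nat_assoc {X : C} (f : 𝟙_ C ⟶ X) {W W' R : C} (g : W ⟶ W')
    (h : X ⊗ ( W') ⟶ R) :
    g ≫ t01 f W' ≫ h = t01 f W ≫ X ◁ g ≫ h :=
  comp_congr (t01_nat f g) h

theorem t01_nat₁ {X : C} (f : 𝟙_ C ⟶ X) {P W W' : C} (g : W ⟶ W') :
    P ◁ g ≫ P ◁ t01 f W' = P ◁ t01 f W ≫ P ◁ X ◁ g :=
  whisk (t01_nat f g)

theorem t01_nat₁_assoc {X : C} (f : 𝟙_ C ⟶ X) {P W W' R : C} (g : W ⟶ W')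
    (h : P ⊗ ( X ⊗ ( W')) ⟶ R) :
    P ◁ g ≫ P ◁ t01 f W' ≫ h = P ◁ t01 f W ≫ P ◁ X ◁ g ≫ h :=
  comp_congr (t01_nat₁ f g) h

theorem t10_nat {X : C} (f : X ⟶ 𝟙_ C) {W W' : C} (g : W ⟶ W') :
    X ◁ g ≫ t10 f W' = t10 f W ≫ g := by
  simp only [t10, Category.assoc, whisker_exchange_assoc, leftUnitor_naturality]

theorem t10_nat_assoc {X : C} (f : X ⟶ 𝟙_ C) {W W' R : C} (g : W ⟶ W')
    (h : W' ⟶ R) :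
    X ◁ g ≫ t10 f W' ≫ h = t10 f W ≫ g ≫ h :=
  comp_congr (t10_nat f g) h

theorem t10_nat₁ {X : C} (f : X ⟶ 𝟙_ C) {P W W' : C} (g : W ⟶ W') :
    P ◁ X ◁ g ≫ P ◁ t10 f W' = P ◁ t10 f W ≫ P ◁ g :=
  whisk (t10_nat f g)

theorem t10_nat₁_assoc {X : C} (f : X ⟶ 𝟙_ C) {P W W' R : C} (g : W ⟶ W')
    (h : P ⊗ ( W') ⟶ R) :
    P ◁ X ◁ g ≫ P ◁ t10 f W' ≫ h = P ◁ t10 f W ≫ P ◁ g ≫ h :=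
  comp_congr (t10_nat₁ f g) h

theorem t11_nat {X Y : C} (f : X ⟶ Y) {W W' : C} (g : W ⟶ W') :
    X ◁ g ≫ t11 f W' = t11 f W ≫ Y ◁ g := by
  simp only [t11, whisker_exchange]

theorem t11_nat_assoc {X Y : C} (f : X ⟶ Y) {W W' R : C} (g : W ⟶ W')
    (h : Y ⊗ ( W') ⟶ R) :
    X ◁ g ≫ t11 f W' ≫ h = t11 f W ≫ Y ◁ g ≫ h :=
  comp_congr (t11_nat f g) h

theorem t11_nat₁ {X Y : C} (f : X ⟶ Y) {P W W' : C} (g : W ⟶ W') :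
    P ◁ X ◁ g ≫ P ◁ t11 f W' = P ◁ t11 f W ≫ P ◁ Y ◁ g :=
  whisk (t11_nat f g)

theorem t11_nat₁_assoc {X Y : C} (f : X ⟶ Y) {P W W' R : C} (g : W ⟶ W')
    (h : P ⊗ ( Y ⊗ ( W')) ⟶ R) :
    P ◁ X ◁ g ≫ P ◁ t11 f W' ≫ h = P ◁ t11 f W ≫ P ◁ Y ◁ g ≫ h :=
  comp_congr (t11_nat₁ f g) h

/-- The recursive description of the structure maps of a braided tensor algebra, in terms of
morphisms acting on the head of right-nested tensor products. -/
structure Data [Preadditive C] (V T : C) where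
  b : V ⊗ V ⟶ V ⊗ V
  e : ℕ → C
  i : ∀ n, e n ⟶ T
  one : 𝟙_ C ⟶ T
  app : T ⊗ V ⟶ T
  mul : T ⊗ T ⟶ T
  B : T ⊗ V ⟶ V ⊗ T
  β : T ⊗ T ⟶ T ⊗ T
  Δ : T ⟶ T ⊗ T
  ε : T ⟶ 𝟙_ C
  S : T ⟶ T
  -- The inclusions of the homogeneous parts are jointly epimorphic, also after tensoring on both
  -- sides. This is all that replaces the coproduct in the abstract setting.
  ext : ∀ {P W X : C} (f g : P ⊗ (T ⊗ W) ⟶ X),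
    (∀ n, P ◁ (i n ▷ W) ≫ f = P ◁ (i n ▷ W) ≫ g) → f = g
  zero_iso : e 0 ≅ 𝟙_ C
  succ_iso : ∀ n, e (n + 1) ≅ e n ⊗ V
  i_zero : i 0 = zero_iso.hom ≫ one
  i_succ : ∀ n, i (n + 1) = (succ_iso n).hom ≫ i n ▷ V ≫ app
  braid : ∀ W, t22 b (V ⊗ W) ≫ V ◁ t22 b W ≫ t22 b (V ⊗ W) =
    V ◁ t22 b W ≫ t22 b (V ⊗ W) ≫ V ◁ t22 b W
  mul_one : ∀ W, T ◁ t01 one W ≫ t21 mul W = 𝟙 _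
  mul_app : ∀ W, T ◁ t21 app W ≫ t21 mul W = t21 mul (V ⊗ W) ≫ t21 app W
  B_one : ∀ W, t01 one (V ⊗ W) ≫ t22 B W = V ◁ t01 one W
  B_app : ∀ W, t21 app (V ⊗ W) ≫ t22 B W = T ◁ t22 b W ≫ t22 B (V ⊗ W) ≫ V ◁ t21 app W
  β_one : ∀ W, T ◁ t01 one W ≫ t22 β W = t01 one (T ⊗ W)
  β_app : ∀ W, T ◁ t21 app W ≫ t22 β W = t22 β (V ⊗ W) ≫ T ◁ t22 B W ≫ t21 app (T ⊗ W)
  Δ_one : ∀ W, t01 one W ≫ t12 Δ W = t01 one W ≫ t01 one (T ⊗ W)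
  -- Multiplicativity of Δ for right multiplication by a primitive letter: the letter goes to the
  -- second factor, or it moves past the second factor and joins the first.
  Δ_app : ∀ W, t21 app W ≫ t12 Δ W =
    t12 Δ (V ⊗ W) ≫ (T ◁ t21 app W + T ◁ t22 B W ≫ t21 app (T ⊗ W))
  ε_one : ∀ W, t01 one W ≫ t10 ε W = 𝟙 _
  ε_app : ∀ W, t21 app W ≫ t10 ε W = 0
  S_one : ∀ W, t01 one W ≫ t11 S W = t01 one W
  -- The antipode reverses products with the help of the braiding and sends a letter to its
  -- negative: S(xv) is minus the product of the letter, moved past S(x), with S(x).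
  S_app : ∀ W, t21 app W ≫ t11 S W =
    - (t11 S (V ⊗ W) ≫ t22 B W ≫ t01 one (V ⊗ (T ⊗ W)) ≫ t21 app (T ⊗ W) ≫ t21 mul W)

/-! ### The Hopf algebra axioms, by induction on word length -/

namespace Data

variable [Preadditive C] [MonoidalPreadditive C] {V T : C} (D : Data V T)

/-- A word of length n + 1 with tail `W` is a word of length n whose tail is a letter followed by
`W`. This is why every identity is proved for all tails at once: the induction hypothesis is needed
for the longer tail. -/
theorem i_succ_tail (n : ℕ) (W : C) : D.i (n + 1) ▷ W =
    (D.succ_iso n).hom ▷ W ≫ (α_ _ _ _).hom ≫ D.i n ▷ (V ⊗ W) ≫ t21 D.app W := by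
  simp [D.i_succ, t21]

theorem i_zero_tail (W : C) : D.i 0 ▷ W = (D.zero_iso.hom ▷ W ≫ (λ_ W).hom) ≫ t01 D.one W := by
  simp [D.i_zero, t01]

/-- Induction on word length. The inclusion of the words of length n is abstracted to a map `a` on
which `f` and `g` agree, for every tail and followed by every continuation `k`, so that the
hypothesis rewrites inside composites. `G` records the shape of tail for which the identity makes
sense, for instance a letter followed by `W`. -/
theorem ind₂ {P : C} {F : C → C} (G : C → C) (f g : ∀ W, P ⊗ (T ⊗ G W) ⟶ F W)
    (h0 : ∀ W, P ◁ t01 D.one (G W) ≫ f W = P ◁ t01 D.one (G W) ≫ g W)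
    (hs : ∀ (E : C) (a : E ⟶ T), (∀ W R (k : F W ⟶ R),
        P ◁ t11 a (G W) ≫ f W ≫ k = P ◁ t11 a (G W) ≫ g W ≫ k) → ∀ W,
      P ◁ t11 a (V ⊗ G W) ≫ P ◁ t21 D.app (G W) ≫ f W =
        P ◁ t11 a (V ⊗ G W) ≫ P ◁ t21 D.app (G W) ≫ g W)
    (W : C) : f W = g W := by
  refine D.ext _ _ fun n => ?_
  induction n generalizing W with
  | zero => simp only [i_zero_tail, MonoidalCategory.whiskerLeft_comp, Category.assoc, h0]
  | succ n ih =>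
    have := hs _ (D.i n) (fun W R k => by
      rw [← Category.assoc, ← Category.assoc]; exact congr($(ih W) ≫ k)) W
    simp only [t11] at this
    simp only [i_succ_tail, MonoidalCategory.whiskerLeft_comp, Category.assoc, this]

theorem ind₁ {F : C → C} (G : C → C) (f g : ∀ W, T ⊗ G W ⟶ F W)
    (h0 : ∀ W, t01 D.one (G W) ≫ f W = t01 D.one (G W) ≫ g W)
    (hs : ∀ (E : C) (a : E ⟶ T), (∀ W R (k : F W ⟶ R),
        t11 a (G W) ≫ f W ≫ k = t11 a (G W) ≫ g W ≫ k) → ∀ W,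
      t11 a (V ⊗ G W) ≫ t21 D.app (G W) ≫ f W = t11 a (V ⊗ G W) ≫ t21 D.app (G W) ≫ g W)
    (W : C) : f W = g W := by
  have := D.ind₂ (P := 𝟙_ C) G (fun W => (λ_ _).hom ≫ f W) (fun W => (λ_ _).hom ≫ g W)
    (fun W => by simp [h0]) (fun E a h W => by
      simp only [Category.assoc, leftUnitor_naturality_assoc, cancel_epi] at h ⊢
      exact hs E a h W) W
  simpa using this

theorem ind₃ {P Q : C} {F : C → C} (G : C → C) (f g : ∀ W, P ⊗ (Q ⊗ (T ⊗ G W)) ⟶ F W)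
    (h0 : ∀ W, P ◁ Q ◁ t01 D.one (G W) ≫ f W = P ◁ Q ◁ t01 D.one (G W) ≫ g W)
    (hs : ∀ (E : C) (a : E ⟶ T), (∀ W R (k : F W ⟶ R),
        P ◁ Q ◁ t11 a (G W) ≫ f W ≫ k = P ◁ Q ◁ t11 a (G W) ≫ g W ≫ k) → ∀ W,
      P ◁ Q ◁ t11 a (V ⊗ G W) ≫ P ◁ Q ◁ t21 D.app (G W) ≫ f W =
        P ◁ Q ◁ t11 a (V ⊗ G W) ≫ P ◁ Q ◁ t21 D.app (G W) ≫ g W)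
    (W : C) : f W = g W := by
  have := D.ind₂ (P := P ⊗ Q) G (fun W => (α_ _ _ _).hom ≫ f W)
    (fun W => (α_ _ _ _).hom ≫ g W)
    (fun W => by
      rw [associator_naturality_right_assoc, associator_naturality_right_assoc, h0])
    (fun E a h W => by
      simp only [Category.assoc, associator_naturality_right_assoc, cancel_epi] at h ⊢
      exact hs E a h W) W
  simpa using this

attribute [local simp] t22_nat t22_nat_assoc t22_nat₁ t22_nat₁_assoc t21_nat t21_nat_assoc t12_nat
  t12_nat_assoc t01_nat t01_nat_assoc t01_nat₁ t01_nat₁_assoc t10_nat t10_nat_assoc t10_nat₁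
  t10_nat₁_assoc t11_nat t11_nat_assoc t11_nat₁ t11_nat₁_assoc

theorem whiskerLeft_neg (P : C) {X Y : C} (f : X ⟶ Y) : P ◁ (-f) = -(P ◁ f) := by
  rw [eq_neg_iff_add_eq_zero, ← MonoidalPreadditive.whiskerLeft_add, neg_add_cancel,
    MonoidalPreadditive.whiskerLeft_zero]

/-- The product is defined by recursion on its right factor, so only the right unit law is part of
the recursion; the left one needs an induction. -/
theorem one_mul (W : C) : t01 D.one (T ⊗ W) ≫ t21 D.mul W = 𝟙 _ := by
  refine D.ind₁ (fun W => W) (fun W => t01 D.one (T ⊗ W) ≫ t21 D.mul W) (fun W => 𝟙 _)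
    (fun W => ?_) (fun E a h W => ?_) W
  · simp [D.mul_one, comp_eq (D.mul_one _), comp_eq (whisk_eq _ (D.mul_one _)), whisk_eq _ (D.mul_one _)]
  · simp at h
    simp [D.mul_app, comp_eq (D.mul_app _), comp_eq (whisk_eq _ (D.mul_app _)), whisk_eq _ (D.mul_app _), h]

theorem mul_assoc (W : C) :
    T ◁ t21 D.mul W ≫ t21 D.mul W = t21 D.mul (T ⊗ W) ≫ t21 D.mul W := by
  refine D.ind₃ (fun W => W) (fun W => T ◁ t21 D.mul W ≫ t21 D.mul W)
    (fun W => t21 D.mul (T ⊗ W) ≫ t21 D.mul W) (fun W => ?_) (fun E a h W => ?_) W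
  · simp [D.mul_one, comp_eq (D.mul_one _), comp_eq (whisk_eq _ (D.mul_one _)), whisk_eq _ (D.mul_one _)]
  · simp at h
    simp [h, D.mul_app, comp_eq (D.mul_app _), comp_eq (whisk_eq _ (D.mul_app _)), whisk_eq _ (D.mul_app _)]

theorem one_β (W : C) : t01 D.one (T ⊗ W) ≫ t22 D.β W = T ◁ t01 D.one W := by
  refine D.ind₁ (fun W => W) (fun W => t01 D.one (T ⊗ W) ≫ t22 D.β W)
    (fun W => T ◁ t01 D.one W) (fun W => ?_)
    (fun E a h W => ?_) W
  · simp [D.β_one, comp_eq (D.β_one _), comp_eq (whisk_eq _ (D.β_one _)), whisk_eq _ (D.β_one _)]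
  · simp at h
    simp [D.B_one, comp_eq (D.B_one _), comp_eq (whisk_eq _ (D.B_one _)), whisk_eq _ (D.B_one _), D.β_app, comp_eq (D.β_app _), comp_eq (whisk_eq _ (D.β_app _)), whisk_eq _ (D.β_app _), h]

theorem mul_right (W : C) : T ◁ t21 D.mul W ≫ t22 D.β W =
    t22 D.β (T ⊗ W) ≫ T ◁ t22 D.β W ≫ t21 D.mul (T ⊗ W) := by
  refine D.ind₃ (fun W => W) (fun W => T ◁ t21 D.mul W ≫ t22 D.β W)
    (fun W => t22 D.β (T ⊗ W) ≫ T ◁ t22 D.β W ≫ t21 D.mul (T ⊗ W)) (fun W => ?_)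
    (fun E a h W => ?_) W
  · simp [D.mul_one, comp_eq (D.mul_one _), comp_eq (whisk_eq _ (D.mul_one _)), whisk_eq _ (D.mul_one _), D.β_one, comp_eq (D.β_one _), comp_eq (whisk_eq _ (D.β_one _)), whisk_eq _ (D.β_one _)]
  · simp at h
    simp [h, D.β_app, comp_eq (D.β_app _), comp_eq (whisk_eq _ (D.β_app _)), whisk_eq _ (D.β_app _), D.mul_app, comp_eq (D.mul_app _), comp_eq (whisk_eq _ (D.mul_app _)), whisk_eq _ (D.mul_app _)]

/-- Moving a letter past a product is moving it past the right factor and then past the left one, by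
induction on the right factor. This hexagon-type identity feeds `mul_left` and `mul_comul`. -/
theorem mul_B (W : C) : t21 D.mul (V ⊗ W) ≫ t22 D.B W =
    T ◁ t22 D.B W ≫ t22 D.B (T ⊗ W) ≫ V ◁ t21 D.mul W := by
  refine D.ind₂ (fun W => V ⊗ W) (fun W => t21 D.mul (V ⊗ W) ≫ t22 D.B W)
    (fun W => T ◁ t22 D.B W ≫ t22 D.B (T ⊗ W) ≫ V ◁ t21 D.mul W) (fun W => ?_)
    (fun E a h W => ?_) W
  · simp [D.B_one, comp_eq (D.B_one _), comp_eq (whisk_eq _ (D.B_one _)), whisk_eq _ (D.B_one _), D.mul_one, comp_eq (D.mul_one _), comp_eq (whisk_eq _ (D.mul_one _)), whisk_eq _ (D.mul_one _)]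
  · simp at h
    simp [D.B_app, comp_eq (D.B_app _), comp_eq (whisk_eq _ (D.B_app _)), whisk_eq _ (D.B_app _), D.mul_app, comp_eq (D.mul_app _), comp_eq (whisk_eq _ (D.mul_app _)), whisk_eq _ (D.mul_app _)]
    -- The normal form has separated the factors of the induction hypothesis; naturality is undone
    -- until it appears, at the longer tail.
    rw [← t21_nat_assoc, ← t11_nat₁_assoc, h (V ⊗ W)]
    simp

theorem mul_left (W : C) : t21 D.mul (T ⊗ W) ≫ t22 D.β W =
    T ◁ t22 D.β W ≫ t22 D.β (T ⊗ W) ≫ T ◁ t21 D.mul W := by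
  refine D.ind₃ (fun W => W) (fun W => t21 D.mul (T ⊗ W) ≫ t22 D.β W)
    (fun W => T ◁ t22 D.β W ≫ t22 D.β (T ⊗ W) ≫ T ◁ t21 D.mul W) (fun W => ?_)
    (fun E a h W => ?_) W
  · simp [D.β_one, comp_eq (D.β_one _), comp_eq (whisk_eq _ (D.β_one _)), whisk_eq _ (D.β_one _)]
  · simp at h
    simp [h, D.β_app, comp_eq (D.β_app _), comp_eq (whisk_eq _ (D.β_app _)), whisk_eq _ (D.β_app _), D.mul_app, comp_eq (D.mul_app _), comp_eq (whisk_eq _ (D.mul_app _)), whisk_eq _ (D.mul_app _), D.mul_B, comp_eq (D.mul_B _), comp_eq (whisk_eq _ (D.mul_B _)), whisk_eq _ (D.mul_B _)]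

/-- Two adjacent letters may interact through `b` before or after a word moves past both. The
inductive step is the braid equation for the last letter of the word and these two; it is the only
direct use of that equation. -/
theorem B_braid (W : C) : T ◁ t22 D.b W ≫ t22 D.B (V ⊗ W) ≫ V ◁ t22 D.B W =
    t22 D.B (V ⊗ W) ≫ V ◁ t22 D.B W ≫ t22 D.b (T ⊗ W) := by
  refine D.ind₁ (fun W => V ⊗ (V ⊗ W)) (fun W => T ◁ t22 D.b W ≫ t22 D.B (V ⊗ W) ≫ V ◁ t22 D.B W)
    (fun W => t22 D.B (V ⊗ W) ≫ V ◁ t22 D.B W ≫ t22 D.b (T ⊗ W)) (fun W => ?_)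
    (fun E a h W => ?_) W
  · rw [← t01_nat_assoc, comp_eq (D.B_one _)]; simp [D.B_one, comp_eq (D.B_one _), comp_eq (whisk_eq _ (D.B_one _)), whisk_eq _ (D.B_one _)]
  · simp at h
    have hb := fun (R : C) (k : _ ⟶ R) => comp_eq₃ (whisk_eq₃ E (D.braid W)) k
    simp at hb
    rw [← t21_nat_assoc, comp_eq (D.B_app _), comp_eq (D.B_app _)]
    simp only [Category.assoc, MonoidalCategory.whiskerLeft_comp, whisk_eq _ (D.B_app _),
      comp_eq (whisk_eq _ (D.B_app _))]
    rw [t22_nat, ← t22_nat_assoc, ← t22_nat_assoc, ← t11_nat_assoc, ← t11_nat_assoc,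
      ← t11_nat_assoc, ← t11_nat_assoc, ← t11_nat_assoc, ← h, ← t11_nat_assoc, hb]

/-- The braid relation for two words and a letter, by induction on the second word with `B_braid` as
the step. The full braid relation for three words then follows by induction on the third. -/
theorem β_braid (W : C) : t22 D.β (V ⊗ W) ≫ T ◁ t22 D.B W ≫ t22 D.B (T ⊗ W) =
    T ◁ t22 D.B W ≫ t22 D.B (T ⊗ W) ≫ V ◁ t22 D.β W := by
  refine D.ind₂ (fun W => V ⊗ W) (fun W => t22 D.β (V ⊗ W) ≫ T ◁ t22 D.B W ≫ t22 D.B (T ⊗ W))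
    (fun W => T ◁ t22 D.B W ≫ t22 D.B (T ⊗ W) ≫ V ◁ t22 D.β W) (fun W => ?_)
    (fun E a h W => ?_) W
  · simp [D.B_one, comp_eq (D.B_one _), comp_eq (whisk_eq _ (D.B_one _)), whisk_eq _ (D.B_one _), D.β_one, comp_eq (D.β_one _), comp_eq (whisk_eq _ (D.β_one _)), whisk_eq _ (D.β_one _)]
    rw [← t01_nat_assoc, D.B_one]
  · simp at h
    have hb := fun (R : C) (k : _ ⟶ R) => comp_eq₃ (whisk_eq₃ T (D.B_braid W).symm) k
    simp [D.B_app, comp_eq (D.B_app _), comp_eq (whisk_eq _ (D.B_app _)), whisk_eq _ (D.B_app _), D.β_app, comp_eq (D.β_app _), comp_eq (whisk_eq _ (D.β_app _)), whisk_eq _ (D.β_app _)]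
    simp at hb
    rw [← t21_nat_assoc, D.B_app, hb, ← t22_nat_assoc, ← t11_nat₁_assoc, t22_nat_assoc, h]
    simp

theorem preBraiding (W : C) : t22 D.β (T ⊗ W) ≫ T ◁ t22 D.β W ≫ t22 D.β (T ⊗ W) =
    T ◁ t22 D.β W ≫ t22 D.β (T ⊗ W) ≫ T ◁ t22 D.β W := by
  refine D.ind₃ (fun W => W) (fun W => t22 D.β (T ⊗ W) ≫ T ◁ t22 D.β W ≫ t22 D.β (T ⊗ W))
    (fun W => T ◁ t22 D.β W ≫ t22 D.β (T ⊗ W) ≫ T ◁ t22 D.β W) (fun W => ?_)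
    (fun E a h W => ?_) W
  · simp [D.β_one, comp_eq (D.β_one _), comp_eq (whisk_eq _ (D.β_one _)), whisk_eq _ (D.β_one _), D.one_β, comp_eq (D.one_β _), comp_eq (whisk_eq _ (D.one_β _)), whisk_eq _ (D.one_β _)]
  · simp at h
    simp [h, D.β_app, comp_eq (D.β_app _), comp_eq (whisk_eq _ (D.β_app _)), whisk_eq _ (D.β_app _), D.β_braid, comp_eq₃ (D.β_braid _), comp_eq₃ (whisk_eq₃ _ (D.β_braid _)), whisk_eq₃ _ (D.β_braid _)]

theorem B_ε (W : C) : t22 D.B W ≫ V ◁ t10 D.ε W = t10 D.ε (V ⊗ W) := by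
  refine D.ind₁ (fun W => V ⊗ W) (fun W => t22 D.B W ≫ V ◁ t10 D.ε W)
    (fun W => t10 D.ε (V ⊗ W)) (fun W => ?_) (fun E a h W => ?_) W
  · simp [D.B_one, comp_eq (D.B_one _), comp_eq (whisk_eq _ (D.B_one _)), whisk_eq _ (D.B_one _), D.ε_one, comp_eq (D.ε_one _), comp_eq (whisk_eq _ (D.ε_one _)), whisk_eq _ (D.ε_one _)]
  · simp at h
    simp [h, D.B_app, comp_eq (D.B_app _), comp_eq (whisk_eq _ (D.B_app _)), whisk_eq _ (D.B_app _), D.ε_app, comp_eq (D.ε_app _), comp_eq (whisk_eq _ (D.ε_app _)), whisk_eq _ (D.ε_app _)]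

theorem mul_ε (W : C) : t21 D.mul W ≫ t10 D.ε W = T ◁ t10 D.ε W ≫ t10 D.ε W := by
  refine D.ind₂ (fun W => W) (fun W => t21 D.mul W ≫ t10 D.ε W)
    (fun W => T ◁ t10 D.ε W ≫ t10 D.ε W) (fun W => ?_) (fun E a h W => ?_) W
  · simp [D.mul_one, comp_eq (D.mul_one _), comp_eq (whisk_eq _ (D.mul_one _)), whisk_eq _ (D.mul_one _), D.ε_one, comp_eq (D.ε_one _), comp_eq (whisk_eq _ (D.ε_one _)), whisk_eq _ (D.ε_one _)]
  · simp [D.mul_app, comp_eq (D.mul_app _), comp_eq (whisk_eq _ (D.mul_app _)), whisk_eq _ (D.mul_app _), D.ε_app, comp_eq (D.ε_app _), comp_eq (whisk_eq _ (D.ε_app _)), whisk_eq _ (D.ε_app _)]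

theorem counit_right (W : C) : t22 D.β W ≫ T ◁ t10 D.ε W = t10 D.ε (T ⊗ W) := by
  refine D.ind₂ (fun W => W) (fun W => t22 D.β W ≫ T ◁ t10 D.ε W)
    (fun W => t10 D.ε (T ⊗ W)) (fun W => ?_) (fun E a h W => ?_) W
  · simp [D.β_one, comp_eq (D.β_one _), comp_eq (whisk_eq _ (D.β_one _)), whisk_eq _ (D.β_one _), D.ε_one, comp_eq (D.ε_one _), comp_eq (whisk_eq _ (D.ε_one _)), whisk_eq _ (D.ε_one _)]
  · simp at h
    simp [D.β_app, comp_eq (D.β_app _), comp_eq (whisk_eq _ (D.β_app _)), whisk_eq _ (D.β_app _)]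
    rw [← t21_nat, comp_eq (whisk_eq _ (D.B_ε _)), h]

theorem counit_left (W : C) : t22 D.β W ≫ t10 D.ε (T ⊗ W) = T ◁ t10 D.ε W := by
  refine D.ind₂ (fun W => W) (fun W => t22 D.β W ≫ t10 D.ε (T ⊗ W))
    (fun W => T ◁ t10 D.ε W) (fun W => ?_) (fun E a h W => ?_) W
  · simp [D.β_one, comp_eq (D.β_one _), comp_eq (whisk_eq _ (D.β_one _)), whisk_eq _ (D.β_one _), D.ε_one, comp_eq (D.ε_one _), comp_eq (whisk_eq _ (D.ε_one _)), whisk_eq _ (D.ε_one _)]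
  · simp at h
    simp [h, D.β_app, comp_eq (D.β_app _), comp_eq (whisk_eq _ (D.β_app _)), whisk_eq _ (D.β_app _), D.ε_app, comp_eq (D.ε_app _), comp_eq (whisk_eq _ (D.ε_app _)), whisk_eq _ (D.ε_app _)]

theorem counit_comul (W : C) : t12 D.Δ W ≫ t10 D.ε (T ⊗ W) = 𝟙 _ := by
  refine D.ind₁ (fun W => W) (fun W => t12 D.Δ W ≫ t10 D.ε (T ⊗ W))
    (fun W => 𝟙 _) (fun W => ?_) (fun E a h W => ?_) W
  · simp [D.Δ_one, comp_eq (D.Δ_one _), comp_eq (whisk_eq _ (D.Δ_one _)), whisk_eq _ (D.Δ_one _), D.ε_one, comp_eq (D.ε_one _), comp_eq (whisk_eq _ (D.ε_one _)), whisk_eq _ (D.ε_one _)]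
  · simp at h
    simp [h, D.Δ_app, comp_eq (D.Δ_app _), comp_eq (whisk_eq _ (D.Δ_app _)), whisk_eq _ (D.Δ_app _), D.ε_app, comp_eq (D.ε_app _), comp_eq (whisk_eq _ (D.ε_app _)), whisk_eq _ (D.ε_app _)]

theorem comul_counit (W : C) : t12 D.Δ W ≫ T ◁ t10 D.ε W = 𝟙 _ := by
  refine D.ind₁ (fun W => W) (fun W => t12 D.Δ W ≫ T ◁ t10 D.ε W)
    (fun W => 𝟙 _) (fun W => ?_) (fun E a h W => ?_) W
  · simp [D.Δ_one, comp_eq (D.Δ_one _), comp_eq (whisk_eq _ (D.Δ_one _)), whisk_eq _ (D.Δ_one _), D.ε_one, comp_eq (D.ε_one _), comp_eq (whisk_eq _ (D.ε_one _)), whisk_eq _ (D.ε_one _)]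
  · simp at h
    simp [D.Δ_app, comp_eq (D.Δ_app _), comp_eq (whisk_eq _ (D.Δ_app _)), whisk_eq _ (D.Δ_app _), D.ε_app, comp_eq (D.ε_app _), comp_eq (whisk_eq _ (D.ε_app _)), whisk_eq _ (D.ε_app _)]
    rw [← t21_nat, comp_eq (whisk_eq _ (D.B_ε _)), h]

/-- Naturality of the passage of a letter with respect to Δ. In the inductive step the new term of Δ
contains two passages, which `B_braid` reorders. -/
theorem B_Δ (W : C) : t12 D.Δ (V ⊗ W) ≫ T ◁ t22 D.B W ≫ t22 D.B (T ⊗ W) =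
    t22 D.B W ≫ V ◁ t12 D.Δ W := by
  refine D.ind₁ (fun W => V ⊗ W)
    (fun W => t12 D.Δ (V ⊗ W) ≫ T ◁ t22 D.B W ≫ t22 D.B (T ⊗ W))
    (fun W => t22 D.B W ≫ V ◁ t12 D.Δ W) (fun W => ?_) (fun E a h W => ?_) W
  · simp [D.Δ_one, comp_eq (D.Δ_one _), comp_eq (whisk_eq _ (D.Δ_one _)), whisk_eq _ (D.Δ_one _), D.B_one, comp_eq (D.B_one _), comp_eq (whisk_eq _ (D.B_one _)), whisk_eq _ (D.B_one _)]
  · simp at h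
    simp [D.Δ_app, comp_eq (D.Δ_app _), comp_eq (whisk_eq _ (D.Δ_app _)), whisk_eq _ (D.Δ_app _), D.B_app, comp_eq (D.B_app _), comp_eq (whisk_eq _ (D.B_app _)), whisk_eq _ (D.B_app _)]
    have hb := fun (R : C) (k : _ ⟶ R) => comp_eq₃ (whisk_eq₃ T (D.B_braid W).symm) k
    simp at hb
    rw [← t21_nat_assoc, D.B_app, hb, t22_nat_assoc]
    simp only [← t12_nat_assoc, ← t11_nat_assoc, h]

theorem comul_left (W : C) : t12 D.Δ (T ⊗ W) ≫ T ◁ t22 D.β W ≫ t22 D.β (T ⊗ W) =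
    t22 D.β W ≫ T ◁ t12 D.Δ W := by
  refine D.ind₂ (fun W => W)
    (fun W => t12 D.Δ (T ⊗ W) ≫ T ◁ t22 D.β W ≫ t22 D.β (T ⊗ W))
    (fun W => t22 D.β W ≫ T ◁ t12 D.Δ W) (fun W => ?_) (fun E a h W => ?_) W
  · simp [D.Δ_one, comp_eq (D.Δ_one _), comp_eq (whisk_eq _ (D.Δ_one _)), whisk_eq _ (D.Δ_one _), D.β_one, comp_eq (D.β_one _), comp_eq (whisk_eq _ (D.β_one _)), whisk_eq _ (D.β_one _)]
  · simp at h
    simp [h, D.β_app, comp_eq (D.β_app _), comp_eq (whisk_eq _ (D.β_app _)), whisk_eq _ (D.β_app _)]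
    have hb := fun (R : C) (k : _ ⟶ R) => comp_eq₃ (whisk_eq₃ T (D.B_Δ W)) k
    simp at hb
    rw [← t21_nat, ← hb]

theorem comul_right (W : C) : T ◁ t12 D.Δ W ≫ t22 D.β (T ⊗ W) ≫ T ◁ t22 D.β W =
    t22 D.β W ≫ t12 D.Δ (T ⊗ W) := by
  refine D.ind₂ (fun W => W)
    (fun W => T ◁ t12 D.Δ W ≫ t22 D.β (T ⊗ W) ≫ T ◁ t22 D.β W)
    (fun W => t22 D.β W ≫ t12 D.Δ (T ⊗ W)) (fun W => ?_) (fun E a h W => ?_) W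
  · simp [D.Δ_one, comp_eq (D.Δ_one _), comp_eq (whisk_eq _ (D.Δ_one _)), whisk_eq _ (D.Δ_one _), D.β_one, comp_eq (D.β_one _), comp_eq (whisk_eq _ (D.β_one _)), whisk_eq _ (D.β_one _)]
  · simp at h
    simp [h, D.Δ_app, comp_eq (D.Δ_app _), comp_eq (whisk_eq _ (D.Δ_app _)), whisk_eq _ (D.Δ_app _), D.β_app, comp_eq (D.β_app _), comp_eq (whisk_eq _ (D.β_app _)), whisk_eq _ (D.β_app _)]
    have hb := fun (R : C) (k : _ ⟶ R) => comp_eq₃ (whisk_eq₃ T (D.β_braid W)) k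
    simp at hb
    rw [← t21_nat, ← hb, h]

/-- After a letter is appended, it can end up in any of the three factors, and the two sides yield
the same three terms. `B_Δ` matches the term in which the letter passes a comultiplied factor. -/
theorem comul_assoc (W : C) : t12 D.Δ W ≫ t12 D.Δ (T ⊗ W) = t12 D.Δ W ≫ T ◁ t12 D.Δ W := by
  refine D.ind₁ (fun W => W) (fun W => t12 D.Δ W ≫ t12 D.Δ (T ⊗ W))
    (fun W => t12 D.Δ W ≫ T ◁ t12 D.Δ W) (fun W => ?_) (fun E a h W => ?_) W
  · simp [D.Δ_one, comp_eq (D.Δ_one _), comp_eq (whisk_eq _ (D.Δ_one _)), whisk_eq _ (D.Δ_one _)]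
  · simp at h
    simp [h, D.Δ_app, comp_eq (D.Δ_app _), comp_eq (whisk_eq _ (D.Δ_app _)), whisk_eq _ (D.Δ_app _)]
    have hb := fun (R : C) (k : _ ⟶ R) => comp_eq₃ (whisk_eq₃ T (D.B_Δ W)) k
    simp at hb
    rw [← t21_nat, ← hb, add_assoc]

/-- By induction on the right factor it suffices to append a letter. Multiplicativity of Δ in that
case is `Δ_app`, and `mul_B` and `β_app` show that the letter passes the braided product correctly.
-/
theorem mul_comul (W : C) : t21 D.mul W ≫ t12 D.Δ W =
    t12 D.Δ (T ⊗ W) ≫ T ◁ T ◁ t12 D.Δ W ≫ T ◁ t22 D.β (T ⊗ W) ≫ t21 D.mul (T ⊗ (T ⊗ W)) ≫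
      T ◁ t21 D.mul W := by
  refine D.ind₂ (fun W => W) (fun W => t21 D.mul W ≫ t12 D.Δ W)
    (fun W => t12 D.Δ (T ⊗ W) ≫ T ◁ T ◁ t12 D.Δ W ≫ T ◁ t22 D.β (T ⊗ W) ≫
      t21 D.mul (T ⊗ (T ⊗ W)) ≫ T ◁ t21 D.mul W) (fun W => ?_) (fun E a h W => ?_) W
  · simp [D.Δ_one, comp_eq (D.Δ_one _), comp_eq (whisk_eq _ (D.Δ_one _)), whisk_eq _ (D.Δ_one _), comp_eq (whisk_eq _ (whisk_eq _ (D.Δ_one _))), D.β_one, comp_eq (D.β_one _), comp_eq (whisk_eq _ (D.β_one _)), whisk_eq _ (D.β_one _), D.mul_one, comp_eq (D.mul_one _), comp_eq (whisk_eq _ (D.mul_one _)), whisk_eq _ (D.mul_one _)]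
  · simp at h
    simp [h, D.Δ_app, comp_eq (D.Δ_app _), comp_eq (whisk_eq _ (D.Δ_app _)), whisk_eq _ (D.Δ_app _), comp_eq (whisk_eq _ (whisk_eq _ (D.Δ_app _))), D.mul_B, comp_eq (D.mul_B _), comp_eq (whisk_eq _ (D.mul_B _)), whisk_eq _ (D.mul_B _), D.mul_app, comp_eq (D.mul_app _), comp_eq (whisk_eq _ (D.mul_app _)), whisk_eq _ (D.mul_app _), D.β_app, comp_eq (D.β_app _), comp_eq (whisk_eq _ (D.β_app _)), whisk_eq _ (D.β_app _)]

theorem S_B (W : C) : t11 D.S (V ⊗ W) ≫ t22 D.B W = t22 D.B W ≫ V ◁ t11 D.S W := by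
  refine D.ind₁ (fun W => V ⊗ W) (fun W => t11 D.S (V ⊗ W) ≫ t22 D.B W)
    (fun W => t22 D.B W ≫ V ◁ t11 D.S W) (fun W => ?_) (fun E a h W => ?_) W
  · simp [D.S_one, comp_eq (D.S_one _), comp_eq (whisk_eq _ (D.S_one _)), whisk_eq _ (D.S_one _), D.B_one, comp_eq (D.B_one _), comp_eq (whisk_eq _ (D.B_one _)), whisk_eq _ (D.B_one _)]
  · simp at h
    simp [h, D.S_app, comp_eq (D.S_app _), comp_eq (whisk_eq _ (D.S_app _)), whisk_eq _ (D.S_app _), D.B_app, comp_eq (D.B_app _), comp_eq (whisk_eq _ (D.B_app _)), whisk_eq _ (D.B_app _), D.mul_B, comp_eq (D.mul_B _), comp_eq (whisk_eq _ (D.mul_B _)), whisk_eq _ (D.mul_B _), whiskerLeft_neg]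
    have hb := fun (R : C) (k : _ ⟶ R) => comp_eq₃ (whisk_eq₃ T (D.B_braid W).symm) k
    simp at hb
    rw [← t21_nat_assoc, comp_eq (D.B_app _)]
    simp only [Category.assoc]
    rw [hb]
    simp only [← t01_nat_assoc, ← t01_nat₁_assoc, comp_eq (D.B_one _)]
    simp only [← t11_nat_assoc, h]

/-- For a word xv, Δ gives two terms. In the first, x contributes ε(x) by induction, leaving ε(x)v.
In the second, S places a letter in front with a minus sign; by `mul_B` this letter has passed the
whole product S(x₁)x₂, which is again ε(x), and the terms cancel. -/
theorem antipode_left (W : C) : t12 D.Δ W ≫ t11 D.S (T ⊗ W) ≫ t21 D.mul W =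
    t10 D.ε W ≫ t01 D.one W := by
  refine D.ind₁ (fun W => W) (fun W => t12 D.Δ W ≫ t11 D.S (T ⊗ W) ≫ t21 D.mul W)
    (fun W => t10 D.ε W ≫ t01 D.one W) (fun W => ?_) (fun E a h W => ?_) W
  · simp [D.Δ_one, comp_eq (D.Δ_one _), comp_eq (whisk_eq _ (D.Δ_one _)), whisk_eq _ (D.Δ_one _), D.S_one, comp_eq (D.S_one _), comp_eq (whisk_eq _ (D.S_one _)), whisk_eq _ (D.S_one _), D.mul_one, comp_eq (D.mul_one _), comp_eq (whisk_eq _ (D.mul_one _)), whisk_eq _ (D.mul_one _), D.one_mul, comp_eq (D.one_mul _), comp_eq (whisk_eq _ (D.one_mul _)), whisk_eq _ (D.one_mul _), D.ε_one, comp_eq (D.ε_one _), comp_eq (whisk_eq _ (D.ε_one _)), whisk_eq _ (D.ε_one _)]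
  · simp at h
    simp [h, D.Δ_app, comp_eq (D.Δ_app _), comp_eq (whisk_eq _ (D.Δ_app _)), whisk_eq _ (D.Δ_app _), D.S_app, comp_eq (D.S_app _), comp_eq (whisk_eq _ (D.S_app _)), whisk_eq _ (D.S_app _), D.mul_app, comp_eq (D.mul_app _), comp_eq (whisk_eq _ (D.mul_app _)), whisk_eq _ (D.mul_app _), D.ε_app, comp_eq (D.ε_app _), comp_eq (whisk_eq _ (D.ε_app _)), whisk_eq _ (D.ε_app _)]
    have hb := fun (R : C) (k : _ ⟶ R) => comp_eq₃ (D.mul_B W).symm k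
    simp only [Category.assoc] at hb
    simp only [← t01_nat_assoc] at h ⊢
    rw [← D.mul_assoc, ← t21_nat_assoc, ← t01_nat_assoc, hb, h, comp_eq (D.B_one _)]
    simp [D.mul_one, comp_eq (D.mul_one _), comp_eq (whisk_eq _ (D.mul_one _)), whisk_eq _ (D.mul_one _)]

/-- Here the two terms for xv cancel directly: `S_B` lets the letter pass S(x₂) instead of x₂, and
associativity identifies the products. -/
theorem antipode_right (W : C) : t12 D.Δ W ≫ T ◁ t11 D.S W ≫ t21 D.mul W =
    t10 D.ε W ≫ t01 D.one W := by
  refine D.ind₁ (fun W => W) (fun W => t12 D.Δ W ≫ T ◁ t11 D.S W ≫ t21 D.mul W)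
    (fun W => t10 D.ε W ≫ t01 D.one W) (fun W => ?_) (fun E a h W => ?_) W
  · simp [D.Δ_one, comp_eq (D.Δ_one _), comp_eq (whisk_eq _ (D.Δ_one _)), whisk_eq _ (D.Δ_one _), D.S_one, comp_eq (D.S_one _), comp_eq (whisk_eq _ (D.S_one _)), whisk_eq _ (D.S_one _), D.mul_one, comp_eq (D.mul_one _), comp_eq (whisk_eq _ (D.mul_one _)), whisk_eq _ (D.mul_one _), D.one_mul, comp_eq (D.one_mul _), comp_eq (whisk_eq _ (D.one_mul _)), whisk_eq _ (D.one_mul _), D.ε_one, comp_eq (D.ε_one _), comp_eq (whisk_eq _ (D.ε_one _)), whisk_eq _ (D.ε_one _)]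
  · simp at h
    simp [h, D.Δ_app, comp_eq (D.Δ_app _), comp_eq (whisk_eq _ (D.Δ_app _)), whisk_eq _ (D.Δ_app _), D.S_app, comp_eq (D.S_app _), comp_eq (whisk_eq _ (D.S_app _)), whisk_eq _ (D.S_app _), D.mul_app, comp_eq (D.mul_app _), comp_eq (whisk_eq _ (D.mul_app _)), whisk_eq _ (D.mul_app _), D.mul_one, comp_eq (D.mul_one _), comp_eq (whisk_eq _ (D.mul_one _)), whisk_eq _ (D.mul_one _), D.mul_assoc, comp_eq (D.mul_assoc _), comp_eq (whisk_eq _ (D.mul_assoc _)), whisk_eq _ (D.mul_assoc _), D.S_B, comp_eq (D.S_B _), comp_eq (whisk_eq _ (D.S_B _)), whisk_eq _ (D.S_B _), D.ε_app, comp_eq (D.ε_app _), comp_eq (whisk_eq _ (D.ε_app _)), whisk_eq _ (D.ε_app _), whiskerLeft_neg]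

/-! ### The axioms in the usual form -/

/-- Taking the tail to be the unit object recovers each axiom in its usual form; what remains is
monoidal coherence. -/
theorem of_whiskerRight_unit {X Y : C} {f g : X ⟶ Y} (h : f ▷ 𝟙_ C = g ▷ 𝟙_ C) : f = g := by
  simpa using h

theorem one_mul_std : D.one ▷ T ≫ D.mul = (λ_ T).hom := by
  refine of_whiskerRight_unit ?_
  calc _ = 𝟙 _ ⊗≫ (t01 D.one (T ⊗ 𝟙_ C) ≫ t21 D.mul (𝟙_ C)) ⊗≫ 𝟙 _ := by
        simp only [t01, t10, t11, t12, t21, t22]; monoidal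
    _ = _ := by
        rw [one_mul D _]; monoidal

theorem mul_one_std : T ◁ D.one ≫ D.mul = (ρ_ T).hom := by
  refine of_whiskerRight_unit ?_
  calc _ = 𝟙 _ ⊗≫ (T ◁ t01 D.one (𝟙_ C) ≫ t21 D.mul (𝟙_ C)) ⊗≫ 𝟙 _ := by
        simp only [t01, t10, t11, t12, t21, t22]; monoidal
    _ = _ := by
        rw [mul_one D _]; monoidal

theorem mul_assoc_std : D.mul ▷ T ≫ D.mul = (α_ T T T).hom ≫ T ◁ D.mul ≫ D.mul := by
  refine of_whiskerRight_unit ?_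
  calc _ = 𝟙 _ ⊗≫ (t21 D.mul (T ⊗ 𝟙_ C) ≫ t21 D.mul (𝟙_ C)) ⊗≫ 𝟙 _ := by
        simp only [t01, t10, t11, t12, t21, t22]; monoidal
    _ = _ := by
        rw [(mul_assoc D _).symm]; simp only [t01, t10, t11, t12, t21, t22,
          MonoidalCategory.id_whiskerRight]
        monoidal

theorem counit_comul_std : D.Δ ≫ D.ε ▷ T = (λ_ T).inv := by
  refine of_whiskerRight_unit ?_
  calc _ = 𝟙 _ ⊗≫ (t12 D.Δ (𝟙_ C) ≫ t10 D.ε (T ⊗ 𝟙_ C)) ⊗≫ 𝟙 _ := by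
        simp only [t01, t10, t11, t12, t21, t22]; monoidal
    _ = _ := by
        rw [counit_comul D _]; monoidal

theorem comul_counit_std : D.Δ ≫ T ◁ D.ε = (ρ_ T).inv := by
  refine of_whiskerRight_unit ?_
  calc _ = 𝟙 _ ⊗≫ (t12 D.Δ (𝟙_ C) ≫ T ◁ t10 D.ε (𝟙_ C)) ⊗≫ 𝟙 _ := by
        simp only [t01, t10, t11, t12, t21, t22]; monoidal
    _ = _ := by
        rw [comul_counit D _]; monoidal

theorem comul_assoc_std : D.Δ ≫ T ◁ D.Δ = D.Δ ≫ D.Δ ▷ T ≫ (α_ T T T).hom := by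
  refine of_whiskerRight_unit ?_
  calc _ = 𝟙 _ ⊗≫ (t12 D.Δ (𝟙_ C) ≫ T ◁ t12 D.Δ (𝟙_ C)) ⊗≫ 𝟙 _ := by
        simp only [t01, t10, t11, t12, t21, t22]; monoidal
    _ = _ := by
        rw [(comul_assoc D _).symm]; simp only [t01, t10, t11, t12, t21, t22,
          MonoidalCategory.id_whiskerRight]
        monoidal

theorem preBraiding_std : D.β ▷ T ≫ (α_ T T T).hom ≫ T ◁ D.β ≫ (α_ T T T).inv ≫ D.β ▷ T ≫ (α_ T T T).hom =
      (α_ T T T).hom ≫ T ◁ D.β ≫ (α_ T T T).inv ≫ D.β ▷ T ≫ (α_ T T T).hom ≫ T ◁ D.β := by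
  refine of_whiskerRight_unit ?_
  calc _ = 𝟙 _ ⊗≫ (t22 D.β (T ⊗ 𝟙_ C) ≫ T ◁ t22 D.β (𝟙_ C) ≫ t22 D.β (T ⊗ 𝟙_ C)) ⊗≫ 𝟙 _ := by
        simp only [t01, t10, t11, t12, t21, t22]; monoidal
    _ = _ := by
        rw [preBraiding D _]; simp only [t01, t10, t11, t12, t21, t22,
          MonoidalCategory.id_whiskerRight]
        monoidal

theorem one_left_std : D.one ▷ T ≫ D.β = (λ_ T).hom ≫ (ρ_ T).inv ≫ T ◁ D.one := by
  refine of_whiskerRight_unit ?_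
  calc _ = 𝟙 _ ⊗≫ (t01 D.one (T ⊗ 𝟙_ C) ≫ t22 D.β (𝟙_ C)) ⊗≫ 𝟙 _ := by
        simp only [t01, t10, t11, t12, t21, t22]; monoidal
    _ = _ := by
        rw [one_β D _]; simp only [t01, t10, t11, t12, t21, t22,
          MonoidalCategory.id_whiskerRight]
        monoidal

theorem one_right_std : T ◁ D.one ≫ D.β = (ρ_ T).hom ≫ (λ_ T).inv ≫ D.one ▷ T := by
  refine of_whiskerRight_unit ?_
  calc _ = 𝟙 _ ⊗≫ (T ◁ t01 D.one (𝟙_ C) ≫ t22 D.β (𝟙_ C)) ⊗≫ 𝟙 _ := by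
        simp only [t01, t10, t11, t12, t21, t22]; monoidal
    _ = _ := by
        rw [β_one D _]; simp only [t01, t10, t11, t12, t21, t22,
          MonoidalCategory.id_whiskerRight]
        monoidal

theorem mul_left_std : D.mul ▷ T ≫ D.β = (α_ T T T).hom ≫ T ◁ D.β ≫ (α_ T T T).inv ≫ D.β ▷ T ≫
      (α_ T T T).hom ≫ T ◁ D.mul := by
  refine of_whiskerRight_unit ?_
  calc _ = 𝟙 _ ⊗≫ (t21 D.mul (T ⊗ 𝟙_ C) ≫ t22 D.β (𝟙_ C)) ⊗≫ 𝟙 _ := by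
        simp only [t01, t10, t11, t12, t21, t22]; monoidal
    _ = _ := by
        rw [mul_left D _]; simp only [t01, t10, t11, t12, t21, t22,
          MonoidalCategory.id_whiskerRight]
        monoidal

theorem mul_right_std : T ◁ D.mul ≫ D.β = (α_ T T T).inv ≫ D.β ▷ T ≫ (α_ T T T).hom ≫ T ◁ D.β ≫
      (α_ T T T).inv ≫ D.mul ▷ T := by
  refine of_whiskerRight_unit ?_
  calc _ = 𝟙 _ ⊗≫ (T ◁ t21 D.mul (𝟙_ C) ≫ t22 D.β (𝟙_ C)) ⊗≫ 𝟙 _ := by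
        simp only [t01, t10, t11, t12, t21, t22]; monoidal
    _ = _ := by
        rw [mul_right D _]; simp only [t01, t10, t11, t12, t21, t22,
          MonoidalCategory.id_whiskerRight]
        monoidal

theorem counit_left_std : D.β ≫ D.ε ▷ T ≫ (λ_ T).hom = T ◁ D.ε ≫ (ρ_ T).hom := by
  refine of_whiskerRight_unit ?_
  calc _ = 𝟙 _ ⊗≫ (t22 D.β (𝟙_ C) ≫ t10 D.ε (T ⊗ 𝟙_ C)) ⊗≫ 𝟙 _ := by
        simp only [t01, t10, t11, t12, t21, t22]; monoidal
    _ = _ := by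
        rw [counit_left D _]; simp only [t01, t10, t11, t12, t21, t22,
          MonoidalCategory.id_whiskerRight]
        monoidal

theorem counit_right_std : D.β ≫ T ◁ D.ε ≫ (ρ_ T).hom = D.ε ▷ T ≫ (λ_ T).hom := by
  refine of_whiskerRight_unit ?_
  calc _ = 𝟙 _ ⊗≫ (t22 D.β (𝟙_ C) ≫ T ◁ t10 D.ε (𝟙_ C)) ⊗≫ 𝟙 _ := by
        simp only [t01, t10, t11, t12, t21, t22]; monoidal
    _ = _ := by
        rw [counit_right D _]; simp only [t01, t10, t11, t12, t21, t22,
          MonoidalCategory.id_whiskerRight]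
        monoidal

theorem comul_left_std : D.Δ ▷ T ≫ (α_ T T T).hom ≫ T ◁ D.β ≫ (α_ T T T).inv ≫ D.β ▷ T ≫ (α_ T T T).hom =
      D.β ≫ T ◁ D.Δ := by
  refine of_whiskerRight_unit ?_
  calc _ = 𝟙 _ ⊗≫ (t12 D.Δ (T ⊗ 𝟙_ C) ≫ T ◁ t22 D.β (𝟙_ C) ≫ t22 D.β (T ⊗ 𝟙_ C)) ⊗≫ 𝟙 _ := by
        simp only [t01, t10, t11, t12, t21, t22]; monoidal
    _ = _ := by
        rw [comul_left D _]; simp only [t01, t10, t11, t12, t21, t22,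
          MonoidalCategory.id_whiskerRight]
        monoidal

theorem comul_right_std : T ◁ D.Δ ≫ (α_ T T T).inv ≫ D.β ▷ T ≫ (α_ T T T).hom ≫ T ◁ D.β ≫ (α_ T T T).inv =
      D.β ≫ D.Δ ▷ T := by
  refine of_whiskerRight_unit ?_
  calc _ = 𝟙 _ ⊗≫ (T ◁ t12 D.Δ (𝟙_ C) ≫ t22 D.β (T ⊗ 𝟙_ C) ≫ T ◁ t22 D.β (𝟙_ C)) ⊗≫ 𝟙 _ := by
        simp only [t01, t10, t11, t12, t21, t22]; monoidal
    _ = _ := by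
        rw [comul_right D _]; simp only [t01, t10, t11, t12, t21, t22,
          MonoidalCategory.id_whiskerRight]
        monoidal

theorem mul_comul_std : D.mul ≫ D.Δ = (D.Δ ⊗ₘ D.Δ) ≫ ((α_ T T (T ⊗ T)).hom ≫ T ◁ (α_ T T T).inv ≫
      T ◁ (D.β ▷ T) ≫ T ◁ (α_ T T T).hom ≫ (α_ T T (T ⊗ T)).inv) ≫ (D.mul ⊗ₘ D.mul) := by
  refine of_whiskerRight_unit ?_
  calc _ = 𝟙 _ ⊗≫ (t21 D.mul (𝟙_ C) ≫ t12 D.Δ (𝟙_ C)) ⊗≫ 𝟙 _ := by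
        simp only [t01, t10, t11, t12, t21, t22]; monoidal
    _ = _ := by
        rw [mul_comul D _]; simp only [t01, t10, t11, t12, t21, t22, MonoidalCategory.tensorHom_def,
          MonoidalCategory.id_whiskerRight]
        monoidal

theorem one_comul_std : D.one ≫ D.Δ = (λ_ (𝟙_ C)).inv ≫ (D.one ⊗ₘ D.one) := by
  refine of_whiskerRight_unit ?_
  calc _ = 𝟙 _ ⊗≫ (t01 D.one (𝟙_ C) ≫ t12 D.Δ (𝟙_ C)) ⊗≫ 𝟙 _ := by
        simp only [t01, t10, t11, t12, t21, t22]; monoidal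
    _ = _ := by
        rw [Δ_one D _]; simp only [t01, t10, t11, t12, t21, t22, MonoidalCategory.tensorHom_def',
          MonoidalCategory.id_whiskerRight]
        monoidal

theorem one_counit_std : D.one ≫ D.ε = 𝟙 (𝟙_ C) := by
  refine of_whiskerRight_unit ?_
  calc _ = 𝟙 _ ⊗≫ (t01 D.one (𝟙_ C) ≫ t10 D.ε (𝟙_ C)) ⊗≫ 𝟙 _ := by
        simp only [t01, t10, t11, t12, t21, t22]; monoidal
    _ = _ := by
        rw [ε_one D _]; simp only [t01, t10, t11, t12, t21, t22,
          MonoidalCategory.id_whiskerRight]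
        monoidal

theorem mul_counit_std : D.mul ≫ D.ε = (D.ε ⊗ₘ D.ε) ≫ (λ_ (𝟙_ C)).hom := by
  refine of_whiskerRight_unit ?_
  calc _ = 𝟙 _ ⊗≫ (t21 D.mul (𝟙_ C) ≫ t10 D.ε (𝟙_ C)) ⊗≫ 𝟙 _ := by
        simp only [t01, t10, t11, t12, t21, t22]; monoidal
    _ = _ := by
        rw [mul_ε D _]; simp only [t01, t10, t11, t12, t21, t22, MonoidalCategory.tensorHom_def',
          MonoidalCategory.id_whiskerRight]
        monoidal

theorem antipode_left_std : D.Δ ≫ D.S ▷ T ≫ D.mul = D.ε ≫ D.one := by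
  refine of_whiskerRight_unit ?_
  calc _ = 𝟙 _ ⊗≫ (t12 D.Δ (𝟙_ C) ≫ t11 D.S (T ⊗ 𝟙_ C) ≫ t21 D.mul (𝟙_ C)) ⊗≫ 𝟙 _ := by
        simp only [t01, t10, t11, t12, t21, t22]; monoidal
    _ = _ := by
        rw [antipode_left D _]; simp only [t01, t10, t11, t12, t21, t22,
          MonoidalCategory.id_whiskerRight]
        monoidal

theorem antipode_right_std : D.Δ ≫ T ◁ D.S ≫ D.mul = D.ε ≫ D.one := by
  refine of_whiskerRight_unit ?_
  calc _ = 𝟙 _ ⊗≫ (t12 D.Δ (𝟙_ C) ≫ T ◁ t11 D.S (𝟙_ C) ≫ t21 D.mul (𝟙_ C)) ⊗≫ 𝟙 _ := by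
        simp only [t01, t10, t11, t12, t21, t22]; monoidal
    _ = _ := by
        rw [antipode_right D _]; simp only [t01, t10, t11, t12, t21, t22,
          MonoidalCategory.id_whiskerRight]
        monoidal

end Data

end Tail

/-! ### Quantum symmetrizers -/

namespace Tail

universe v w

variable {C : Type w} [Category.{v} C] [MonoidalCategory C] [Preadditive C]
  [MonoidalPreadditive C] {V T : C}

/-- The quantum symmetrizer `𝔖` of a braided tensor algebra, with the projections `π n` to the
graded pieces, the braided derivation `d` and the map `δ` that splits off the last letter. -/
structure Sym (D : Data V T) where
  π : ℕ → (T ⟶ T)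
  d : T ⟶ T ⊗ T
  δ : T ⟶ T ⊗ T
  𝔖 : T ⟶ T
  -- The homogeneous projections replace the inclusions as the family that detects equality, so that
  -- inductions on degree can be run on maps of T itself.
  ext : ∀ {P W X : C} (f g : P ⊗ (T ⊗ W) ⟶ X),
    (∀ n, P ◁ t11 (π n) W ≫ f = P ◁ t11 (π n) W ≫ g) → f = g
  d_eq : ∀ W, t12 d W = t12 D.Δ W ≫ T ◁ t11 (π 1) W
  π_zero : ∀ W, t11 (π 0) W = t10 D.ε W ≫ t01 D.one W
  one_π : ∀ W, t01 D.one W ≫ t11 (π 1) W = 0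
  π_ε : ∀ n W, t11 (π (n + 1)) W ≫ t10 D.ε W = 0
  mul_π : ∀ W, t21 D.mul W ≫ t11 (π 1) W =
    T ◁ t10 D.ε W ≫ t11 (π 1) W + t10 D.ε (T ⊗ W) ≫ t11 (π 1) W
  π_d : ∀ n W, t11 (π (n + 1)) W ≫ t12 d W = t12 d W ≫ t11 (π n) (T ⊗ W)
  β_π : ∀ n W, t22 D.β W ≫ T ◁ t11 (π n) W = t11 (π n) (T ⊗ W) ≫ t22 D.β W
  π_β : ∀ n W, t22 D.β W ≫ t11 (π n) (T ⊗ W) = T ◁ t11 (π n) W ≫ t22 D.β W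
  one_δ : ∀ W, t01 D.one W ≫ t12 δ W = 0
  -- Words are free: multiplication on the right by an element of degree one is undone by splitting
  -- off the last letter.
  mul_δ : ∀ W, T ◁ t11 (π 1) W ≫ t21 D.mul W ≫ t12 δ W = T ◁ t11 (π 1) W
  𝔖_eq : ∀ W, t11 𝔖 W =
    t10 D.ε W ≫ t01 D.one W + t12 d W ≫ t11 𝔖 (T ⊗ W) ≫ t21 D.mul W

/-! ### The kernel of the quantum symmetrizer is an ideal and a coideal -/

namespace Sym

variable {D : Data V T} (Y : Sym D)

theorem one_d (W : C) : t01 D.one W ≫ t12 Y.d W = 0 := by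
  rw [Y.d_eq, comp_eq (D.Δ_one W), Category.assoc, ← t01_nat, comp_eq (Y.one_π W),
    Limits.zero_comp]

theorem one_𝔖 (W : C) : t01 D.one W ≫ t11 Y.𝔖 W = t01 D.one W := by
  rw [Y.𝔖_eq, Preadditive.comp_add, comp_eq (D.ε_one W), comp_eq (Y.one_d W)]
  simp

/-- Apply δ to the recursion for 𝔖: the scalar term dies and δ cancels the final multiplication by a
letter. Hence 𝔖x = 0 implies (𝔖 ⊗ 1)dx = 0, which drives both kernel theorems. -/
theorem 𝔖_δ (W : C) : t11 Y.𝔖 W ≫ t12 Y.δ W = t12 Y.d W ≫ t11 Y.𝔖 (T ⊗ W) := by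
  rw [Y.𝔖_eq, Preadditive.add_comp, Category.assoc, Y.one_δ, Y.d_eq]
  simp only [Category.assoc, Limits.comp_zero, zero_add, t11_nat_assoc, Y.mul_δ, t11_nat]

theorem d_Δ (W : C) : t12 D.Δ W ≫ T ◁ t12 Y.d W = t12 Y.d W ≫ t12 D.Δ (T ⊗ W) := by
  rw [Y.d_eq, MonoidalCategory.whiskerLeft_comp, comp_eq (D.comul_assoc W).symm]
  simp only [Category.assoc, t12_nat]

/-- The braided Leibniz rule. Apply 1 ⊗ π₁ to multiplicativity of Δ: a product has a degree one part
only if one of its factors contributes a scalar, and the counit axioms remove that factor. -/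
theorem mul_d (W : C) : t21 D.mul W ≫ t12 Y.d W =
    T ◁ t12 Y.d W ≫ t21 D.mul (T ⊗ W) +
      t12 Y.d (T ⊗ W) ≫ T ◁ t22 D.β W ≫ t21 D.mul (T ⊗ W) := by
  rw [Y.d_eq, Y.d_eq, comp_eq (D.mul_comul W)]
  simp only [Category.assoc, ← t21_nat_assoc, ← t21_nat]
  rw [comp_eq (whisk_eq T (whisk_eq T (Y.mul_π W)))]
  simp only [MonoidalPreadditive.whiskerLeft_add, Preadditive.comp_add, Preadditive.add_comp,
    MonoidalCategory.whiskerLeft_comp, Category.assoc]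
  rw [add_comm, comp_eq (whisk_eq T (D.counit_right (T ⊗ W))), t10_nat₁_assoc,
    comp_eq (D.comul_counit (T ⊗ W)), ← t22_nat₁_assoc,
    comp_eq (whisk_eq T (whisk_eq T (D.comul_counit W))), comp_eq (whisk_eq T (Y.β_π _ _))]
  simp

theorem β_d (W : C) : t22 D.β W ≫ T ◁ t12 Y.d W =
    t12 Y.d (T ⊗ W) ≫ T ◁ t22 D.β W ≫ t22 D.β (T ⊗ W) := by
  rw [Y.d_eq, Y.d_eq, MonoidalCategory.whiskerLeft_comp, comp_eq (D.comul_left W).symm]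
  simp only [Category.assoc, ← t22_nat, comp_eq (whisk_eq _ (Y.β_π _ _)), whisk_eq _ (Y.β_π _ _),
    MonoidalCategory.whiskerLeft_comp]

theorem d_β (W : C) : t22 D.β W ≫ t12 Y.d (T ⊗ W) =
    T ◁ t12 Y.d W ≫ t22 D.β (T ⊗ W) ≫ T ◁ t22 D.β W := by
  rw [Y.d_eq, Y.d_eq, MonoidalCategory.whiskerLeft_comp, comp_eq (D.comul_right W).symm]
  simp only [Category.assoc, t22_nat_assoc, comp_eq (whisk_eq _ (Y.π_β _ _)),
    whisk_eq _ (Y.π_β _ _), MonoidalCategory.whiskerLeft_comp]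

/-- Induction on the degree of the word to which 𝔖 is applied: both ingredients of the recursion, d
and the product, are compatible with the braiding, and d lowers the degree by one. -/
theorem 𝔖_β_right (W : C) : T ◁ t11 Y.𝔖 W ≫ t22 D.β W = t22 D.β W ≫ t11 Y.𝔖 (T ⊗ W) := by
  refine Y.ext _ _ fun n => ?_
  induction n generalizing W with
  | zero =>
    simp only [Y.π_zero, MonoidalCategory.whiskerLeft_comp, Category.assoc,
      comp_eq (whisk_eq T (Y.one_𝔖 _)), D.β_one, comp_eq (D.β_one _), Y.one_𝔖]
  | succ n ih =>
    have ih' := fun R (k : _ ⟶ R) => comp_eq₃ (ih (T ⊗ W)) k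
    simp only [Category.assoc] at ih'
    have hε := comp_eq (whisk_eq T (Y.π_ε n W)) (T ◁ t01 D.one W ≫ t22 D.β W)
    have hd := fun R (k : _ ⟶ R) => comp_eq (whisk_eq T (Y.π_d n W)) k
    simp only [MonoidalCategory.whiskerLeft_comp, Category.assoc] at hd
    conv_lhs => rw [Y.𝔖_eq W]
    conv_rhs => rw [Y.𝔖_eq (T ⊗ W)]
    simp only [MonoidalPreadditive.whiskerLeft_add, Preadditive.comp_add,
      Preadditive.add_comp, MonoidalCategory.whiskerLeft_comp, Category.assoc, hε,
      comp_eq (D.counit_left W), hd]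
    rw [comp_eq (whisk_eq T (Y.π_ε n W))]
    simp only [MonoidalPreadditive.whiskerLeft_zero, Limits.zero_comp, zero_add]
    rw [D.mul_right, ih', comp_eq (Y.d_β W)]
    simp only [Category.assoc, hd, ← t11_nat_assoc]

theorem 𝔖_β_left (W : C) : t11 Y.𝔖 (T ⊗ W) ≫ t22 D.β W = t22 D.β W ≫ T ◁ t11 Y.𝔖 W := by
  have key : ∀ n W, t11 (Y.π n) (T ⊗ W) ≫ t11 Y.𝔖 (T ⊗ W) ≫ t22 D.β W =
      t11 (Y.π n) (T ⊗ W) ≫ t22 D.β W ≫ T ◁ t11 Y.𝔖 W := by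
    intro n
    induction n with
    | zero =>
      intro W
      simp only [Y.π_zero, Category.assoc, comp_eq (Y.one_𝔖 _), D.one_β,
        comp_eq (D.one_β _), whisk_eq T (Y.one_𝔖 _)]
    | succ n ih =>
      intro W
      have ih' := fun R (k : _ ⟶ R) => comp_eq₃ (ih (T ⊗ W)) k
      simp only [Category.assoc] at ih'
      conv_lhs => rw [Y.𝔖_eq (T ⊗ W)]
      conv_rhs => rw [Y.𝔖_eq W]
      simp only [MonoidalPreadditive.whiskerLeft_add, Preadditive.comp_add,
        Preadditive.add_comp, MonoidalCategory.whiskerLeft_comp, Category.assoc,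
        comp_eq (D.counit_right W), comp_eq (Y.π_ε n _), Limits.zero_comp, zero_add]
      rw [D.mul_left, comp_eq (Y.π_d n _), comp_eq (Y.β_d W)]
      simp only [Category.assoc, ← t11_nat_assoc]
      rw [ih', t11_nat_assoc, comp_eq (Y.π_d n _).symm]
      simp only [Category.assoc]
  -- The extensionality principle concerns the second tensor factor, so a unit object is put in
  -- front.
  have := Y.ext (P := 𝟙_ C) (W := T ⊗ W) ((λ_ _).hom ≫ t11 Y.𝔖 (T ⊗ W) ≫ t22 D.β W)
    ((λ_ _).hom ≫ t22 D.β W ≫ T ◁ t11 Y.𝔖 W) (fun n => by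
      simp only [leftUnitor_naturality_assoc, key])
  simpa only [cancel_epi] using this

/-- Induction on the degree m of the right factor. In degree zero the right factor is the counit,
and (𝔖 ⊗ ε)Δ is 𝔖. In degree m + 1 the recursion for 𝔖 on the right factor produces (1 ⊗ d)Δ = (Δ ⊗
1)d, and dz is again annihilated by 𝔖 on its first factor. Since d lengthens the tail, the claim is
made for generalized elements `z` with any tail. -/
theorem comul_ker (m : ℕ) : ∀ {W Z : C} (z : Z ⟶ T ⊗ W), z ≫ t11 Y.𝔖 W = 0 →
    z ≫ t12 D.Δ W ≫ t11 Y.𝔖 (T ⊗ W) ≫ T ◁ t11 (Y.π m) W ≫ T ◁ t11 Y.𝔖 W = 0 := by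
  induction m with
  | zero =>
    intro W Z z hz
    have := congr($hz ≫ T ◁ t01 D.one W)
    simp only [Category.assoc, Limits.zero_comp] at this
    simp only [Y.π_zero, MonoidalCategory.whiskerLeft_comp, Category.assoc,
      whisk_eq T (Y.one_𝔖 _)]
    rw [← t11_nat_assoc, comp_eq (D.comul_counit W), Category.id_comp, this]
  | succ m ih =>
    intro W Z z hz
    have h1 := ih (z ≫ t12 Y.d W) (by
      rw [Category.assoc, ← Y.𝔖_δ, ← Category.assoc, hz, Limits.zero_comp])
    have h2 := congr($h1 ≫ T ◁ t21 D.mul W)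
    simp only [Category.assoc, Limits.zero_comp] at h2
    rw [Y.𝔖_eq W]
    simp only [Preadditive.comp_add, MonoidalPreadditive.whiskerLeft_add,
      MonoidalCategory.whiskerLeft_comp, comp_eq (whisk_eq T (Y.π_ε m _)),
      comp_eq (whisk_eq T (Y.π_d m _)), Category.assoc]
    simp only [MonoidalPreadditive.whiskerLeft_zero, Limits.zero_comp, Limits.comp_zero, zero_add]
    rw [← t11_nat_assoc, comp_eq (Y.d_Δ W), Category.assoc]
    exact h2

/-- Double induction on the degrees. By the recursion and the Leibniz rule, 𝔖(xy) is assembled from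
𝔖 of x·dy and 𝔖 of dx multiplied by y with the letter moved past y. The first has a right factor of
smaller degree, the second a left factor of smaller degree. If one degree is zero, that factor is a
scalar and 𝔖 fixes it. -/
theorem mul_ker (n m : ℕ) : ∀ {W Z : C} (z : Z ⟶ T ⊗ (T ⊗ W)),
    z ≫ t11 (Y.π n) (T ⊗ W) ≫ T ◁ t11 (Y.π m) W ≫ t11 Y.𝔖 (T ⊗ W) ≫ T ◁ t11 Y.𝔖 W = 0 →
    z ≫ t11 (Y.π n) (T ⊗ W) ≫ T ◁ t11 (Y.π m) W ≫ t21 D.mul W ≫ t11 Y.𝔖 W = 0 := by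
  induction n generalizing m with
  | zero =>
    intro W Z z hz
    have := congr($hz ≫ t10 D.ε (T ⊗ W))
    simp only [Y.π_zero, Category.assoc, ← t01_nat_assoc, comp_eq (Y.one_𝔖 _), D.ε_one,
      Category.comp_id, Limits.zero_comp] at this
    simpa only [Y.π_zero, Category.assoc, ← t01_nat_assoc, comp_eq (D.one_mul _),
      Category.id_comp] using this
  | succ n ihn =>
    induction m with
    | zero =>
      intro W Z z hz
      have := congr($hz ≫ T ◁ t10 D.ε W)
      simp only [Y.π_zero, Category.assoc, MonoidalCategory.whiskerLeft_comp, t11_nat_assoc,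
        comp_eq (whisk_eq T (Y.one_𝔖 _)), whisk_eq T (D.ε_one _),
        Limits.zero_comp, MonoidalCategory.whiskerLeft_id, Category.comp_id] at this
      rw [← t11_nat] at this
      simp only [Y.π_zero, Category.assoc, MonoidalCategory.whiskerLeft_comp,
        comp_eq (D.mul_one _), Category.id_comp]
      exact this
    | succ m ihm =>
      intro W Z z hz
      -- Splitting off the last letter of 𝔖y shows that x ⊗ dy satisfies the hypothesis.
      have hδ := congr($hz ≫ T ◁ t12 Y.δ W)
      -- Splitting off the last letter of 𝔖x and moving it past 𝔖y does the same for the other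
      -- Leibniz term, because 𝔖 commutes with the braiding.
      have hβ := congr($hz ≫ t12 Y.δ (T ⊗ W) ≫ T ◁ t22 D.β W)
      simp only [Category.assoc, Limits.zero_comp] at hδ hβ
      have eπ := whisk_eq T (Y.π_β (m + 1) W)
      have e𝔖 := whisk_eq T (Y.𝔖_β_right W).symm
      have eδ : ∀ {R : C} (k : T ⊗ (T ⊗ (T ⊗ W)) ⟶ R), t12 Y.d (T ⊗ W) ≫
          t11 (Y.π n) (T ⊗ (T ⊗ W)) ≫ t11 Y.𝔖 (T ⊗ (T ⊗ W)) ≫ k =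
          t11 (Y.π (n + 1)) (T ⊗ W) ≫ t11 Y.𝔖 (T ⊗ W) ≫ t12 Y.δ (T ⊗ W) ≫ k := by
        intro R k
        rw [comp_eq (Y.π_d n (T ⊗ W)).symm, Category.assoc, comp_eq (Y.𝔖_δ (T ⊗ W)),
          Category.assoc]
      simp only [MonoidalCategory.whiskerLeft_comp] at eπ e𝔖
      have h1 := congr($(ihm (z ≫ T ◁ t12 Y.d W) (by
        simp only [Category.assoc, t11_nat_assoc]
        rw [comp_eq (whisk_eq T (Y.π_d m W).symm)]
        simp only [Category.assoc, MonoidalCategory.whiskerLeft_comp]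
        rw [whisk_eq T (Y.𝔖_δ W)] at hδ
        simp only [Category.assoc, MonoidalCategory.whiskerLeft_comp, ← t11_nat_assoc] at hδ ⊢
        exact hδ)) ≫ t21 D.mul W)
      have h2 := congr($(ihn (m + 1) (z ≫ t12 Y.d (T ⊗ W) ≫ T ◁ t22 D.β W) (by
        simp only [Category.assoc, t11_nat_assoc, comp_eq eπ, e𝔖, eδ, t12_nat_assoc] at hβ ⊢
        exact hβ)) ≫ t21 D.mul W)
      simp only [Category.assoc, Limits.zero_comp] at h1 h2
      rw [Y.𝔖_eq W]
      simp only [Preadditive.comp_add, comp_eq (D.mul_ε W), comp_eq (Y.mul_d W),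
        Preadditive.add_comp, Category.assoc]
      rw [comp_eq (whisk_eq T (Y.π_ε m _))]
      simp only [MonoidalPreadditive.whiskerLeft_zero, Limits.zero_comp, Limits.comp_zero, zero_add]
      have e1 := whisk_eq T (Y.π_d m W)
      simp only [MonoidalCategory.whiskerLeft_comp] at e1
      simp only [t11_nat_assoc, comp_eq e1, comp_eq eπ, Category.assoc] at h1 h2
      simp only [comp_eq e1, t12_nat_assoc, comp_eq (Y.π_d n (T ⊗ W)), Category.assoc, h1, h2,
        add_zero, t11_nat_assoc]

theorem 𝔖_β_right_std : T ◁ Y.𝔖 ≫ D.β = D.β ≫ Y.𝔖 ▷ T := by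
  refine Data.of_whiskerRight_unit ?_
  calc _ = 𝟙 _ ⊗≫ (T ◁ t11 Y.𝔖 (𝟙_ C) ≫ t22 D.β (𝟙_ C)) ⊗≫ 𝟙 _ := by
        simp only [t11, t22]; monoidal
    _ = _ := by rw [Y.𝔖_β_right]; simp only [t11, t22]; monoidal

theorem 𝔖_β_left_std : Y.𝔖 ▷ T ≫ D.β = D.β ≫ T ◁ Y.𝔖 := by
  refine Data.of_whiskerRight_unit ?_
  calc _ = 𝟙 _ ⊗≫ (t11 Y.𝔖 (T ⊗ 𝟙_ C) ≫ t22 D.β (𝟙_ C)) ⊗≫ 𝟙 _ := by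
        simp only [t11, t22]; monoidal
    _ = _ := by rw [Y.𝔖_β_left]; simp only [t11, t22]; monoidal

theorem comul_ker_std (m : ℕ) {Z : C} (z : Z ⟶ T) (hz : z ≫ Y.𝔖 = 0) :
    z ≫ D.Δ ≫ (Y.𝔖 ⊗ₘ (Y.π m ≫ Y.𝔖)) = 0 := by
  have := Y.comul_ker m (z ≫ (ρ_ T).inv) (by
    rw [t11, Category.assoc, ← rightUnitor_inv_naturality, comp_eq hz, Limits.zero_comp])
  have := congr($this ≫ T ◁ (ρ_ T).hom)
  simp only [Limits.zero_comp, Category.assoc] at this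
  rw [← this]
  congr 1
  simp only [t11, t12, MonoidalCategory.tensorHom_def]
  monoidal

theorem mul_ker_std (n m : ℕ) {Z : C} (z : Z ⟶ T ⊗ T)
    (hz : z ≫ ((Y.π n ≫ Y.𝔖) ⊗ₘ (Y.π m ≫ Y.𝔖)) = 0) :
    z ≫ (Y.π n ⊗ₘ Y.π m) ≫ D.mul ≫ Y.𝔖 = 0 := by
  have := Y.mul_ker n m (z ≫ T ◁ (ρ_ T).inv) (by
    have := congr($hz ≫ T ◁ (ρ_ T).inv)
    simp only [Limits.zero_comp, Category.assoc] at this ⊢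
    rw [← this]
    congr 1
    simp only [t11_nat_assoc]
    simp only [t11, MonoidalCategory.tensorHom_def]
    monoidal)
  have := congr($this ≫ (ρ_ T).hom)
  simp only [Limits.zero_comp, Category.assoc] at this
  rw [← this]
  congr 1
  simp only [t11, t21, MonoidalCategory.tensorHom_def]
  monoidal

end Sym

end Tail

noncomputable section

namespace BanNA

/-! ### The additive structure on morphisms, contractions -/

section Additive

variable {k : Type u} [NormedField k] {A B C X : BanNA k}

theorem norm_le_max_of_bounds {x y : A} {M N r : ℝ} (hr : 0 ≤ r) (hx : ‖x‖ ≤ M * r)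
    (hy : ‖y‖ ≤ N * r) : ‖x + y‖ ≤ max M N * r :=
  (IsUltrametricDist.norm_add_le_max x y).trans (max_le
    (hx.trans (mul_le_mul_of_nonneg_right (le_max_left _ _) hr))
    (hy.trans (mul_le_mul_of_nonneg_right (le_max_right _ _) hr)))

instance : Add (A ⟶ B) := ⟨fun f g => ⟨Hom.lin f + Hom.lin g, by
  obtain ⟨M, hM⟩ := Hom.bound f
  obtain ⟨N, hN⟩ := Hom.bound g
  exact ⟨max M N, fun x => norm_le_max_of_bounds (norm_nonneg x) (hM x) (hN x)⟩⟩⟩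

instance : Zero (A ⟶ B) := ⟨⟨0, 0, fun x => by simp⟩⟩

instance : Neg (A ⟶ B) := ⟨fun f => ⟨-Hom.lin f, by
  obtain ⟨M, hM⟩ := Hom.bound f
  exact ⟨M, fun x => by simpa using hM x⟩⟩⟩

@[simp] theorem add_apply (f g : A ⟶ B) (x : A) : (f + g) x = f x + g x := rfl

@[simp] theorem zero_apply (x : A) : (0 : A ⟶ B) x = 0 := rfl

instance : AddCommGroup (A ⟶ B) where
  add_assoc f g h := hom_ext fun x => add_assoc (f x) (g x) (h x)
  zero_add f := hom_ext fun x => zero_add (f x)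
  add_zero f := hom_ext fun x => add_zero (f x)
  add_comm f g := hom_ext fun x => add_comm (f x) (g x)
  neg_add_cancel f := hom_ext fun x => neg_add_cancel (f x)
  nsmul := nsmulRec
  zsmul := zsmulRec

instance : Preadditive (BanNA k) where
  add_comp _ _ _ f g h := hom_ext fun x => map_add (Hom.lin h) (f x) (g x)
  comp_add _ _ _ _ _ _ := rfl

theorem map_zero' (f : A ⟶ B) : f 0 = 0 := map_zero (Hom.lin f)

theorem map_sub' (f : A ⟶ B) (x y : A) : f (x - y) = f x - f y := map_sub (Hom.lin f) x y

/-- Morphisms of norm at most `1`. -/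
def IsContr (f : A ⟶ B) : Prop := ∀ x, ‖f x‖ ≤ ‖x‖

theorem IsContr.id : IsContr (𝟙 A) := fun _ => le_rfl

theorem IsContr.comp {f : A ⟶ B} {g : B ⟶ C} (hf : IsContr f) (hg : IsContr g) :
    IsContr (f ≫ g) := fun x => (hg _).trans (hf x)

theorem IsContr.add {f g : A ⟶ B} (hf : IsContr f) (hg : IsContr g) : IsContr (f + g) :=
  fun x => (IsUltrametricDist.norm_add_le_max _ _).trans (max_le (hf x) (hg x))

theorem IsContr.neg {f : A ⟶ B} (hf : IsContr f) : IsContr (-f) :=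
  fun x => (norm_neg (f x)).trans_le (hf x)

theorem IsContr.zero : IsContr (0 : A ⟶ B) := fun x => by simp

theorem isContr_incl {E : ℕ → BanNA k} (n : ℕ) : IsContr (incl E n) := fun a => (norm_incl n a).le

theorem isContr_proj {E : ℕ → BanNA k} (n : ℕ) : IsContr (proj E n) := fun x => norm_coord_le x n

theorem isContr_lift {f : A → B → X} {hadd hsmul hadd' hsmul'} {h} :
    IsContr (lift f hadd hsmul hadd' hsmul' 1 zero_le_one h : tensor A B ⟶ X) := fun x =>
  (norm_lift_apply_le f hadd hsmul hadd' hsmul' 1 zero_le_one h x).trans_eq (one_mul _)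

theorem incl_proj_self {E : ℕ → BanNA k} (n : ℕ) : incl E n ≫ proj E n = 𝟙 _ :=
  hom_ext fun a => coord_incl_self n a

theorem incl_proj_ne {E : ℕ → BanNA k} {n m : ℕ} (h : m ≠ n) : incl E n ≫ proj E m = 0 :=
  hom_ext fun a => coord_incl_ne a h

end Additive

variable {k : Type u} [NormedField k] [IsUltrametricDist k] [CompleteSpace k]

/-! ### Contractions, and maps out of tensor products of contracting coproducts -/

section Contraction

variable {A B C A' B' X W P : BanNA k} {E : ℕ → BanNA k}

instance : MonoidalPreadditive (BanNA k) where
  whiskerLeft_zero := tensor_ext fun a b => by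
    rw [whiskerLeft_tmul, zero_apply, zero_apply]; exact map_zero (Hom.lin (tmulL _ a))
  zero_whiskerRight := tensor_ext fun a b => by
    rw [whiskerRight_tmul, zero_apply, zero_apply]; exact map_zero (Hom.lin (tmulR _ b))
  whiskerLeft_add f g := tensor_ext fun a b => by simp [tmul_add]
  add_whiskerRight f g := tensor_ext fun a b => by simp [add_tmul]

/-- The tensor product of maps was defined with a chosen bound that carries no information. The map
is therefore identified with the extension of the same bilinear map with bound 1. -/
theorem tensorMap_contr {f : A ⟶ A'} {g : B ⟶ B'} (hf : IsContr f) (hg : IsContr g) :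
    IsContr (f ⊗ₘ g) := by
  have h : f ⊗ₘ g = (lift (fun a b => ptmul (f a) (g b))
      (fun a a' b => by simp only [map_add', add_ptmul])
      (fun c a b => by simp only [map_smul', smul_ptmul])
      (fun a b b' => by simp only [map_add', ptmul_add])
      (fun c a b => by simp only [map_smul', ptmul_smul])
      1 zero_le_one (fun a b => (norm_ptmul_le _ _).trans (by
        rw [one_mul]
        exact mul_le_mul (hf a) (hg b) (norm_nonneg _) (norm_nonneg _))) :
      tensor A B ⟶ tensor A' B') := tensor_ext fun a b => by
    rw [tensorHom_tmul]
    exact (lift_ptmul (f := fun a b => ptmul (f a) (g b)) _ _ _ _ _ _ _ a b).symm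
  rw [h]
  exact isContr_lift

theorem IsContr.whiskerLeft {f : A ⟶ B} (hf : IsContr f) (W : BanNA k) : IsContr (W ◁ f) := by
  rw [← id_tensorHom]; exact tensorMap_contr .id hf

theorem IsContr.whiskerRight {f : A ⟶ B} (hf : IsContr f) (W : BanNA k) : IsContr (f ▷ W) := by
  rw [← tensorHom_id]; exact tensorMap_contr hf .id

theorem isContr_assocHom : IsContr (assocHom A B C) := fun x =>
  (norm_lift_apply_le _ _ _ _ _ _ _ _ x).trans_eq (one_mul _)

theorem isContr_swap : IsContr (swap A B) := fun x =>
  (norm_lift_apply_le _ _ _ _ _ _ _ _ x).trans_eq (one_mul _)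

theorem isContr_lunit : IsContr (lunit A) := fun x =>
  (norm_lift_apply_le _ _ _ _ _ _ _ _ x).trans_eq (one_mul _)

theorem isContr_associator_hom : IsContr (α_ A B C).hom := isContr_assocHom

theorem isContr_braiding : IsContr (β_ A B).hom := isContr_swap

theorem isContr_associator_inv : IsContr (α_ A B C).inv :=
  isContr_swap.comp (isContr_assocHom.comp (isContr_swap.comp
    (isContr_assocHom.comp isContr_swap)))

theorem isContr_leftUnitor_hom : IsContr (λ_ A).hom := isContr_lunit

theorem isContr_rightUnitor_hom : IsContr (ρ_ A).hom := isContr_swap.comp isContr_lunit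

theorem isContr_leftUnitor_inv : IsContr (λ_ A).inv := fun a => by
  rw [leftUnitor_inv_apply]
  exact (norm_tmul_le _ _).trans_eq (by rw [norm_sOne, one_mul])

theorem isContr_rightUnitor_inv : IsContr (ρ_ A).inv := fun a => by
  rw [rightUnitor_inv_apply]
  exact (norm_tmul_le _ _).trans_eq (by rw [norm_sOne, mul_one])

theorem norm_apply_tmul_le {f : A ⊗ B ⟶ X} (hf : IsContr f) (a : A) (b : B) :
    ‖f (tmul a b)‖ ≤ ‖b‖ * ‖a‖ :=
  (hf _).trans ((norm_tmul_le a b).trans_eq (mul_comm _ _))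

theorem summable_apply_tmul {f : ∀ n, E n ⊗ W ⟶ X} (hf : ∀ n, IsContr (f n)) (x : contrCoprod E)
    (w : W) : Summable fun n => f n (tmul (coord x n) w) :=
  tendsto_of_bound (fun n a => f n (tmul a w)) (fun n a => norm_apply_tmul_le (hf n) a w) x

/-- A family of contractions `Eₙ ⊗ W ⟶ X` induces a map `(∐ Eₙ) ⊗ W ⟶ X`. -/
def tensorDesc (f : ∀ n, E n ⊗ W ⟶ X) (hf : ∀ n, IsContr (f n)) : contrCoprod E ⊗ W ⟶ X :=
  lift (fun x w => ∑' n, f n (tmul (coord x n) w))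
    (fun x y w => by
      simp only [coord_add, add_tmul, map_add']
      exact (summable_apply_tmul hf x w).tsum_add (summable_apply_tmul hf y w))
    (fun c x w => by
      simp only [coord_smul, smul_tmul, map_smul']
      exact (summable_apply_tmul hf x w).tsum_const_smul c)
    (fun x w w' => by
      simp only [tmul_add, map_add']
      exact (summable_apply_tmul hf x w).tsum_add (summable_apply_tmul hf x w'))
    (fun c x w => by
      simp only [tmul_smul, map_smul']
      exact (summable_apply_tmul hf x w).tsum_const_smul c)
    1 zero_le_one fun x w => IsUltrametricDist.norm_tsum_le_of_forall_le_of_nonneg (by positivity)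
      fun n => (norm_apply_tmul_le (hf n) _ w).trans (by
        rw [one_mul, mul_comm]
        exact mul_le_mul_of_nonneg_right (norm_coord_le x n) (norm_nonneg w))

theorem isContr_tensorDesc {f : ∀ n, E n ⊗ W ⟶ X} {hf : ∀ n, IsContr (f n)} :
    IsContr (tensorDesc f hf) := fun x =>
  (norm_lift_apply_le _ _ _ _ _ _ _ _ x).trans_eq (one_mul _)

theorem tensorDesc_tmul (f : ∀ n, E n ⊗ W ⟶ X) (hf : ∀ n, IsContr (f n)) (x : contrCoprod E)
    (w : W) : tensorDesc f hf (tmul x w) = ∑' n, f n (tmul (coord x n) w) :=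
  lift_ptmul _ _ _ _ _ _ _ _ _ _

theorem incl_tensorDesc (f : ∀ n, E n ⊗ W ⟶ X) (hf : ∀ n, IsContr (f n)) (n : ℕ) :
    incl E n ▷ W ≫ tensorDesc f hf = f n := tensor_ext fun a w => by
  rw [comp_apply, whiskerRight_tmul, tensorDesc_tmul]
  refine (tsum_eq_single n fun m hm => ?_).trans (by rw [coord_incl_self])
  rw [coord_incl_ne a hm]
  exact map_zero (Hom.lin (tmulR _ w ≫ f m))

/-- With the outer entries of a pure tensor fixed, the map is bounded and linear in the coproduct
variable, hence determined on the summands. -/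
theorem whisker_incl_ext {f g : P ⊗ (contrCoprod E ⊗ W) ⟶ X}
    (h : ∀ n, P ◁ (incl E n ▷ W) ≫ f = P ◁ (incl E n ▷ W) ≫ g) : f = g :=
  tensor_ext_right fun p x w => by
    have : tmulR _ w ≫ tmulL _ p ≫ f = tmulR _ w ≫ tmulL _ p ≫ g := contrCoprod_ext fun n a => by
      have := congr($(h n) (tmul p (tmul a w)))
      simpa [tmulL_apply, tmulR_apply] using this
    exact congr($this x)

theorem incl_whiskerRight_ext {f g : contrCoprod E ⊗ W ⟶ X}
    (h : ∀ n, incl E n ▷ W ≫ f = incl E n ▷ W ≫ g) : f = g :=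
  tensor_ext fun x w => by
    have : tmulR _ w ≫ f = tmulR _ w ≫ g := contrCoprod_ext fun n a => by
      have := congr($(h n) (tmul a w))
      simpa [tmulR_apply] using this
    exact congr($this x)

theorem incl_whiskerLeft_ext {f g : P ⊗ contrCoprod E ⟶ X}
    (h : ∀ n, P ◁ incl E n ≫ f = P ◁ incl E n ≫ g) : f = g :=
  tensor_ext fun p x => by
    have : tmulL _ p ≫ f = tmulL _ p ≫ g := contrCoprod_ext fun n a => by
      have := congr($(h n) (tmul p a))
      simpa [tmulL_apply] using this
    exact congr($this x)

end Contraction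

/-! ### Maps defined by recursion on the tensor algebra -/

section Recursion

variable {V X P : BanNA k}

/-- The inclusion of the `n`-th tensor power. -/
def inclT (V : BanNA k) (n : ℕ) : tensorPow V n ⟶ tensorAlg V := incl (tensorPow V) n

theorem isContr_inclT (n : ℕ) : IsContr (inclT V n) := isContr_incl n

theorem inclT_ext {f g : tensorAlg V ⟶ X} (h : ∀ n, inclT V n ≫ f = inclT V n ≫ g) : f = g :=
  contrCoprod_ext fun n a => congr($(h n) a)

theorem whisker_inclT_ext {W : BanNA k} {f g : P ⊗ (tensorAlg V ⊗ W) ⟶ X}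
    (h : ∀ n, P ◁ (inclT V n ▷ W) ≫ f = P ◁ (inclT V n ▷ W) ≫ g) : f = g :=
  whisker_incl_ext h

theorem inclT_whiskerRight_ext {W : BanNA k} {f g : tensorAlg V ⊗ W ⟶ X}
    (h : ∀ n, inclT V n ▷ W ≫ f = inclT V n ▷ W ≫ g) : f = g :=
  incl_whiskerRight_ext h

theorem inclT_whiskerLeft_ext {f g : P ⊗ tensorAlg V ⟶ X}
    (h : ∀ n, P ◁ inclT V n ≫ f = P ◁ inclT V n ≫ g) : f = g :=
  incl_whiskerLeft_ext h

/-- A family of contractions `V^{⊗n} ⊗ W ⟶ X` induces a map `T(V) ⊗ W ⟶ X`. -/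
def tensorDescT {W : BanNA k} (f : ∀ n, tensorPow V n ⊗ W ⟶ X) (hf : ∀ n, IsContr (f n)) :
    tensorAlg V ⊗ W ⟶ X := tensorDesc f hf

theorem isContr_tensorDescT {W : BanNA k} {f : ∀ n, tensorPow V n ⊗ W ⟶ X}
    {hf : ∀ n, IsContr (f n)} : IsContr (tensorDescT f hf) := isContr_tensorDesc

theorem inclT_tensorDescT {W : BanNA k} (f : ∀ n, tensorPow V n ⊗ W ⟶ X)
    (hf : ∀ n, IsContr (f n)) (n : ℕ) : inclT V n ▷ W ≫ tensorDescT f hf = f n :=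
  incl_tensorDesc f hf n

/-- Appending a letter to a word. -/
def append (V : BanNA k) : tensorAlg V ⊗ V ⟶ tensorAlg V :=
  tensorDescT (fun n => inclT V (n + 1)) fun n => isContr_inclT (n + 1)

theorem isContr_append : IsContr (append V) := isContr_tensorDescT

theorem inclT_append (n : ℕ) :
    inclT V n ▷ V ≫ append V = inclT V (n + 1) :=
  inclT_tensorDescT _ _ n

/-- The components of the map determined by its values on the empty word and on words with a
letter appended. -/
def iterPow (z : P ⟶ X) (s : X ⊗ V ⟶ X) : ∀ n, P ⊗ tensorPow V n ⟶ X
  | 0 => (ρ_ P).hom ≫ z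
  | n + 1 => (α_ P (tensorPow V n) V).inv ≫ iterPow z s n ▷ V ≫ s

theorem isContr_iterPow {z : P ⟶ X} {s : X ⊗ V ⟶ X} (hz : IsContr z) (hs : IsContr s) :
    ∀ n, IsContr (iterPow z s n)
  | 0 => isContr_rightUnitor_hom.comp hz
  | n + 1 => isContr_associator_inv.comp (((isContr_iterPow hz hs n).whiskerRight V).comp hs)

/-- The map out of `P ⊗ T(V)` determined by its values on the empty word and on words with a
letter appended. -/
def iter (z : P ⟶ X) (s : X ⊗ V ⟶ X) (hz : IsContr z) (hs : IsContr s) :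
    P ⊗ tensorAlg V ⟶ X :=
  -- The symmetry of Banach spaces only moves T(V) to the left, where maps out of the coproduct were
  -- constructed; it has nothing to do with `c`.
  (β_ _ _).hom ≫ tensorDescT (fun n => (β_ _ _).hom ≫ iterPow z s n)
    fun n => isContr_braiding.comp (isContr_iterPow hz hs n)

theorem isContr_iter {z : P ⟶ X} {s : X ⊗ V ⟶ X} {hz : IsContr z} {hs : IsContr s} :
    IsContr (iter z s hz hs) := isContr_braiding.comp isContr_tensorDescT

theorem inclT_iter (z : P ⟶ X) (s : X ⊗ V ⟶ X) (hz : IsContr z) (hs : IsContr s) (n : ℕ) :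
    P ◁ inclT V n ≫ iter z s hz hs = iterPow z s n := by
  rw [iter]
  rw [BraidedCategory.braiding_naturality_right_assoc, inclT_tensorDescT]
  simp

theorem one_iter (z : P ⟶ X) (s : X ⊗ V ⟶ X) (hz : IsContr z) (hs : IsContr s) :
    P ◁ inclT V 0 ≫ iter z s hz hs = (ρ_ P).hom ≫ z := inclT_iter z s hz hs 0

theorem append_iter (z : P ⟶ X) (s : X ⊗ V ⟶ X) (hz : IsContr z) (hs : IsContr s) :
    P ◁ append V ≫ iter z s hz hs = (α_ _ _ _).inv ≫ iter z s hz hs ▷ V ≫ s :=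
  whisker_inclT_ext fun n => by
    have h : P ◁ (inclT V n ▷ V ≫ append V) ≫ iter z s hz hs =
        (α_ P (tensorPow V n) V).inv ≫ iterPow z s n ▷ V ≫ s := by
      rw [inclT_append]
      exact inclT_iter z s hz hs (n + 1)
    rw [MonoidalCategory.whiskerLeft_comp, Category.assoc] at h
    rw [h, associator_inv_naturality_middle_assoc,
      ← comp_whiskerRight_assoc, inclT_iter]

end Recursion

end BanNA

end

noncomputable section

namespace BanNA

variable {k : Type u} [NormedField k] [IsUltrametricDist k] [CompleteSpace k]

/-! ### The structure maps of the braided tensor algebra -/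

section Structure

variable {V X : BanNA k}

/-- The empty word. -/
def emptyWord (V : BanNA k) : 𝟙_ (BanNA k) ⟶ tensorAlg V := inclT V 0

theorem isContr_emptyWord : IsContr (emptyWord V) := isContr_inclT 0

theorem iter_unit (z : 𝟙_ (BanNA k) ⟶ X) (s : X ⊗ V ⟶ X) (hz : IsContr z) (hs : IsContr s) :
    emptyWord V ≫ (λ_ _).inv ≫ iter z s hz hs = z := by
  rw [leftUnitor_inv_naturality_assoc]
  have := one_iter z s hz hs
  rw [emptyWord]
  erw [this]
  rw [← unitors_equal, Iso.inv_hom_id_assoc]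

theorem iter_append (z : 𝟙_ (BanNA k) ⟶ X) (s : X ⊗ V ⟶ X) (hz : IsContr z) (hs : IsContr s) :
    append V ≫ (λ_ _).inv ≫ iter z s hz hs = ((λ_ _).inv ≫ iter z s hz hs) ▷ V ≫ s := by
  rw [leftUnitor_inv_naturality_assoc, append_iter]
  simp

/-- Concatenation of words. -/
def concat (V : BanNA k) : tensorAlg V ⊗ tensorAlg V ⟶ tensorAlg V :=
  iter (𝟙 _) (append V) .id isContr_append

theorem isContr_concat : IsContr (concat V) := isContr_iter

theorem one_concat : tensorAlg V ◁ emptyWord V ≫ concat V = (ρ_ _).hom :=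
  (one_iter _ _ _ _).trans (Category.comp_id _)

theorem append_concat : tensorAlg V ◁ append V ≫ concat V =
    (α_ _ _ _).inv ≫ concat V ▷ V ≫ append V := append_iter _ _ _ _

/-- Words with one letter. -/
def letter (V : BanNA k) : V ⟶ tensorAlg V := (λ_ V).inv ≫ emptyWord V ▷ V ≫ append V

theorem letter_eq : letter V = inclV V := by
  rw [letter, emptyWord]
  erw [inclT_append]
  rfl

theorem isContr_letter : IsContr (letter V) :=
  isContr_leftUnitor_inv.comp ((isContr_emptyWord.whiskerRight V).comp isContr_append)

variable (c : V ⊗ V ⟶ V ⊗ V)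

/-- This is where the norm of `c` matters: moving a letter past n letters uses `c` n times, and only
a bound 1 for `c` makes these maps uniformly bounded. -/
theorem isContr_braidPow₁ {c : V ⊗ V ⟶ V ⊗ V} (hc : IsContr c) : ∀ n, IsContr (braidPow₁ c n)
  | 0 => isContr_leftUnitor_hom.comp isContr_rightUnitor_inv
  | n + 1 => isContr_associator_hom.comp <| (hc.whiskerLeft _).comp <|
      isContr_associator_inv.comp <| ((isContr_braidPow₁ hc n).whiskerRight V).comp
        isContr_associator_hom

variable {c} (hc : IsContr c)

/-- Moving a letter past a word. -/
def braidLetter : tensorAlg V ⊗ V ⟶ V ⊗ tensorAlg V :=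
  tensorDescT (fun n => braidPow₁ c n ≫ V ◁ inclT V n) fun n =>
    (isContr_braidPow₁ hc n).comp ((isContr_inclT n).whiskerLeft V)

theorem isContr_braidLetter : IsContr (braidLetter hc) := isContr_tensorDescT

theorem inclT_braidLetter (n : ℕ) :
    inclT V n ▷ V ≫ braidLetter hc = braidPow₁ c n ≫ V ◁ inclT V n := inclT_tensorDescT _ _ n

theorem one_braidLetter : emptyWord V ▷ V ≫ braidLetter hc =
    (λ_ V).hom ≫ (ρ_ V).inv ≫ V ◁ emptyWord V :=
  (inclT_braidLetter hc 0).trans (Category.assoc _ _ _)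

theorem append_braidLetter : append V ▷ V ≫ braidLetter hc =
    (α_ _ _ _).hom ≫ tensorAlg V ◁ c ≫ (α_ _ _ _).inv ≫ braidLetter hc ▷ V ≫
      (α_ _ _ _).hom ≫ V ◁ append V := by
  rw [← cancel_epi (α_ _ _ _).inv]
  refine inclT_whiskerRight_ext fun n => ?_
  have h : (inclT V n ▷ V ≫ append V) ▷ V ≫ braidLetter hc = ((α_ (tensorPow V n) V V).hom ≫
      tensorPow V n ◁ c ≫ (α_ (tensorPow V n) V V).inv ≫ braidPow₁ c n ▷ V ≫
        (α_ V (tensorPow V n) V).hom) ≫ V ◁ (inclT V n ▷ V ≫ append V) := by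
    rw [inclT_append]
    exact inclT_braidLetter hc (n + 1)
  rw [associator_inv_naturality_left_assoc, ← comp_whiskerRight_assoc, h]
  simp only [Iso.inv_hom_id_assoc, Category.assoc, ← whisker_exchange_assoc,
    associator_inv_naturality_left_assoc]
  rw [← comp_whiskerRight_assoc, inclT_braidLetter]
  simp

/-- The pre-braiding of the tensor algebra. -/
def tensorBraid : tensorAlg V ⊗ tensorAlg V ⟶ tensorAlg V ⊗ tensorAlg V :=
  iter ((λ_ _).inv ≫ emptyWord V ▷ tensorAlg V)
    ((α_ _ _ _).hom ≫ tensorAlg V ◁ braidLetter hc ≫ (α_ _ _ _).inv ≫ append V ▷ tensorAlg V)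
    (isContr_leftUnitor_inv.comp (isContr_emptyWord.whiskerRight _))
    (isContr_associator_hom.comp (((isContr_braidLetter hc).whiskerLeft _).comp
      (isContr_associator_inv.comp (isContr_append.whiskerRight _))))

theorem one_tensorBraid : tensorAlg V ◁ emptyWord V ≫ tensorBraid hc =
    (ρ_ _).hom ≫ (λ_ _).inv ≫ emptyWord V ▷ tensorAlg V := one_iter _ _ _ _

theorem append_tensorBraid : tensorAlg V ◁ append V ≫ tensorBraid hc =
    (α_ _ _ _).inv ≫ tensorBraid hc ▷ V ≫ (α_ _ _ _).hom ≫ tensorAlg V ◁ braidLetter hc ≫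
      (α_ _ _ _).inv ≫ append V ▷ tensorAlg V := append_iter _ _ _ _

/-- The action of a letter on `T(V) ⊗ T(V)` through its comultiplication. -/
def comulStep : (tensorAlg V ⊗ tensorAlg V) ⊗ V ⟶ tensorAlg V ⊗ tensorAlg V :=
  (α_ _ _ _).hom ≫ (tensorAlg V ◁ append V +
    tensorAlg V ◁ braidLetter hc ≫ (α_ _ _ _).inv ≫ append V ▷ tensorAlg V)

theorem isContr_comulStep : IsContr (comulStep hc) :=
  isContr_associator_hom.comp ((isContr_append.whiskerLeft _).add
    (((isContr_braidLetter hc).whiskerLeft _).comp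
      (isContr_associator_inv.comp (isContr_append.whiskerRight _))))

/-- The comultiplication of the tensor algebra. -/
def tensorComul : tensorAlg V ⟶ tensorAlg V ⊗ tensorAlg V :=
  (λ_ _).inv ≫ iter ((λ_ _).inv ≫ (emptyWord V ⊗ₘ emptyWord V)) (comulStep hc)
    (isContr_leftUnitor_inv.comp (tensorMap_contr isContr_emptyWord isContr_emptyWord))
    (isContr_comulStep hc)

theorem isContr_tensorComul : IsContr (tensorComul hc) :=
  isContr_leftUnitor_inv.comp isContr_iter

theorem one_tensorComul : emptyWord V ≫ tensorComul hc =
    (λ_ _).inv ≫ (emptyWord V ⊗ₘ emptyWord V) := iter_unit _ _ _ _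

theorem append_tensorComul : append V ≫ tensorComul hc = tensorComul hc ▷ V ≫ comulStep hc :=
  iter_append _ _ _ _

/-- The counit of the tensor algebra. -/
def tensorCounit (V : BanNA k) : tensorAlg V ⟶ 𝟙_ (BanNA k) :=
  (λ_ _).inv ≫ iter (𝟙 _) 0 .id .zero

theorem isContr_tensorCounit : IsContr (tensorCounit V) :=
  isContr_leftUnitor_inv.comp isContr_iter

theorem one_tensorCounit : emptyWord V ≫ tensorCounit V = 𝟙 _ := iter_unit _ _ _ _

theorem append_tensorCounit : append V ≫ tensorCounit V = 0 :=
  (iter_append _ _ _ _).trans Limits.comp_zero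

/-- The antipode of the tensor algebra. -/
def tensorAntipode : tensorAlg V ⟶ tensorAlg V :=
  (λ_ _).inv ≫ iter (emptyWord V) (-(braidLetter hc ≫ letter V ▷ tensorAlg V ≫ concat V))
    isContr_emptyWord ((isContr_braidLetter hc).comp
      ((isContr_letter.whiskerRight _).comp isContr_concat)).neg

theorem one_tensorAntipode : emptyWord V ≫ tensorAntipode hc = emptyWord V := iter_unit _ _ _ _

theorem append_tensorAntipode : append V ≫ tensorAntipode hc = tensorAntipode hc ▷ V ≫
    (-(braidLetter hc ≫ letter V ▷ tensorAlg V ≫ concat V)) :=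
  iter_append _ _ _ _

theorem neg_whiskerRight {A B : BanNA k} (f : A ⟶ B) (W : BanNA k) : (-f) ▷ W = -(f ▷ W) :=
  (tensorRight W).map_neg

open Tail

/-- The recursive description of the structure of the tensor algebra. -/
def tensorData (hb : IsPreBraiding c) : Tail.Data V (tensorAlg V) where
  b := c
  e := tensorPow V
  i := inclT V
  one := emptyWord V
  app := append V
  mul := concat V
  B := braidLetter hc
  β := tensorBraid hc
  Δ := tensorComul hc
  ε := tensorCounit V
  S := tensorAntipode hc
  ext f g h := whisker_inclT_ext h
  zero_iso := Iso.refl _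
  succ_iso n := Iso.refl _
  i_zero := (Category.id_comp _).symm
  i_succ n := (inclT_append n).symm.trans (Category.id_comp _).symm
  -- The pattern of the following fields: coherence isolates the one equation that is not
  -- structural, tensored with the tail, and coherence again closes the other end.
  braid W := by
    calc _ = 𝟙 _ ⊗≫ (c ▷ V ≫ (α_ V V V).hom ≫ V ◁ c ≫ (α_ V V V).inv ≫ c ▷ V ≫
            (α_ V V V).hom) ▷ W ⊗≫ 𝟙 _ := by simp only [t22]; monoidal
      _ = _ := by rw [hb]; simp only [t22]; monoidal
  mul_one W := by
    calc _ = 𝟙 _ ⊗≫ (tensorAlg V ◁ emptyWord V ≫ concat V) ▷ W ⊗≫ 𝟙 _ := by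
          simp only [t01, t21]; monoidal
      _ = _ := by rw [one_concat]; monoidal
  mul_app W := by
    calc _ = 𝟙 _ ⊗≫ (tensorAlg V ◁ append V ≫ concat V) ▷ W ⊗≫ 𝟙 _ := by
          simp only [t21]; monoidal
      _ = _ := by rw [append_concat]; simp only [t21]; monoidal
  B_one W := by
    calc _ = 𝟙 _ ⊗≫ (emptyWord V ▷ V ≫ braidLetter hc) ▷ W ⊗≫ 𝟙 _ := by
          simp only [t01, t22]; monoidal
      _ = _ := by rw [one_braidLetter]; simp only [t01]; monoidal
  B_app W := by
    calc _ = 𝟙 _ ⊗≫ (append V ▷ V ≫ braidLetter hc) ▷ W ⊗≫ 𝟙 _ := by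
          simp only [t21, t22]; monoidal
      _ = _ := by rw [append_braidLetter]; simp only [t21, t22]; monoidal
  β_one W := by
    calc _ = 𝟙 _ ⊗≫ (tensorAlg V ◁ emptyWord V ≫ tensorBraid hc) ▷ W ⊗≫ 𝟙 _ := by
          simp only [t01, t22]; monoidal
      _ = _ := by rw [one_tensorBraid]; simp only [t01]; monoidal
  β_app W := by
    calc _ = 𝟙 _ ⊗≫ (tensorAlg V ◁ append V ≫ tensorBraid hc) ▷ W ⊗≫ 𝟙 _ := by
          simp only [t21, t22]; monoidal
      _ = _ := by rw [append_tensorBraid]; simp only [t21, t22]; monoidal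
  Δ_one W := by
    calc _ = 𝟙 _ ⊗≫ (emptyWord V ≫ tensorComul hc) ▷ W ⊗≫ 𝟙 _ := by
          simp only [t01, t12]; monoidal
      _ = _ := by rw [one_tensorComul]; simp only [t01, MonoidalCategory.tensorHom_def']; monoidal
  Δ_app W := by
    calc _ = (α_ _ _ _).inv ≫ (append V ≫ tensorComul hc) ▷ W ≫ (α_ _ _ _).hom := by
          simp only [t21, t12]; monoidal
      _ = _ := by
        rw [append_tensorComul, comulStep]
        simp only [t12, t21, t22, Preadditive.comp_add, Preadditive.add_comp,
          MonoidalPreadditive.add_whiskerRight]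
        congr 1 <;> monoidal
  ε_one W := by
    calc _ = 𝟙 _ ⊗≫ (emptyWord V ≫ tensorCounit V) ▷ W ⊗≫ 𝟙 _ := by
          simp only [t01, t10]; monoidal
      _ = _ := by rw [one_tensorCounit]; monoidal
  ε_app W := by
    calc _ = (α_ _ _ _).inv ≫ (append V ≫ tensorCounit V) ▷ W ≫ (λ_ _).hom := by
          simp only [t21, t10]; monoidal
      _ = _ := by rw [append_tensorCounit]; simp
  S_one W := by
    calc _ = 𝟙 _ ⊗≫ (emptyWord V ≫ tensorAntipode hc) ▷ W ⊗≫ 𝟙 _ := by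
          simp only [t01, t11]; monoidal
      _ = _ := by rw [one_tensorAntipode]; simp only [t01]; monoidal
  S_app W := by
    calc _ = (α_ _ _ _).inv ≫ (append V ≫ tensorAntipode hc) ▷ W := by
          simp only [t21, t11]; monoidal
      _ = _ := by
        rw [append_tensorAntipode, Preadditive.comp_neg, neg_whiskerRight, Preadditive.comp_neg,
          letter]
        congr 1
        simp only [t01, t11, t21, t22]; monoidal

end Structure

end BanNA

end

noncomputable section

namespace BanNA

variable {k : Type u} [NormedField k] [IsUltrametricDist k] [CompleteSpace k]

/-! ### The grading of T(V) and the graded Hopf algebra structure -/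

section Grading

open MonObj ComonObj

variable {V X : BanNA k}

theorem tmul_zero {A B : BanNA k} (a : A) : tmul a (0 : B) = 0 := map_zero' (tmulL B a)

theorem zero_tmul {A B : BanNA k} (b : B) : tmul (0 : A) b = 0 := map_zero' (tmulR A b)

theorem tensorμ_tmul {A B C D : BanNA k} (a : A) (b : B) (c : C) (d : D) :
    tensorμ A B C D (tmul (tmul a b) (tmul c d)) = tmul (tmul a c) (tmul b d) := by
  simp [tensorμ]

theorem coaction₂_tmul {ρ : X ⟶ disk k ⊗ X} {x y : X} {s t : disk k} (hx : ρ x = tmul s x)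
    (hy : ρ y = tmul t y) : coaction₂ ρ (tmul x y) = tmul (tmul s t) (tmul x y) := by
  rw [coaction₂, comp_apply, tensorHom_tmul, hx, hy, tensorμ_tmul]

theorem one_disk_apply (c : (𝟙_ (BanNA k) : BanNA k)) : η[disk k] c = toScalar c • tElt k 0 :=
  tPow_apply 0 c

theorem mul_disk_tElt (m n : ℕ) : μ[disk k] (tmul (tElt k m) (tElt k n)) = tElt k (m + n) :=
  diskMul_tElt m n

theorem comul_disk_tElt (n : ℕ) : Δ[disk k] (tElt k n) = tmul (tElt k n) (tElt k n) :=
  diskComul_tElt n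

theorem counit_disk_tElt (n : ℕ) : ε[disk k] (tElt k n) = sOne k := diskCounit_tElt n

theorem inclT_tensor_ext {f g : tensorAlg V ⊗ tensorAlg V ⟶ X}
    (h : ∀ n m a b, f (tmul (inclT V n a) (inclT V m b)) = g (tmul (inclT V n a) (inclT V m b))) :
    f = g :=
  inclT_whiskerRight_ext fun n => inclT_whiskerLeft_ext fun m => tensor_ext fun a b => by
    simpa using h n m a b

theorem inclT_tensor_ext₂ {f g : (tensorAlg V ⊗ tensorAlg V) ⊗ V ⟶ X}
    (h : ∀ n m a b v, f (tmul (tmul (inclT V n a) (inclT V m b)) v) =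
      g (tmul (tmul (inclT V n a) (inclT V m b)) v)) : f = g :=
  tensor_ext fun z v => by
    have : tmulR _ v ≫ f = tmulR _ v ≫ g := inclT_tensor_ext fun n m a b => h n m a b v
    exact congr($this z)

/-- The identification of `V` with `V^{⊗1}`. -/
def oneLetter (V : BanNA k) : V ⟶ tensorPow V 1 := (λ_ V).inv

theorem letter_eq_oneLetter : letter V = oneLetter V ≫ inclT V 1 := by
  rw [letter, emptyWord]
  erw [inclT_append]
  rfl

/-- The inclusion of the words of length `n + 1`. -/
def inclSucc (V : BanNA k) (n : ℕ) : tensorPow V n ⊗ V ⟶ tensorAlg V := inclT V (n + 1)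

/-- The identification of `V^{⊗n} ⊗ V` with `V^{⊗(n + 1)}`. -/
def snoc {n : ℕ} (x : (tensorPow V n ⊗ V : BanNA k)) : tensorPow V (n + 1) := x

theorem inclT_append_eq (n : ℕ) : inclT V n ▷ V ≫ append V = inclSucc V n := inclT_append n

/-- Both equations agree by definition. The hypothesis has V^{⊗n} ⊗ V as its source, so tensor
extensionality applies to it syntactically. -/
theorem inclT_succ_congr {n : ℕ} {f g : tensorAlg V ⟶ X}
    (h : inclSucc V n ≫ f = inclSucc V n ≫ g) : inclT V (n + 1) ≫ f = inclT V (n + 1) ≫ g := h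

/-- The coaction of `k{t}` for which `V^{⊗n}` has degree `n`. -/
def tensorCoact (V : BanNA k) : tensorAlg V ⟶ disk k ⊗ tensorAlg V :=
  desc (fun n => inclT V n ≫ tmulL _ (tElt k n)) 1 zero_le_one fun n a =>
    (norm_tmul_le _ _).trans (by
      rw [norm_tElt]; exact mul_le_mul_of_nonneg_left (isContr_inclT n a) zero_le_one)

theorem tensorCoact_inclT (n : ℕ) (a : tensorPow V n) :
    tensorCoact V (inclT V n a) = tmul (tElt k n) (inclT V n a) := desc_incl _ _ _ _ n a

theorem coaction₂_inclT (n m : ℕ) (a : tensorPow V n) (b : tensorPow V m) :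
    coaction₂ (tensorCoact V) (tmul (inclT V n a) (inclT V m b)) =
      tmul (tmul (tElt k n) (tElt k m)) (tmul (inclT V n a) (inclT V m b)) :=
  coaction₂_tmul (tensorCoact_inclT n a) (tensorCoact_inclT m b)

theorem isCoaction_tensorCoact : IsCoaction (tensorCoact V) where
  coassoc := inclT_ext fun n => hom_ext fun a => by
    simp only [comp_apply, tensorCoact_inclT, whiskerLeft_tmul, whiskerRight_tmul,
      comul_disk_tElt, associator_hom_tmul]
  counit := inclT_ext fun n => hom_ext fun a => by
    simp only [comp_apply, tensorCoact_inclT, whiskerRight_tmul, counit_disk_tElt,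
      leftUnitor_inv_apply]

theorem concat_inclT (n m : ℕ) : (inclT V n ⊗ₘ inclT V m) ≫ concat V =
    tensorPowMul V n m ≫ inclT V (n + m) := by
  rw [MonoidalCategory.tensorHom_def, Category.assoc, concat, inclT_iter]
  induction m with
  | zero => exact (rightUnitor_naturality_assoc _ _).trans (congrArg _ (Category.comp_id _))
  | succ m ih =>
    change inclT V n ▷ (tensorPow V m ⊗ V) ≫ (α_ _ _ _).inv ≫ iterPow _ _ m ▷ V ≫ append V =
      ((α_ _ _ _).inv ≫ tensorPowMul V n m ▷ V) ≫ inclSucc V (n + m)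
    rw [associator_inv_naturality_left_assoc, ← comp_whiskerRight_assoc, ih, comp_whiskerRight,
      ← inclT_append_eq]
    simp only [Category.assoc]

theorem concat_inclT_apply (n m : ℕ) (a : tensorPow V n) (b : tensorPow V m) :
    concat V (tmul (inclT V n a) (inclT V m b)) = inclT V (n + m) (tensorPowMul V n m (tmul a b)) := by
  have := congr($(concat_inclT n m) (tmul a b))
  rwa [comp_apply, comp_apply, tensorHom_tmul] at this

variable {c : V ⊗ V ⟶ V ⊗ V} (hc : IsContr c)

theorem tensorBraid_inclT (n m : ℕ) : (inclT V n ⊗ₘ inclT V m) ≫ tensorBraid hc =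
    braidPow c n m ≫ (inclT V m ⊗ₘ inclT V n) := by
  rw [MonoidalCategory.tensorHom_def, Category.assoc, tensorBraid, inclT_iter]
  induction m with
  | zero =>
    refine (rightUnitor_naturality_assoc _ _).trans ?_
    change _ = ((ρ_ _).hom ≫ (λ_ _).inv) ≫ (emptyWord V ⊗ₘ inclT V n)
    rw [Category.assoc, MonoidalCategory.tensorHom_def', leftUnitor_inv_naturality_assoc]
  | succ m ih =>
    change inclT V n ▷ (tensorPow V m ⊗ V) ≫ (α_ _ _ _).inv ≫ iterPow _ _ m ▷ V ≫ _ =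
      ((α_ _ _ _).inv ≫ braidPow c n m ▷ V ≫ (α_ _ _ _).hom ≫ tensorPow V m ◁ braidPow₁ c n ≫
        (α_ _ _ _).inv) ≫ (inclSucc V m ⊗ₘ inclT V n)
    rw [associator_inv_naturality_left_assoc, ← comp_whiskerRight_assoc, ih, ← inclT_append_eq]
    simp only [comp_whiskerRight, Category.assoc]
    congr 2
    calc _ = 𝟙 _ ⊗≫ inclT V m ▷ (tensorPow V n ⊗ V) ⊗≫
          tensorAlg V ◁ (inclT V n ▷ V ≫ braidLetter hc) ⊗≫ append V ▷ tensorAlg V := by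
            rw [MonoidalCategory.tensorHom_def]; monoidal
      _ = _ := by
        rw [inclT_braidLetter]
        calc _ = 𝟙 _ ⊗≫ (inclT V m ▷ (tensorPow V n ⊗ V) ≫ tensorAlg V ◁ braidPow₁ c n) ⊗≫
              ((tensorAlg V ⊗ V : BanNA k) ◁ inclT V n ≫ append V ▷ tensorAlg V) := by monoidal
          _ = _ := by
            rw [← whisker_exchange (inclT V m), whisker_exchange (append V),
              MonoidalCategory.tensorHom_def]
            monoidal

theorem tensorBraid_inclT_apply (n m : ℕ) (a : tensorPow V n) (b : tensorPow V m) :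
    tensorBraid hc (tmul (inclT V n a) (inclT V m b)) =
      (inclT V m ⊗ₘ inclT V n) (braidPow c n m (tmul a b)) := by
  have := congr($(tensorBraid_inclT hc n m) (tmul a b))
  rwa [comp_apply, comp_apply, tensorHom_tmul] at this

theorem append_inclT_apply (n : ℕ) (a : tensorPow V n) (v : V) :
    append V (tmul (inclT V n a) v) = inclT V (n + 1) (snoc (tmul a v)) := by
  have := congr($(inclT_append_eq n) (tmul a v))
  rwa [comp_apply, whiskerRight_tmul] at this

theorem braidLetter_inclT_apply (n : ℕ) (a : tensorPow V n) (v : V) :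
    braidLetter hc (tmul (inclT V n a) v) = (V ◁ inclT V n) (braidPow₁ c n (tmul a v)) := by
  have := congr($(inclT_braidLetter hc n) (tmul a v))
  rwa [comp_apply, whiskerRight_tmul] at this

/-- The total degree coaction. -/
def totalCoact (ρ : X ⟶ disk k ⊗ X) : X ⊗ X ⟶ disk k ⊗ (X ⊗ X) :=
  coaction₂ ρ ≫ μ[disk k] ▷ (X ⊗ X)

theorem totalCoact_inclT (n m : ℕ) (a : tensorPow V n) (b : tensorPow V m) :
    totalCoact (tensorCoact V) (tmul (inclT V n a) (inclT V m b)) =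
      tmul (tElt k (n + m)) (tmul (inclT V n a) (inclT V m b)) := by
  rw [totalCoact, comp_apply, coaction₂_inclT, whiskerRight_tmul, mul_disk_tElt]

/-- The action of a letter raises the total degree by one, that is, multiplies the coaction by t.
Both summands of the action append one letter to one of the two factors. -/
theorem comulStep_totalCoact : comulStep hc ≫ totalCoact (tensorCoact V) =
    totalCoact (tensorCoact V) ▷ V ≫ (α_ _ _ _).hom ≫ (diskMulRight (tElt k 1) ⊗ₘ comulStep hc) :=
  inclT_tensor_ext₂ fun n m a b v => by
    have hd : diskMulRight (tElt k 1) (tElt k (n + m)) = tElt k (n + m + 1) :=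
      (diskDesc_tElt _ _ _ _ _).trans (diskDesc_tElt _ _ _ _ _)
    have h1 : totalCoact (tensorCoact V) (tmul (inclT V n a) (append V (tmul (inclT V m b) v))) =
        tmul (tElt k (n + m + 1)) (tmul (inclT V n a) (append V (tmul (inclT V m b) v))) := by
      rw [append_inclT_apply, totalCoact_inclT]; rfl
    have h2 : ∀ y : (V ⊗ tensorPow V m : BanNA k), totalCoact (tensorCoact V)
        ((append V ▷ tensorAlg V) ((α_ (tensorAlg V) V (tensorAlg V)).inv (tmul (inclT V n a) ((V ◁ inclT V m) y)))) =
        tmul (tElt k (n + m + 1)) ((append V ▷ tensorAlg V) ((α_ (tensorAlg V) V (tensorAlg V)).inv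
          (tmul (inclT V n a) ((V ◁ inclT V m) y)))) := by
      intro y
      have : V ◁ inclT V m ≫ tmulL _ (inclT V n a) ≫ (α_ _ _ _).inv ≫ append V ▷ tensorAlg V ≫
          totalCoact (tensorCoact V) = V ◁ inclT V m ≫ tmulL _ (inclT V n a) ≫
          (α_ _ _ _).inv ≫ append V ▷ tensorAlg V ≫ tmulL _ (tElt k (n + m + 1)) := by
        refine tensor_ext fun v b => ?_
        simp only [comp_apply, whiskerLeft_tmul, tmulL_apply, associator_inv_tmul,
          whiskerRight_tmul, append_inclT_apply, totalCoact_inclT]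
        rw [Nat.add_right_comm]
      exact congr($this y)
    simp only [comp_apply, whiskerRight_tmul, totalCoact_inclT, associator_hom_tmul,
      tensorHom_tmul, hd, comulStep, add_apply, whiskerLeft_tmul, map_add', tmul_add,
      h1, braidLetter_inclT_apply, h2]

/-- Δ preserves the total degree: each appended letter contributes one factor t on both sides. -/
theorem tensorComul_inclT_totalCoact (n : ℕ) :
    inclT V n ≫ tensorComul hc ≫ totalCoact (tensorCoact V) =
      inclT V n ≫ tensorComul hc ≫ tmulL _ (tElt k n) := by
  induction n with
  | zero =>
    have h : inclT V 0 ≫ tensorComul hc = (λ_ _).inv ≫ (inclT V 0 ⊗ₘ inclT V 0) :=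
      one_tensorComul hc
    refine hom_ext fun a => ?_
    rw [← Category.assoc, ← Category.assoc, h]
    simp only [comp_apply]
    erw [leftUnitor_inv_apply, tensorHom_tmul]
    exact totalCoact_inclT 0 0 _ _
  | succ n ih =>
    have h : inclT V n ▷ V ≫ append V ≫ tensorComul hc ≫ totalCoact (tensorCoact V) =
        inclT V n ▷ V ≫ append V ≫ tensorComul hc ≫ tmulL _ (tElt k (n + 1)) := by
      rw [← Category.assoc (append V), ← Category.assoc (append V), append_tensorComul,
        Category.assoc, comulStep_totalCoact, ← comp_whiskerRight_assoc, ← comp_whiskerRight_assoc,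
        Category.assoc, ih]
      refine tensor_ext fun a v => ?_
      simp only [comp_apply, whiskerRight_tmul, tmulL_apply, associator_hom_tmul, tensorHom_tmul]
      congr 1
      exact (diskDesc_tElt _ _ _ _ _).trans (diskDesc_tElt _ _ _ _ _)
    refine inclT_succ_congr ?_
    rw [← inclT_append_eq, Category.assoc, Category.assoc, h]

theorem tensorAntipode_inclT (n : ℕ) (a : tensorPow V n) :
    ∃ b : tensorPow V n, tensorAntipode hc (inclT V n a) = inclT V n b := by
  suffices h : ∃ f : tensorPow V n ⟶ tensorPow V n, inclT V n ≫ tensorAntipode hc = f ≫ inclT V n by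
    obtain ⟨f, hf⟩ := h
    exact ⟨f a, congr($hf a)⟩
  clear a
  induction n with
  | zero => exact ⟨𝟙 _, (one_tensorAntipode hc).trans (Category.id_comp _).symm⟩
  | succ n ih =>
    obtain ⟨f, hf⟩ := ih
    have h : inclT V n ▷ V ≫ append V ≫ tensorAntipode hc =
        (-(f ▷ V ≫ braidPow₁ c n ≫ oneLetter V ▷ _ ≫ tensorPowMul V 1 n)) ≫ inclT V (1 + n) := by
      rw [append_tensorAntipode, Preadditive.comp_neg, Preadditive.comp_neg, Preadditive.neg_comp,
        ← comp_whiskerRight_assoc, hf, comp_whiskerRight, letter_eq_oneLetter]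
      congr 1
      simp only [Category.assoc]
      rw [← concat_inclT, ← Category.assoc (inclT V n ▷ V), inclT_braidLetter,
        MonoidalCategory.tensorHom_def']
      simp only [Category.assoc, comp_whiskerRight, whisker_exchange_assoc]
    rw [← Category.assoc, inclT_append_eq] at h
    -- The recursion puts the letter in front and yields words of length 1 + n. Quantifying over m
    -- with m = n + 1 changes the index without casts between tensor powers.
    have key : ∀ m, m = n + 1 → ∀ g : tensorPow V (n + 1) ⟶ tensorPow V m,
        ∃ g' : tensorPow V (n + 1) ⟶ tensorPow V (n + 1),
          g ≫ inclT V m = g' ≫ inclT V (n + 1) := by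
      rintro m rfl g
      exact ⟨g, rfl⟩
    obtain ⟨g', hg'⟩ := key (1 + n) (add_comm 1 n)
      (-(f ▷ V ≫ braidPow₁ c n ≫ oneLetter V ▷ _ ≫ tensorPowMul V 1 n))
    exact ⟨g', h.trans hg'⟩

/-- The algebra structure of the tensor algebra. -/
@[reducible]
def tensorMon (hb : IsPreBraiding c) : MonObj (tensorAlg V) where
  one := emptyWord V
  mul := concat V
  one_mul := (tensorData hc hb).one_mul_std
  mul_one := (tensorData hc hb).mul_one_std
  mul_assoc := (tensorData hc hb).mul_assoc_std

/-- The coalgebra structure of the tensor algebra. -/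
@[reducible]
def tensorComon (hb : IsPreBraiding c) : ComonObj (tensorAlg V) where
  counit := tensorCounit V
  comul := tensorComul hc
  counit_comul := (tensorData hc hb).counit_comul_std
  comul_counit := (tensorData hc hb).comul_counit_std
  comul_assoc := (tensorData hc hb).comul_assoc_std

theorem tensorCounit_inclT_succ (n : ℕ) (a : tensorPow V (n + 1)) :
    tensorCounit V (inclT V (n + 1) a) = 0 := by
  have h : inclSucc V n ≫ tensorCounit V = 0 := by
    rw [← inclT_append_eq, Category.assoc, append_tensorCounit, Limits.comp_zero]
  exact congr($h a)

/-- The analytically graded pre-braided Hopf algebra structure of the tensor algebra. -/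
def tensorHopf (hb : IsPreBraiding c) : GradedHopf (tensorAlg V) where
  mon := tensorMon hc hb
  comon := tensorComon hc hb
  braid := tensorBraid hc
  coact := tensorCoact V
  antipode := tensorAntipode hc
  bialgebra :=
    letI := tensorMon hc hb
    letI := tensorComon hc hb
    let D := tensorData hc hb
    { preBraiding := D.preBraiding_std
      one_left := D.one_left_std
      one_right := D.one_right_std
      mul_left := D.mul_left_std
      mul_right := D.mul_right_std
      counit_left := D.counit_left_std
      counit_right := D.counit_right_std
      comul_left := D.comul_left_std
      comul_right := D.comul_right_std
      mul_comul := D.mul_comul_std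
      one_comul := D.one_comul_std
      one_counit := D.one_counit_std
      mul_counit := D.mul_counit_std }
  antipode_left := (tensorData hc hb).antipode_left_std
  antipode_right := (tensorData hc hb).antipode_right_std
  isCoaction := isCoaction_tensorCoact
  one_graded := hom_ext fun a => by
    change tensorCoact V (inclT V 0 a) = (η[disk k] ⊗ₘ emptyWord V) (tmul (sOne k) a)
    refine (tensorCoact_inclT 0 a).trans ?_
    rw [tensorHom_tmul, one_disk_apply]
    congr 1
    exact (one_smul k _).symm
  mul_graded := inclT_tensor_ext fun n m a b => by
    change tensorCoact V (concat V _) = (μ[disk k] ⊗ₘ concat V) (coaction₂ (tensorCoact V) _)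
    rw [coaction₂_inclT, tensorHom_tmul, mul_disk_tElt, concat_inclT_apply, tensorCoact_inclT]
  counit_graded := inclT_ext fun n => hom_ext fun a => by
    change (disk k ◁ tensorCounit V) (tensorCoact V (inclT V n a)) = (η[disk k] ▷ 𝟙_ (BanNA k))
      (tmul (sOne k) (tensorCounit V (inclT V n a)))
    rw [tensorCoact_inclT, whiskerLeft_tmul, whiskerRight_tmul, one_disk_apply]
    rw [show toScalar (sOne k) = 1 from rfl, one_smul]
    cases n with
    | zero => rfl
    | succ n => rw [tensorCounit_inclT_succ, tmul_zero, tmul_zero]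
  comul_graded := inclT_ext fun n => hom_ext fun a => by
    change (disk k ◁ tensorComul hc) (tensorCoact V (inclT V n a)) =
      totalCoact (tensorCoact V) (tensorComul hc (inclT V n a))
    rw [tensorCoact_inclT, whiskerLeft_tmul]
    exact congr($(tensorComul_inclT_totalCoact hc n) a).symm
  braid_graded := inclT_tensor_ext fun n m a b => by
    have : (inclT V m ⊗ₘ inclT V n) ≫ coaction₂ (tensorCoact V) =
        (inclT V m ⊗ₘ inclT V n) ≫ tmulL _ (tmul (tElt k m) (tElt k n)) :=
      tensor_ext fun b a => by
        simp only [comp_apply, tensorHom_tmul, coaction₂_inclT, tmulL_apply]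
    change coaction₂ (tensorCoact V) (tensorBraid hc _) =
      ((β_ (disk k) (disk k)).hom ⊗ₘ tensorBraid hc) (coaction₂ (tensorCoact V) _)
    rw [coaction₂_inclT, tensorHom_tmul, braiding_hom_tmul, tensorBraid_inclT_apply]
    exact congr($this _)
  antipode_graded := inclT_ext fun n => hom_ext fun a => by
    obtain ⟨b, hb⟩ := tensorAntipode_inclT hc n a
    change tensorCoact V (tensorAntipode hc (inclT V n a)) =
      (disk k ◁ tensorAntipode hc) (tensorCoact V (inclT V n a))
    rw [tensorCoact_inclT, whiskerLeft_tmul, hb, tensorCoact_inclT]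

theorem tensorComul_letter (v : V) : tensorComul hc (letter V v) =
    tmul (emptyWord V (sOne k)) (letter V v) + tmul (letter V v) (emptyWord V (sOne k)) := by
  have h : letter V ≫ tensorComul hc = (λ_ V).inv ≫ emptyWord V ▷ _ ≫ tensorAlg V ◁ letter V +
      (ρ_ V).inv ≫ letter V ▷ _ ≫ tensorAlg V ◁ emptyWord V := by
    rw [letter, Category.assoc, Category.assoc, append_tensorComul, ← comp_whiskerRight_assoc,
      one_tensorComul, comulStep]
    simp only [Preadditive.comp_add]
    congr 1
    · rw [MonoidalCategory.tensorHom_def]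
      monoidal
    · calc _ = 𝟙 _ ⊗≫ emptyWord V ▷ V ⊗≫ tensorAlg V ◁ (emptyWord V ▷ V ≫ braidLetter hc) ⊗≫
            append V ▷ tensorAlg V := by rw [MonoidalCategory.tensorHom_def]; monoidal
        _ = _ := by
          rw [one_braidLetter]
          calc _ = 𝟙 _ ⊗≫ emptyWord V ▷ V ⊗≫
                ((tensorAlg V ⊗ V : BanNA k) ◁ emptyWord V ≫ append V ▷ tensorAlg V) := by monoidal
            _ = _ := by rw [whisker_exchange]; monoidal
  have := congr($h v)
  simpa using this

theorem isTensorHopf_tensorHopf (hb : IsPreBraiding c) : IsTensorHopf c (tensorHopf hc hb) where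
  one := rfl
  mul n m := concat_inclT n m
  comul v := by
    rw [← letter_eq]
    exact tensorComul_letter hc v
  braid n m := tensorBraid_inclT hc n m
  coact n := hom_ext fun a => by
    change tensorCoact V (inclT V n a) = (tPow k n ⊗ₘ inclT V n) (tmul (sOne k) a)
    rw [tensorCoact_inclT, tensorHom_tmul]
    rfl

end Grading

end BanNA

end

noncomputable section

namespace BanNA

variable {k : Type u} [NormedField k] [IsUltrametricDist k] [CompleteSpace k]

/-! ### Components of elements of a tensor product with a contracting coproduct -/

section Projections

variable {E : ℕ → BanNA k} {W : BanNA k}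

variable (E W) in
/-- The map `(∐ Eₙ) ⊗ W ⟶ ∐ (Eₙ ⊗ W)`. -/
def tensorToCoprod : contrCoprod E ⊗ W ⟶ contrCoprod fun n => E n ⊗ W :=
  tensorDesc (fun n => incl (fun n => E n ⊗ W) n) fun n => isContr_incl n

variable (E W) in
/-- The map `∐ (Eₙ ⊗ W) ⟶ (∐ Eₙ) ⊗ W`. -/
def coprodToTensor : (contrCoprod fun n => E n ⊗ W) ⟶ contrCoprod E ⊗ W :=
  desc (fun n => incl E n ▷ W) 1 zero_le_one fun n a =>
    ((isContr_incl n).whiskerRight W a).trans_eq (one_mul _).symm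

theorem incl_coprodToTensor (n : ℕ) :
    incl (fun n => E n ⊗ W) n ≫ coprodToTensor E W = incl E n ▷ W :=
  hom_ext fun a => desc_incl (E := fun n => E n ⊗ W) (fun n => incl E n ▷ W) 1 zero_le_one
    (fun n a => ((isContr_incl n).whiskerRight W a).trans_eq (one_mul _).symm) n a

theorem incl_tensorToCoprod (n : ℕ) :
    incl E n ▷ W ≫ tensorToCoprod E W = incl (fun n => E n ⊗ W) n := incl_tensorDesc _ _ n

/-- Only this composite is needed: it makes the comparison map to ∐ (Eₙ ⊗ W) injective, so that
elements are determined by components. -/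
theorem tensorToCoprod_coprodToTensor : tensorToCoprod E W ≫ coprodToTensor E W = 𝟙 _ :=
  incl_whiskerRight_ext fun n => by
    rw [← Category.assoc, incl_tensorToCoprod, incl_coprodToTensor, Category.comp_id]

theorem tensorToCoprod_proj (p : ℕ) :
    tensorToCoprod E W ≫ proj (fun n => E n ⊗ W) p = proj E p ▷ W :=
  incl_whiskerRight_ext fun n => by
    rw [← Category.assoc, incl_tensorToCoprod, ← comp_whiskerRight]
    by_cases h : p = n
    · subst h
      rw [incl_proj_self, incl_proj_self, id_whiskerRight]
    · refine (incl_proj_ne h).trans ?_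
      rw [incl_proj_ne h, MonoidalPreadditive.zero_whiskerRight]

/-- The components of an element of `(∐ Eₙ) ⊗ W` determine it. -/
theorem proj_whiskerRight_ext {x y : (contrCoprod E ⊗ W : BanNA k)}
    (h : ∀ p, (proj E p ▷ W) x = (proj E p ▷ W) y) : x = y := by
  have key : tensorToCoprod E W x = tensorToCoprod E W y := coord_ext fun p =>
    congr($(tensorToCoprod_proj (E := E) (W := W) p) x).trans
      ((h p).trans congr($(tensorToCoprod_proj (E := E) (W := W) p) y).symm)
  have := congrArg (coprodToTensor E W) key
  rwa [← comp_apply, ← comp_apply, tensorToCoprod_coprodToTensor] at this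

variable (k) in
/-- The coefficient of `tⁿ`. -/
def diskProj (n : ℕ) : disk k ⟶ 𝟙_ (BanNA k) := proj (fun _ : ℕ => 𝟙_ (BanNA k)) n

theorem diskProj_tElt_self (n : ℕ) : diskProj k n (tElt k n) = sOne k := coord_incl_self n _

theorem diskProj_tElt_ne {n m : ℕ} (h : m ≠ n) : diskProj k m (tElt k n) = 0 := coord_incl_ne _ h

theorem tmul_tElt_coeff (n m : ℕ) (x : W) :
    (diskProj k m ▷ W ≫ (λ_ W).hom) (tmul (tElt k n) x) = if n = m then x else 0 := by
  rw [comp_apply, whiskerRight_tmul]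
  split_ifs with h
  · subst h
    rw [diskProj_tElt_self, leftUnitor_hom_tmul]
    exact one_smul k x
  · rw [diskProj_tElt_ne (Ne.symm h), zero_tmul, map_zero']

/-- Compare the coefficients of tⁿ. This is how equations between coactions become statements about
degrees. -/
theorem eq_zero_of_tmul_tElt {n m : ℕ} (hnm : n ≠ m) {x y : W}
    (h : tmul (tElt k n) x = tmul (tElt k m) y) : x = 0 := by
  have := congrArg (diskProj k n ▷ W ≫ (λ_ W).hom) h
  rwa [tmul_tElt_coeff, tmul_tElt_coeff, if_pos rfl, if_neg hnm.symm] at this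

end Projections

/-! ### The quantum symmetrizer of T(V) -/

section Symmetrizer

variable {V X : BanNA k}

/-- The projection of `T(V)` to `V^{⊗n}`. -/
def projT (V : BanNA k) (n : ℕ) : tensorAlg V ⟶ tensorPow V n := proj (tensorPow V) n

theorem inclT_projT_self (n : ℕ) : inclT V n ≫ projT V n = 𝟙 _ := incl_proj_self n

theorem inclT_projT_ne {n m : ℕ} (h : m ≠ n) : inclT V n ≫ projT V m = 0 := incl_proj_ne h

/-- The projection of `T(V)` to the part of degree `n`. -/
def degProj (V : BanNA k) (n : ℕ) : tensorAlg V ⟶ tensorAlg V := projT V n ≫ inclT V n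

theorem isContr_degProj (n : ℕ) : IsContr (degProj V n) := (isContr_proj n).comp (isContr_inclT n)

theorem inclT_degProj_self (n : ℕ) : inclT V n ≫ degProj V n = inclT V n := by
  rw [degProj, ← Category.assoc, inclT_projT_self, Category.id_comp]

theorem inclT_degProj_ne {n m : ℕ} (h : m ≠ n) : inclT V n ≫ degProj V m = 0 := by
  rw [degProj, ← Category.assoc, inclT_projT_ne h, Limits.zero_comp]

theorem degProj_inclT_self (n : ℕ) (a : tensorPow V n) :
    degProj V n (inclT V n a) = inclT V n a := congr($(inclT_degProj_self n) a)

theorem degProj_inclT_ne {n m : ℕ} (h : m ≠ n) (a : tensorPow V n) :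
    degProj V m (inclT V n a) = 0 := congr($(inclT_degProj_ne h) a)

theorem degProj_comp_self (n : ℕ) : degProj V n ≫ degProj V n = degProj V n := by
  conv_lhs => rw [degProj, Category.assoc, ← degProj, inclT_degProj_self]
  rfl

theorem degProj_comp_ne {n m : ℕ} (h : m ≠ n) : degProj V n ≫ degProj V m = 0 := by
  rw [degProj, Category.assoc, inclT_degProj_ne h, Limits.comp_zero]

theorem degProj_projT_self (n : ℕ) : degProj V n ≫ projT V n = projT V n := by
  rw [degProj, Category.assoc, inclT_projT_self, Category.comp_id]

theorem degProj_whiskerRight_ext {W : BanNA k} {x y : (tensorAlg V ⊗ W : BanNA k)}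
    (h : ∀ p, (degProj V p ▷ W) x = (degProj V p ▷ W) y) : x = y :=
  proj_whiskerRight_ext fun p => by
    have e : degProj V p ▷ W ≫ projT V p ▷ W = projT V p ▷ W := by
      rw [← comp_whiskerRight, degProj_projT_self]
    have := congrArg (projT V p ▷ W) (h p)
    exact congr($e x).symm.trans (this.trans congr($e y))

theorem degProj_ext {x y : tensorAlg V} (h : ∀ p, degProj V p x = degProj V p y) : x = y :=
  coord_ext fun p => by
    have := congrArg (projT V p) (h p)
    rwa [← comp_apply, ← comp_apply, degProj_projT_self] at this

theorem totalCoact_degProj (p q : ℕ) : totalCoact (tensorCoact V) ≫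
    disk k ◁ (degProj V p ⊗ₘ degProj V q) =
      (degProj V p ⊗ₘ degProj V q) ≫ tmulL _ (tElt k (p + q)) :=
  inclT_tensor_ext fun n m a b => by
    simp only [comp_apply, totalCoact_inclT, whiskerLeft_tmul, tensorHom_tmul, tmulL_apply]
    by_cases hp : p = n
    · subst hp
      by_cases hq : q = m
      · subst hq; rfl
      · simp only [degProj_inclT_ne hq, tmul_zero]
    · simp only [degProj_inclT_ne hp, zero_tmul, tmul_zero]

variable {c : V ⊗ V ⟶ V ⊗ V} (hc : IsContr c)

/-- On the (p, q) component the total coaction is t^{p+q}, whereas on the coproduct of a word of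
length n it is tⁿ. -/
theorem tensorComul_degProj {n p q : ℕ} (h : n ≠ p + q) (a : tensorPow V n) :
    (degProj V p ⊗ₘ degProj V q) (tensorComul hc (inclT V n a)) = 0 := by
  have h1 := congr($(totalCoact_degProj (V := V) p q) (tensorComul hc (inclT V n a)))
  have h2 := congr($(tensorComul_inclT_totalCoact hc n) a)
  simp only [comp_apply, tmulL_apply] at h1 h2
  rw [h2, whiskerLeft_tmul] at h1
  exact eq_zero_of_tmul_tElt h h1

/-- The braided derivation `(1 ⊗ π₁)Δ` of `T(V)`. -/
def tensorDeriv : tensorAlg V ⟶ tensorAlg V ⊗ tensorAlg V :=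
  tensorComul hc ≫ tensorAlg V ◁ degProj V 1

theorem isContr_tensorDeriv : IsContr (tensorDeriv hc) :=
  (isContr_tensorComul hc).comp ((isContr_degProj 1).whiskerLeft _)

/-- The right factor of d has degree one, so its left factor has one degree less than the argument.
-/
theorem degProj_tensorDeriv (n : ℕ) :
    degProj V (n + 1) ≫ tensorDeriv hc = tensorDeriv hc ≫ degProj V n ▷ tensorAlg V := by
  have h0 : ∀ {m p : ℕ}, m ≠ p + 1 → inclT V m ≫ tensorDeriv hc ≫ degProj V p ▷ tensorAlg V = 0 := by
    intro m p h
    refine hom_ext fun a => ?_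
    have := tensorComul_degProj hc h a
    rwa [MonoidalCategory.tensorHom_def'] at this
  refine inclT_ext fun m => ?_
  by_cases h : m = n + 1
  · subst h
    rw [← Category.assoc, inclT_degProj_self]
    refine hom_ext fun a => degProj_whiskerRight_ext fun p => ?_
    have : inclT V (n + 1) ≫ tensorDeriv hc ≫ degProj V p ▷ tensorAlg V =
        inclT V (n + 1) ≫ tensorDeriv hc ≫ degProj V n ▷ tensorAlg V ≫
          degProj V p ▷ tensorAlg V := by
      rw [← comp_whiskerRight]
      by_cases hp : p = n
      · subst hp; rw [degProj_comp_self]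
      · rw [degProj_comp_ne hp, h0 (by omega)]; simp
    exact congr($this a)
  · rw [h0 h, ← Category.assoc, inclT_degProj_ne (Ne.symm h), Limits.zero_comp]

theorem concat_degProj {p q m : ℕ} (h : m ≠ p + q) :
    (degProj V p ⊗ₘ degProj V q) ≫ concat V ≫ degProj V m = 0 :=
  inclT_tensor_ext fun n l a b => by
    simp only [comp_apply, tensorHom_tmul]
    by_cases hp : p = n
    · subst hp
      by_cases hq : q = l
      · subst hq
        rw [degProj_inclT_self, degProj_inclT_self, concat_inclT_apply, degProj_inclT_ne h]; rfl
      · rw [degProj_inclT_ne hq, tmul_zero, map_zero', map_zero']; rfl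
    · rw [degProj_inclT_ne hp, zero_tmul, map_zero', map_zero']; rfl

/-- The map induced by a family of contractions on the tensor powers. -/
def descT (f : ∀ n, tensorPow V n ⟶ X) (hf : ∀ n, IsContr (f n)) : tensorAlg V ⟶ X :=
  desc f 1 zero_le_one fun n a => (hf n a).trans_eq (one_mul _).symm

theorem inclT_descT (f : ∀ n, tensorPow V n ⟶ X) (hf : ∀ n, IsContr (f n)) (n : ℕ) :
    inclT V n ≫ descT f hf = f n := hom_ext fun a =>
  desc_incl f 1 zero_le_one (fun n a => (hf n a).trans_eq (one_mul _).symm) n a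

/-- The components of the map that splits off the last letter of a word. -/
def splitPow (V : BanNA k) : ∀ n, tensorPow V n ⟶ tensorAlg V ⊗ tensorAlg V
  | 0 => 0
  | n + 1 => inclT V n ⊗ₘ letter V

theorem isContr_splitPow : ∀ n, IsContr (splitPow V n)
  | 0 => .zero
  | n + 1 => tensorMap_contr (isContr_inclT n) isContr_letter

/-- The map that splits off the last letter of a word. -/
def tensorSplit (V : BanNA k) : tensorAlg V ⟶ tensorAlg V ⊗ tensorAlg V :=
  descT (splitPow V) isContr_splitPow

theorem one_tensorSplit : emptyWord V ≫ tensorSplit V = 0 := inclT_descT _ _ 0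

theorem append_tensorSplit : append V ≫ tensorSplit V = tensorAlg V ◁ letter V :=
  inclT_whiskerRight_ext fun n => by
    rw [← Category.assoc, inclT_append_eq]
    refine (inclT_descT _ _ (n + 1)).trans ?_
    exact MonoidalCategory.tensorHom_def _ _

theorem letter_concat : tensorAlg V ◁ letter V ≫ concat V = append V := by
  rw [letter]
  simp only [MonoidalCategory.whiskerLeft_comp, Category.assoc]
  rw [append_concat]
  calc _ = 𝟙 _ ⊗≫ (tensorAlg V ◁ emptyWord V ≫ concat V) ▷ V ⊗≫ append V := by monoidal
    _ = _ := by rw [one_concat]; monoidal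

/-- The components of the quantum symmetrizer. -/
def symPow : ℕ → (tensorAlg V ⟶ tensorAlg V)
  | 0 => tensorCounit V ≫ emptyWord V
  | n + 1 => tensorDeriv hc ≫ symPow n ▷ tensorAlg V ≫ concat V

theorem isContr_symPow : ∀ n, IsContr (symPow hc n)
  | 0 => isContr_tensorCounit.comp isContr_emptyWord
  | n + 1 => (isContr_tensorDeriv hc).comp
      (((isContr_symPow n).whiskerRight _).comp isContr_concat)

/-- The quantum symmetrizer. -/
def symmetrizer : tensorAlg V ⟶ tensorAlg V :=
  descT (fun n => inclT V n ≫ symPow hc n) fun n => (isContr_inclT n).comp (isContr_symPow hc n)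

/-- The recursion for 𝔖 refers to 𝔖 itself, so it is unrolled n times on degree n. The unrolled maps
are contractions, which is what allows them to be glued. -/
theorem degProj_symmetrizer (n : ℕ) : degProj V n ≫ symmetrizer hc = degProj V n ≫ symPow hc n := by
  rw [degProj, Category.assoc, symmetrizer, inclT_descT, Category.assoc]

theorem one_tensorDeriv : emptyWord V ≫ tensorDeriv hc = 0 := by
  have h : emptyWord V ≫ degProj V 1 = 0 := inclT_degProj_ne one_ne_zero
  rw [tensorDeriv, ← Category.assoc, one_tensorComul, Category.assoc,
    MonoidalCategory.tensorHom_def, Category.assoc, ← MonoidalCategory.whiskerLeft_comp, h]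
  simp

theorem degProj_zero : degProj V 0 = tensorCounit V ≫ emptyWord V :=
  inclT_ext fun n => by
    cases n with
    | zero =>
      rw [inclT_degProj_self]
      change emptyWord V = emptyWord V ≫ _
      rw [← Category.assoc, one_tensorCounit, Category.id_comp]
    | succ n =>
      rw [inclT_degProj_ne (Nat.succ_ne_zero n).symm]
      exact hom_ext fun a => by
        rw [comp_apply, comp_apply, tensorCounit_inclT_succ, map_zero']; rfl

theorem degProj_tensorCounit (n : ℕ) : degProj V (n + 1) ≫ tensorCounit V = 0 :=
  hom_ext fun _ => tensorCounit_inclT_succ n _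

/-- Checked degree by degree. Since d maps degree n + 1 to left degree n, the glued map on the right
is evaluated exactly where it is `symPow hc n`. -/
theorem symmetrizer_eq : symmetrizer hc = tensorCounit V ≫ emptyWord V +
    tensorDeriv hc ≫ symmetrizer hc ▷ tensorAlg V ≫ concat V :=
  inclT_ext fun n => by
    rw [← inclT_degProj_self, Category.assoc, Category.assoc, degProj_symmetrizer]
    congr 1
    cases n with
    | zero =>
      have h : degProj V 0 ≫ tensorDeriv hc = 0 := by
        rw [degProj_zero, Category.assoc, one_tensorDeriv, Limits.comp_zero]
      rw [Preadditive.comp_add, ← Category.assoc (degProj V 0) (tensorDeriv hc), h,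
        Limits.zero_comp, add_zero]
      rfl
    | succ n =>
      rw [Preadditive.comp_add, ← Category.assoc (degProj V (n + 1)) (tensorCounit V),
        degProj_tensorCounit, Limits.zero_comp, zero_add,
        ← Category.assoc (degProj V (n + 1)) (tensorDeriv hc), degProj_tensorDeriv,
        Category.assoc, ← comp_whiskerRight_assoc, degProj_symmetrizer, comp_whiskerRight_assoc,
        symPow, ← Category.assoc (degProj V (n + 1)) (tensorDeriv hc), degProj_tensorDeriv,
        Category.assoc]

theorem tensorDeriv_degProj_one :
    tensorDeriv hc ≫ tensorAlg V ◁ degProj V 1 = tensorDeriv hc := by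
  rw [tensorDeriv, Category.assoc, ← MonoidalCategory.whiskerLeft_comp, degProj_comp_self]

theorem degProj_symPow (n : ℕ) : ∀ m, m ≠ n → degProj V n ≫ symPow hc n ≫ degProj V m = 0 := by
  -- A map all of whose components except the n-th vanish equals its n-th component. The induction
  -- applies this to the part of degree n before multiplying by a letter.
  have ext : ∀ {f : tensorAlg V ⟶ tensorAlg V} {n : ℕ}, (∀ m, m ≠ n → f ≫ degProj V m = 0) →
      f = f ≫ degProj V n := by
    intro f n h
    refine hom_ext fun x => degProj_ext fun m => ?_
    have key : f ≫ degProj V m = (f ≫ degProj V n) ≫ degProj V m := by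
      rw [Category.assoc]
      by_cases hm : m = n
      · subst hm; rw [degProj_comp_self]
      · rw [degProj_comp_ne hm, h m hm, Limits.comp_zero]
    exact congr($key x)
  induction n with
  | zero =>
    intro m hm
    have h : emptyWord V ≫ degProj V m = 0 := inclT_degProj_ne hm
    rw [symPow, Category.assoc, h, Limits.comp_zero, Limits.comp_zero]
  | succ n ih =>
    intro m hm
    have h := ext (f := degProj V n ≫ symPow hc n) (n := n) (by simpa using ih)
    rw [symPow, ← Category.assoc, ← Category.assoc (degProj V (n + 1)), degProj_tensorDeriv,
      ← tensorDeriv_degProj_one]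
    simp only [Category.assoc]
    rw [← comp_whiskerRight_assoc, h, comp_whiskerRight_assoc]
    rw [whisker_exchange_assoc, ← MonoidalCategory.tensorHom_def'_assoc, concat_degProj hm]
    simp

theorem degProj_symmetrizer_comm (n : ℕ) :
    degProj V n ≫ symmetrizer hc = symmetrizer hc ≫ degProj V n :=
  inclT_ext fun m => by
    have h1 : degProj V m ≫ symmetrizer hc ≫ degProj V n =
        degProj V m ≫ symPow hc m ≫ degProj V n := by
      rw [← Category.assoc, degProj_symmetrizer, Category.assoc]
    rw [← inclT_degProj_self, Category.assoc, Category.assoc, h1]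
    by_cases h : n = m
    · subst h
      rw [← Category.assoc (degProj V n) (degProj V n), degProj_comp_self, degProj_symmetrizer]
      refine congrArg (inclT V n ≫ ·) (hom_ext fun x => degProj_ext fun m => ?_)
      have key : (degProj V n ≫ symPow hc n) ≫ degProj V m =
          (degProj V n ≫ symPow hc n ≫ degProj V n) ≫ degProj V m := by
        simp only [Category.assoc]
        by_cases hm : m = n
        · subst hm; rw [degProj_comp_self]
        · rw [degProj_comp_ne hm, degProj_symPow hc n m hm, Limits.comp_zero, Limits.comp_zero]
      exact congr($key x)
    · rw [← Category.assoc (degProj V m) (degProj V n), degProj_comp_ne h, Limits.zero_comp,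
        degProj_symPow hc m n h]

theorem oneLetter_surjective (b : tensorPow V 1) : ∃ v, b = oneLetter V v :=
  ⟨(λ_ V).hom b, congr($((λ_ V).hom_inv_id) b).symm⟩

theorem inclT_zero_apply (a : tensorPow V 0) :
    ∃ r : k, inclT V 0 a = r • emptyWord V (sOne k) :=
  ⟨toScalar a, by
    rw [← map_smul']
    exact congrArg (inclT V 0) (toScalar_smul_sOne a).symm⟩

theorem toScalar_smul_sOne_eq (r : k) : toScalar (r • sOne k) = r := mul_one r

theorem toScalar_zero : toScalar (0 : (𝟙_ (BanNA k) : BanNA k)) = 0 := rfl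

theorem concat_one_left (hc : IsContr c) (x : tensorAlg V) (hb : IsPreBraiding c) :
    concat V (tmul (emptyWord V (sOne k)) x) = x := by
  have := congr($((tensorData hc hb).one_mul_std) (tmul (sOne k) x))
  rw [comp_apply, whiskerRight_tmul, leftUnitor_hom_tmul] at this
  exact this.trans (one_smul k x)

theorem concat_one_right (x : tensorAlg V) :
    concat V (tmul x (emptyWord V (sOne k))) = x := by
  have := congr($(one_concat (V := V)) (tmul x (sOne k)))
  rw [comp_apply, whiskerLeft_tmul, rightUnitor_hom_tmul] at this
  exact this.trans (one_smul k x)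

/-- A product of degree one has one factor of degree zero, that is, a scalar picked out by the
counit. -/
theorem concat_degProj_one (hc : IsContr c) (hb : IsPreBraiding c) : concat V ≫ degProj V 1 =
    tensorAlg V ◁ tensorCounit V ≫ (ρ_ _).hom ≫ degProj V 1 +
      tensorCounit V ▷ tensorAlg V ≫ (λ_ _).hom ≫ degProj V 1 :=
  inclT_tensor_ext fun n m a b => by
    have h0 : degProj V 1 (emptyWord V (sOne k)) = 0 := degProj_inclT_ne one_ne_zero _
    have hε : tensorCounit V (emptyWord V (sOne k)) = sOne k :=
      congr($(one_tensorCounit (V := V)) (sOne k))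
    have h1 : toScalar (sOne k) = 1 := rfl
    simp only [comp_apply, add_apply, whiskerLeft_tmul, whiskerRight_tmul, rightUnitor_hom_tmul,
      leftUnitor_hom_tmul]
    cases n with
    | zero =>
      obtain ⟨r, hr⟩ := inclT_zero_apply a
      rw [hr]
      simp only [smul_tmul, map_smul', concat_one_left hc _ hb, h0, hε, smul_zero, zero_add,
        toScalar_smul_sOne_eq]
    | succ n =>
      rw [tensorCounit_inclT_succ, toScalar_zero, zero_smul, map_zero', add_zero]
      cases m with
      | zero =>
        obtain ⟨r, hr⟩ := inclT_zero_apply b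
        rw [hr]
        simp only [tmul_smul, map_smul', concat_one_right, hε, toScalar_smul_sOne_eq]
      | succ m =>
        rw [tensorCounit_inclT_succ, toScalar_zero, zero_smul, map_zero', concat_inclT_apply,
          degProj_inclT_ne (by omega)]

theorem tensorBraid_degProj (n : ℕ) :
    tensorBraid hc ≫ tensorAlg V ◁ degProj V n = degProj V n ▷ tensorAlg V ≫ tensorBraid hc :=
  inclT_tensor_ext fun p q a b => by
    simp only [comp_apply, whiskerRight_tmul, tensorBraid_inclT_apply]
    have h : (inclT V q ⊗ₘ inclT V p) ≫ tensorAlg V ◁ degProj V n =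
        if n = p then inclT V q ⊗ₘ inclT V p else 0 := by
      rw [MonoidalCategory.tensorHom_def, Category.assoc, ← MonoidalCategory.whiskerLeft_comp]
      split_ifs with hn
      · subst hn; rw [inclT_degProj_self]
      · rw [inclT_degProj_ne hn]; simp
    refine (congr($h _)).trans ?_
    split_ifs with hn
    · subst hn; rw [degProj_inclT_self, tensorBraid_inclT_apply]
    · rw [degProj_inclT_ne hn, zero_tmul, map_zero']; rfl

theorem degProj_tensorBraid (n : ℕ) :
    tensorBraid hc ≫ degProj V n ▷ tensorAlg V = tensorAlg V ◁ degProj V n ≫ tensorBraid hc :=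
  inclT_tensor_ext fun p q a b => by
    simp only [comp_apply, whiskerLeft_tmul, tensorBraid_inclT_apply]
    have h : (inclT V q ⊗ₘ inclT V p) ≫ degProj V n ▷ tensorAlg V =
        if n = q then inclT V q ⊗ₘ inclT V p else 0 := by
      rw [MonoidalCategory.tensorHom_def', Category.assoc, ← comp_whiskerRight]
      split_ifs with hn
      · subst hn; rw [inclT_degProj_self]
      · rw [inclT_degProj_ne hn]; simp
    refine (congr($h _)).trans ?_
    split_ifs with hn
    · subst hn; rw [degProj_inclT_self, tensorBraid_inclT_apply]
    · rw [degProj_inclT_ne hn, tmul_zero, map_zero']; rfl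

theorem degProj_concat_tensorSplit :
    tensorAlg V ◁ degProj V 1 ≫ concat V ≫ tensorSplit V = tensorAlg V ◁ degProj V 1 :=
  inclT_tensor_ext fun p q a b => by
    simp only [comp_apply, whiskerLeft_tmul]
    by_cases h : 1 = q
    · subst h
      obtain ⟨v, rfl⟩ := oneLetter_surjective b
      have hv : inclT V 1 (oneLetter V v) = letter V v := congr($(letter_eq_oneLetter (V := V)) v).symm
      rw [degProj_inclT_self, hv]
      have h1 := congr($(letter_concat (V := V)) (tmul (inclT V p a) v))
      have h2 := congr($(append_tensorSplit (V := V)) (tmul (inclT V p a) v))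
      rw [comp_apply, whiskerLeft_tmul] at h1
      rw [h1]
      rwa [comp_apply, whiskerLeft_tmul] at h2
    · rw [degProj_inclT_ne h, tmul_zero, map_zero', map_zero']

open Tail

/-- The quantum symmetrizer of the tensor algebra. -/
def tensorSym (hb : IsPreBraiding c) : Tail.Sym (tensorData hc hb) where
  π := degProj V
  d := tensorDeriv hc
  δ := tensorSplit V
  𝔖 := symmetrizer hc
  -- The inclusion of V^{⊗n} is fixed by the n-th projection, so agreement after all projections
  -- implies agreement on all tensor powers.
  ext {P W X} f g h := whisker_inclT_ext fun n => by
    have e : P ◁ (inclT V n ▷ W) = P ◁ (inclT V n ▷ W) ≫ P ◁ t11 (degProj V n) W := by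
      rw [t11, ← MonoidalCategory.whiskerLeft_comp, ← comp_whiskerRight, inclT_degProj_self]
    rw [e, Category.assoc, Category.assoc, h]
  d_eq W := by
    change t12 (tensorDeriv hc) W = t12 (tensorComul hc) W ≫ _
    simp only [t12, t11, tensorDeriv]; monoidal
  π_zero W := by
    change t11 _ W = t10 (tensorCounit V) W ≫ t01 (emptyWord V) W
    simp only [t11, t10, t01, degProj_zero]; monoidal
  one_π W := by
    change t01 (emptyWord V) W ≫ _ = 0
    have h : emptyWord V ≫ degProj V 1 = 0 := inclT_degProj_ne one_ne_zero
    rw [t01, t11, Category.assoc, ← comp_whiskerRight, h]; simp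
  π_ε n W := by
    change _ ≫ t10 (tensorCounit V) W = 0
    rw [t10, t11, ← Category.assoc, ← comp_whiskerRight, degProj_tensorCounit]; simp
  mul_π W := by
    change t21 (concat V) W ≫ _ = _ ◁ t10 (tensorCounit V) W ≫ _ + t10 (tensorCounit V) _ ≫ _
    have := congr((α_ _ _ _).inv ≫ $(concat_degProj_one hc hb) ▷ W)
    rw [MonoidalPreadditive.add_whiskerRight, Preadditive.comp_add] at this
    refine Eq.trans ?_ (this.trans (congrArg₂ _ ?_ ?_))
    · simp only [t21, t11]; monoidal
    · simp only [t10, t11]; monoidal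
    · simp only [t10, t11]; monoidal
  π_d n W := by
    have := congr($(degProj_tensorDeriv hc n) ▷ W ≫ (α_ _ _ _).hom)
    refine Eq.trans ?_ (this.trans ?_) <;> · simp only [t11, t12]; monoidal
  β_π n W := by
    change t22 (tensorBraid hc) W ≫ _ = _ ≫ t22 (tensorBraid hc) W
    have := congr((α_ _ _ _).inv ≫ $(tensorBraid_degProj hc n) ▷ W ≫ (α_ _ _ _).hom)
    refine Eq.trans ?_ (this.trans ?_) <;> · simp only [t11, t22]; monoidal
  π_β n W := by
    change t22 (tensorBraid hc) W ≫ _ = _ ≫ t22 (tensorBraid hc) W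
    have := congr((α_ _ _ _).inv ≫ $(degProj_tensorBraid hc n) ▷ W ≫ (α_ _ _ _).hom)
    refine Eq.trans ?_ (this.trans ?_) <;> · simp only [t11, t22]; monoidal
  one_δ W := by
    change t01 (emptyWord V) W ≫ _ = 0
    rw [t01, t12, Category.assoc, ← comp_whiskerRight_assoc, one_tensorSplit]; simp
  mul_δ W := by
    change _ ≫ t21 (concat V) W ≫ _ = _
    have := congr((α_ _ _ _).inv ≫ $(degProj_concat_tensorSplit (V := V)) ▷ W ≫ (α_ _ _ _).hom)
    refine Eq.trans ?_ (this.trans ?_) <;> · simp only [t11, t12, t21]; monoidal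
  𝔖_eq W := by
    change _ = t10 (tensorCounit V) W ≫ t01 (emptyWord V) W + _ ≫ _ ≫ t21 (concat V) W
    have := congr($(symmetrizer_eq hc) ▷ W)
    rw [MonoidalPreadditive.add_whiskerRight] at this
    refine this.trans (congrArg₂ _ ?_ ?_)
    · simp only [t10, t01]; monoidal
    · simp only [t11, t12, t21]; monoidal

end Symmetrizer

end BanNA

end

noncomputable section

namespace BanNA

/-! ### Nearly orthogonal sequences -/

section Orthogonal

variable {k : Type u} [NormedField k] [IsUltrametricDist k] [CompleteSpace k]
  {X : Type u} [NormedAddCommGroup X] [NormedSpace k X] [IsUltrametricDist X] [CompleteSpace X]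

/-- Riesz's lemma: subtract from `s` an almost best approximation in S. The factor r > 1 is needed
because the distance need not be attained. -/
theorem exists_nearly_orthogonal (S : Submodule k X) (hS : IsClosed (S : Set X)) (s : X) {r : ℝ}
    (hr : 1 < r) : ∃ e, e - s ∈ S ∧ ∀ g ∈ S, ‖e‖ ≤ r * ‖e + g‖ := by
  by_cases hs : s ∈ S
  · exact ⟨0, by simpa using hs, fun g _ => by
      rw [norm_zero]; exact mul_nonneg (zero_le_one.trans hr.le) (norm_nonneg _)⟩
  have hd : 0 < Metric.infDist s S := (hS.notMem_iff_infDist_pos ⟨0, S.zero_mem⟩).1 hs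
  obtain ⟨g₀, hg₀, h⟩ := (Metric.infDist_lt_iff (s := (S : Set X)) (x := s) ⟨0, S.zero_mem⟩).1
    (lt_mul_of_one_lt_left hd hr)
  refine ⟨s - g₀, by simpa using S.neg_mem hg₀, fun g hg => ?_⟩
  have h1 := Metric.infDist_le_dist_of_mem (x := s) (S.sub_mem hg₀ hg)
  rw [dist_eq_norm] at h h1
  rw [sub_add]
  exact h.le.trans (mul_le_mul_of_nonneg_left h1 (zero_le_one.trans hr.le))

theorem norm_smul_le_of_nearly_orthogonal {S : Submodule k X} {e : X} {r : ℝ} (hr : 0 ≤ r)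
    (he : ∀ g ∈ S, ‖e‖ ≤ r * ‖e + g‖) (c : k) {g : X} (hg : g ∈ S) :
    ‖c • e‖ ≤ r * ‖c • e + g‖ := by
  by_cases hc : c = 0
  · rw [hc, zero_smul, norm_zero]; exact mul_nonneg hr (norm_nonneg _)
  have := mul_le_mul_of_nonneg_left (he _ (S.smul_mem c⁻¹ hg)) (norm_nonneg c)
  rw [norm_smul]
  refine this.trans_eq ?_
  rw [mul_left_comm, ← norm_smul, smul_add, smul_inv_smul₀ hc]

theorem norm_le_of_nearly_orthogonal {S : Submodule k X} {e : X} {r : ℝ} (hr : 1 ≤ r)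
    (he : ∀ g ∈ S, ‖e‖ ≤ r * ‖e + g‖) (c : k) {g : X} (hg : g ∈ S) :
    ‖g‖ ≤ r * ‖c • e + g‖ := by
  have h1 := norm_smul_le_of_nearly_orthogonal (zero_le_one.trans hr) he c hg
  calc ‖g‖ = ‖(c • e + g) + -(c • e)‖ := by congr 1; abel
    _ ≤ max ‖c • e + g‖ ‖-(c • e)‖ := IsUltrametricDist.norm_add_le_max _ _
    _ ≤ r * ‖c • e + g‖ := max_le (le_mul_of_one_le_left (norm_nonneg _) hr) (by rwa [norm_neg])

theorem sup_span_eq {S : Submodule k X} {e s : X} (h : e - s ∈ S) :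
    S ⊔ Submodule.span k {e} = S ⊔ Submodule.span k {s} := by
  apply le_antisymm <;> refine sup_le le_sup_left ?_ <;>
    rw [Submodule.span_singleton_le_iff_mem]
  · rw [← sub_add_cancel e s]
    exact add_mem (Submodule.mem_sup_left h)
      (Submodule.mem_sup_right (Submodule.mem_span_singleton_self s))
  · rw [← sub_sub_cancel e s]
    exact sub_mem (Submodule.mem_sup_right (Submodule.mem_span_singleton_self e))
      (Submodule.mem_sup_left h)

/-- After replacing `s` by a nearly orthogonal vector, the map S × k → X, (g, c) ↦ g + ce, is
bounded below, so its range is complete. This covers a trivially valued field as well. -/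
theorem isClosed_sup_span (S : Submodule k X) (hS : IsClosed (S : Set X)) (s : X) :
    IsClosed ((S ⊔ Submodule.span k {s} : Submodule k X) : Set X) := by
  obtain ⟨e, hes, he⟩ := exists_nearly_orthogonal S hS s one_lt_two
  rw [← sup_span_eq hes]
  by_cases h0 : e = 0
  · simpa [h0] using hS
  have h0' := norm_pos_iff.2 h0
  have : CompleteSpace S := hS.completeSpace_coe
  let F : S × k →ₗ[k] X := LinearMap.coprod S.subtype (LinearMap.toSpanSingleton k X e)
  have hF : ∀ p, F p = p.2 • e + (p.1 : X) := fun p => add_comm _ _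
  have hK : ∀ p, ‖p‖ ≤ (max 2 (2 / ‖e‖)) * ‖F p‖ := by
    intro p
    rw [hF, Prod.norm_def]
    refine max_le ?_ ?_
    · exact (norm_le_of_nearly_orthogonal one_le_two he p.2 p.1.2).trans
        (mul_le_mul_of_nonneg_right (le_max_left _ _) (norm_nonneg _))
    · have h1 := norm_smul_le_of_nearly_orthogonal zero_le_two he p.2 p.1.2
      rw [norm_smul] at h1
      refine le_trans ?_ (mul_le_mul_of_nonneg_right (le_max_right _ _) (norm_nonneg _))
      rw [div_mul_eq_mul_div, le_div_iff₀ h0']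
      exact h1
  have hanti : AntilipschitzWith (⟨max 2 (2 / ‖e‖), by positivity⟩) F :=
    AddMonoidHomClass.antilipschitz_of_bound F hK
  have hcont : UniformContinuous F := by
    refine AddMonoidHomClass.uniformContinuous_of_bound F (1 + ‖e‖) fun p => ?_
    rw [hF, add_comm]
    refine (norm_add_le _ _).trans ?_
    rw [add_mul, one_mul, norm_smul, mul_comm ‖p.2‖]
    exact add_le_add (norm_fst_le p) (mul_le_mul_of_nonneg_left (norm_snd_le p) (norm_nonneg e))
  have := hanti.isClosed_range hcont
  convert this using 1
  have hr : S ⊔ Submodule.span k {e} = LinearMap.range F := by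
    rw [LinearMap.range_coprod, Submodule.range_subtype, LinearMap.range_toSpanSingleton]
  rw [hr]; rfl

/-- The span of the first `n` members of a sequence. -/
def spanLT (k : Type u) [NormedField k] {X : Type u} [NormedAddCommGroup X] [NormedSpace k X]
    (s : ℕ → X) (n : ℕ) : Submodule k X := Submodule.span k (s '' Set.Iio n)

theorem spanLT_succ (s : ℕ → X) (n : ℕ) :
    spanLT k s (n + 1) = spanLT k s n ⊔ Submodule.span k {s n} := by
  rw [spanLT, spanLT, ← Submodule.span_union]
  congr 1
  ext x
  simp only [Set.mem_image, Set.mem_Iio, Set.mem_union, Set.mem_singleton_iff, Nat.lt_succ_iff_lt_or_eq]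
  constructor
  · rintro ⟨m, h | rfl, rfl⟩
    exacts [Or.inl ⟨m, h, rfl⟩, Or.inr rfl]
  · rintro (⟨m, h, rfl⟩ | rfl)
    exacts [⟨m, Or.inl h, rfl⟩, ⟨n, Or.inr rfl, rfl⟩]

theorem spanLT_zero (s : ℕ → X) : spanLT k s 0 = ⊥ := by
  simp [spanLT]

theorem isClosed_spanLT (s : ℕ → X) (n : ℕ) : IsClosed (spanLT k s n : Set X) := by
  induction n with
  | zero => rw [spanLT_zero]; exact isClosed_singleton
  | succ n ih => rw [spanLT_succ]; exact isClosed_sup_span _ ih _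

/-- The orthogonality constants. -/
def orthConst (n : ℕ) : ℝ := 2 - 1 / (n + 1)

theorem one_le_orthConst (n : ℕ) : 1 ≤ orthConst n := by
  have : (1 : ℝ) / (n + 1) ≤ 1 := by
    rw [div_le_one (by positivity)]; linarith [n.cast_nonneg (α := ℝ)]
  rw [orthConst]; linarith

theorem orthConst_pos (n : ℕ) : 0 < orthConst n := zero_lt_one.trans_le (one_le_orthConst n)

theorem orthConst_div_le (n : ℕ) : orthConst (n + 1) / orthConst n ≤ orthConst (n + 1) :=
  div_le_self (orthConst_pos _).le (one_le_orthConst n)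

/-- The n-th vector is chosen with constant `orthConst (n + 1) / orthConst n`, which must exceed 1.
These ratios telescope, so the total loss over any number of steps stays below 2. -/
theorem orthConst_lt_succ (n : ℕ) : orthConst n < orthConst (n + 1) := by
  rw [orthConst, orthConst, Nat.cast_succ]
  have : (1 : ℝ) / (n + 1 + 1) < 1 / (n + 1) := one_div_lt_one_div_of_lt (by positivity) (by linarith)
  linarith

theorem orthConst_le_two (n : ℕ) : orthConst n ≤ 2 := by
  have : (0 : ℝ) ≤ 1 / (n + 1) := by positivity
  rw [orthConst]; linarith

variable (k) in
theorem exists_orthSeq (s : ℕ → X) : ∃ e : ℕ → X, ∀ n, e n - s n ∈ spanLT k s n ∧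
    ∀ g ∈ spanLT k s n, ‖e n‖ ≤ orthConst (n + 1) / orthConst n * ‖e n + g‖ := by
  choose e he using fun n => exists_nearly_orthogonal (spanLT k s n) (isClosed_spanLT s n) (s n)
    ((one_lt_div (orthConst_pos n)).2 (orthConst_lt_succ n))
  exact ⟨e, he⟩

variable (k) in
/-- A nearly orthogonal sequence with the same finite spans as `s`. -/
def orthSeq (s : ℕ → X) : ℕ → X := (exists_orthSeq k s).choose

theorem orthSeq_sub_mem (s : ℕ → X) (n : ℕ) : orthSeq k s n - s n ∈ spanLT k s n :=
  ((exists_orthSeq k s).choose_spec n).1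

theorem orthSeq_mem (s : ℕ → X) (n : ℕ) : orthSeq k s n ∈ spanLT k s (n + 1) := by
  rw [spanLT_succ, ← sub_add_cancel (orthSeq k s n) (s n)]
  exact add_mem (Submodule.mem_sup_left (orthSeq_sub_mem s n))
    (Submodule.mem_sup_right (Submodule.mem_span_singleton_self _))

theorem norm_smul_orthSeq_le (s : ℕ → X) (n : ℕ) (c : k) {g : X} (hg : g ∈ spanLT k s n) :
    ‖c • orthSeq k s n‖ ≤ orthConst (n + 1) / orthConst n * ‖c • orthSeq k s n + g‖ :=
  norm_smul_le_of_nearly_orthogonal (div_nonneg (orthConst_pos _).le (orthConst_pos _).le)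
    ((exists_orthSeq k s).choose_spec n).2 c hg

theorem norm_le_orthSeq (s : ℕ → X) (n : ℕ) (c : k) {g : X} (hg : g ∈ spanLT k s n) :
    ‖g‖ ≤ orthConst (n + 1) / orthConst n * ‖c • orthSeq k s n + g‖ :=
  norm_le_of_nearly_orthogonal ((one_le_div (orthConst_pos n)).2 (orthConst_lt_succ n).le)
    ((exists_orthSeq k s).choose_spec n).2 c hg

theorem spanLT_succ_orthSeq (s : ℕ → X) (n : ℕ) :
    spanLT k s (n + 1) = spanLT k s n ⊔ Submodule.span k {orthSeq k s n} := by
  rw [spanLT_succ, sup_span_eq (orthSeq_sub_mem s n)]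

theorem mem_spanLT {s : ℕ → X} {m n : ℕ} (h : m < n) : s m ∈ spanLT k s n :=
  Submodule.subset_span ⟨m, h, rfl⟩

theorem spanLT_mono {s : ℕ → X} {m n : ℕ} (h : m ≤ n) : spanLT k s m ≤ spanLT k s n :=
  Submodule.span_mono (Set.image_mono (Set.Iio_subset_Iio h))

/-- Coordinate functionals for a nearly orthogonal sequence. -/
theorem exists_coord_orthSeq (s : ℕ → X) (n : ℕ) : ∃ φ : ℕ → X →ₗ[k] k, ∀ x ∈ spanLT k s n,
    x = ∑ l ∈ Finset.range n, φ l x • orthSeq k s l ∧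
      ∀ l < n, ‖φ l x • orthSeq k s l‖ ≤ orthConst n * ‖x‖ := by
  induction n with
  | zero =>
    refine ⟨fun _ => 0, fun x hx => ?_⟩
    rw [spanLT_zero, Submodule.mem_bot] at hx
    simp [hx]
  | succ n ih =>
    obtain ⟨φ, hφ⟩ := ih
    set e := orthSeq k s n with he
    -- The functional ψ reads off the coefficient of the new vector. If that vector already lies in
    -- the previous span, zero will do.
    obtain ⟨ψ, hψ⟩ : ∃ ψ : X →ₗ[k] k, ∀ x ∈ spanLT k s (n + 1), x - ψ x • e ∈ spanLT k s n := by
      by_cases h0 : e ∈ spanLT k s n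
      · refine ⟨0, fun x hx => ?_⟩
        rw [spanLT_succ_orthSeq, ← he, sup_eq_left.2 (by simpa using h0)] at hx
        simpa using hx
      · obtain ⟨ψ, hψe, hψ⟩ := Submodule.exists_le_ker_of_notMem h0
        refine ⟨(ψ e)⁻¹ • ψ, fun x hx => ?_⟩
        rw [spanLT_succ_orthSeq, ← he] at hx
        obtain ⟨g, hg, y, hy, rfl⟩ := Submodule.mem_sup.1 hx
        obtain ⟨c, rfl⟩ := Submodule.mem_span_singleton.1 hy
        have hg0 : ψ g = 0 := hψ hg
        have : (ψ e)⁻¹ * (c * ψ e) = c := by field_simp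
        simpa [hg0, this] using hg
    -- The earlier functionals are evaluated after the component along the new vector has been
    -- removed.
    refine ⟨fun l => if l = n then ψ else φ l ∘ₗ (LinearMap.id - ψ.smulRight e), fun x hx => ?_⟩
    obtain ⟨h1, h2⟩ := hφ _ (hψ x hx)
    have hb : ∀ l < n, (if l = n then ψ else φ l ∘ₗ (LinearMap.id - ψ.smulRight e)) x =
        φ l (x - ψ x • e) := fun l hl => by rw [if_neg hl.ne]; rfl
    have hx' : ψ x • e + (x - ψ x • e) = x := add_sub_cancel _ _
    beta_reduce
    constructor
    · rw [Finset.sum_range_succ, Finset.sum_congr rfl fun l hl => by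
        rw [hb l (Finset.mem_range.1 hl)], ← h1, if_pos rfl, sub_add_cancel]
    · intro l hl
      have hc := (div_nonneg (orthConst_pos (n + 1)).le (orthConst_pos n).le)
      rcases Nat.lt_succ_iff_lt_or_eq.1 hl with hl | rfl
      · rw [hb l hl]
        refine (h2 l hl).trans ?_
        have := norm_le_orthSeq s n (ψ x) (hψ x hx)
        rw [← he, hx'] at this
        -- The constant of the earlier stage cancels the denominator of the new ratio.
        refine (mul_le_mul_of_nonneg_left this (orthConst_pos n).le).trans_eq ?_
        rw [← mul_assoc, mul_div_cancel₀ _ (orthConst_pos n).ne']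
      · rw [if_pos rfl]
        have := norm_smul_orthSeq_le s l (ψ x) (hψ x hx)
        rw [← he, hx'] at this
        exact this.trans (mul_le_mul_of_nonneg_right (orthConst_div_le l) (norm_nonneg x))

/-- The same telescoping estimate for vectors already given on the lines, without coordinate
functionals; it passes to infinite sums in `isStrictMono_orthSum`. -/
theorem norm_le_sum_orthSeq (s : ℕ → X) (v : ℕ → X)
    (hv : ∀ l, v l ∈ Submodule.span k {orthSeq k s l}) (n : ℕ) :
    ∀ l < n, ‖v l‖ ≤ orthConst n * ‖∑ l ∈ Finset.range n, v l‖ := by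
  have hmem : ∀ n, ∑ l ∈ Finset.range n, v l ∈ spanLT k s n := fun n =>
    Submodule.sum_mem _ fun l hl => by
      obtain ⟨c, hc⟩ := Submodule.mem_span_singleton.1 (hv l)
      rw [← hc]
      exact Submodule.smul_mem _ _ (spanLT_mono (Finset.mem_range.1 hl) (orthSeq_mem s l))
  induction n with
  | zero => intro l hl; exact absurd hl (Nat.not_lt_zero l)
  | succ n ih =>
    intro l hl
    obtain ⟨c, hc⟩ := Submodule.mem_span_singleton.1 (hv n)
    rw [Finset.sum_range_succ, add_comm _ (v n)]
    rcases Nat.lt_succ_iff_lt_or_eq.1 hl with hl | rfl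
    · refine (ih l hl).trans ?_
      have := norm_le_orthSeq s n c (hmem n)
      rw [hc] at this
      refine (mul_le_mul_of_nonneg_left this (orthConst_pos n).le).trans_eq ?_
      rw [← mul_assoc, mul_div_cancel₀ _ (orthConst_pos n).ne']
    · have := norm_smul_orthSeq_le s l c (hmem l)
      rw [hc] at this
      exact this.trans (mul_le_mul_of_nonneg_right (orthConst_div_le l) (norm_nonneg _))

end Orthogonal

end BanNA

end

noncomputable section

namespace BanNA

/-! ### Flatness -/

section Flat

variable {k : Type u} [NormedField k] [IsUltrametricDist k] [CompleteSpace k]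
  {A B K X Y : BanNA k}

theorem norm_sum_le {ι : Type*} (s : List ι) (f : ι → A) {M : ℝ} (hM : 0 ≤ M)
    (h : ∀ i ∈ s, ‖f i‖ ≤ M) : ‖(s.map f).sum‖ ≤ M := by
  induction s with
  | nil => simpa using hM
  | cons i s ih =>
    rw [List.map_cons, List.sum_cons]
    exact (IsUltrametricDist.norm_add_le_max _ _).trans
      (max_le (h i (by simp)) (ih fun j hj => h j (by simp [hj])))

theorem norm_ofAlg (t : AlgTensor k A B) : ‖ofAlg A B t‖ = projNorm t :=
  UniformSpace.Completion.norm_coe (E := AlgTensor k A B) t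

theorem whiskerLeft_ofAlg (X : BanNA k) (g : A ⟶ B) (t : X.carrier ⊗[k] A.carrier) :
    (X ◁ g) (ofAlg X A t) = ofAlg X B (LinearMap.lTensor X.carrier (Hom.lin g) t) := by
  have : Hom.lin (X ◁ g) ∘ₗ ofAlg X A = ofAlg X B ∘ₗ LinearMap.lTensor X.carrier (Hom.lin g) :=
    TensorProduct.ext' fun x a => by
      change (X ◁ g) (tmul x a) = _
      rw [whiskerLeft_tmul]; rfl
  exact LinearMap.congr_fun this t

theorem lid_rTensor_sum (φ : X →ₗ[k] k) (l : List (X × A)) :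
    TensorProduct.lid k A.carrier (LinearMap.rTensor A.carrier φ
      (l.map fun p => (p.1 ⊗ₜ[k] p.2 : X.carrier ⊗[k] A.carrier)).sum) =
    (l.map fun p => φ p.1 • p.2).sum := by
  induction l with
  | nil => simp
  | cons p l ih => simp only [List.map_cons, List.sum_cons, map_add, ih]; simp

/-- Choose a nearly orthogonal system eᵢ with coordinates φᵢ for the left entries of a
representation of t and of a good one of (1 ⊗ g)t. Then t = ∑ eᵢ ⊗ κᵢ with κᵢ = (φᵢ ⊗ 1)t, and g(κᵢ)
can be computed from the good representation, giving ‖eᵢ‖‖g(κᵢ)‖ ≤ 2M. The lower bound for g turns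
this into a bound for ‖eᵢ‖‖κᵢ‖. -/
theorem projNorm_le_lTensor (g : K ⟶ A) {C : ℝ} (hC : 0 ≤ C) (hg : ∀ x, ‖x‖ ≤ C * ‖g x‖)
    (t : AlgTensor k X K) {M : ℝ}
    (h : RepBound (A := X) (B := A) (LinearMap.lTensor X.carrier (Hom.lin g) t) M) :
    projNorm t ≤ C * (2 * M) := by
  obtain ⟨hM, l, hl, hb⟩ := h
  obtain ⟨-, -, l', hl', -⟩ := exists_repBound t
  -- One system must serve both representations: l' to rewrite t, l to estimate the coefficients.
  -- The default value 0 beyond the list plays no role, as only the first N members are used.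
  let xs := l'.map Prod.fst ++ l.map Prod.fst
  let s : ℕ → X := fun n => xs.getD n 0
  let N := xs.length
  have hs : ∀ x ∈ xs, x ∈ spanLT k s N := fun x hx => by
    obtain ⟨n, hn, rfl⟩ := List.mem_iff_getElem.1 hx
    have : s n = xs[n] := List.getD_eq_getElem xs 0 hn
    rw [← this]
    exact mem_spanLT hn
  obtain ⟨φ, hφ⟩ := exists_coord_orthSeq (k := k) s N
  let κ : ℕ → K := fun i => TensorProduct.lid k K.carrier (LinearMap.rTensor K.carrier (φ i) t)
  have hκ : ∀ i, g (κ i) = (l.map fun p => φ i p.1 • p.2).sum := fun i => by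
    rw [← lid_rTensor_sum, hl]
    have : Hom.lin g ∘ₗ (TensorProduct.lid k K.carrier).toLinearMap ∘ₗ
        LinearMap.rTensor K.carrier (φ i) = (TensorProduct.lid k A.carrier).toLinearMap ∘ₗ
        LinearMap.rTensor A.carrier (φ i) ∘ₗ LinearMap.lTensor X.carrier (Hom.lin g) :=
      TensorProduct.ext' fun x a => by simp
    exact LinearMap.congr_fun this t
  have hsum : ∀ l' : List (X × K), (∀ p ∈ l', p.1 ∈ spanLT k s N) →
      ((List.range N).map fun i => (orthSeq k s i ⊗ₜ[k]
        (l'.map fun p => φ i p.1 • p.2).sum : X.carrier ⊗[k] K.carrier)).sum =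
        (l'.map fun p => (p.1 ⊗ₜ[k] p.2 : X.carrier ⊗[k] K.carrier)).sum := by
    intro l' h
    rw [← List.sum_toFinset _ List.nodup_range]
    induction l' with
    | nil => simp
    | cons p l' ih =>
      simp only [List.map_cons, List.sum_cons, TensorProduct.tmul_add, Finset.sum_add_distrib]
      rw [ih fun q hq => h q (by simp [hq])]
      congr 1
      conv_rhs => rw [(hφ p.1 (h p (by simp))).1, TensorProduct.sum_tmul]
      refine Finset.sum_congr (by ext; simp) fun i _ => ?_
      rw [TensorProduct.tmul_smul, TensorProduct.smul_tmul']
  refine projNorm_le ⟨by positivity, (List.range N).map fun i => (orthSeq k s i, κ i), ?_, ?_⟩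
  · rw [List.map_map, ← hl', ← hsum l' fun p hp => hs _ (by
      simp only [xs, List.mem_append, List.mem_map]; exact Or.inl ⟨p, hp, rfl⟩)]
    congr 1
    refine List.map_congr_left fun i _ => ?_
    rw [Function.comp_apply, ← lid_rTensor_sum, hl']
  · intro p hp
    obtain ⟨i, hi, rfl⟩ := List.mem_map.1 hp
    have h1 : ‖orthSeq k s i‖ * ‖g (κ i)‖ ≤ 2 * M := by
      rw [hκ]
      -- A vector of the nearly orthogonal sequence is allowed to vanish; its term then has norm
      -- zero.
      by_cases h0 : ‖orthSeq k s i‖ = 0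
      · rw [h0, zero_mul]; positivity
      have h0' : 0 < ‖orthSeq k s i‖ := lt_of_le_of_ne (norm_nonneg _) (Ne.symm h0)
      rw [mul_comm, ← le_div_iff₀ h0']
      refine norm_sum_le _ _ (by positivity) fun p hp => ?_
      rw [le_div_iff₀ h0', norm_smul]
      have h2 := (hφ p.1 (hs _ (by
        simp only [xs, List.mem_append, List.mem_map]; exact Or.inr ⟨p, hp, rfl⟩))).2 i
          (List.mem_range.1 hi)
      rw [norm_smul] at h2
      calc ‖φ i p.1‖ * ‖p.2‖ * ‖orthSeq k s i‖ = ‖φ i p.1‖ * ‖orthSeq k s i‖ * ‖p.2‖ := by ring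
        _ ≤ (2 * ‖p.1‖) * ‖p.2‖ := mul_le_mul_of_nonneg_right
            (h2.trans (mul_le_mul_of_nonneg_right (orthConst_le_two _) (norm_nonneg _)))
            (norm_nonneg _)
        _ = 2 * (‖p.1‖ * ‖p.2‖) := by ring
        _ ≤ 2 * M := mul_le_mul_of_nonneg_left (hb p hp) zero_le_two
    calc ‖orthSeq k s i‖ * ‖κ i‖ ≤ ‖orthSeq k s i‖ * (C * ‖g (κ i)‖) :=
          mul_le_mul_of_nonneg_left (hg _) (norm_nonneg _)
      _ = C * (‖orthSeq k s i‖ * ‖g (κ i)‖) := by ring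
      _ ≤ C * (2 * M) := mul_le_mul_of_nonneg_left h1 hC

theorem norm_le_whiskerLeft (X : BanNA k) (g : K ⟶ A) {C : ℝ} (hC : 0 ≤ C)
    (hg : ∀ x, ‖x‖ ≤ C * ‖g x‖) (z : (X ⊗ K : BanNA k)) : ‖z‖ ≤ C * 2 * ‖(X ◁ g) z‖ := by
  refine (denseRange_ofAlg X K).induction_on
    (p := fun z : (X ⊗ K : BanNA k) => ‖z‖ ≤ C * 2 * ‖(X ◁ g) z‖) z
    (isClosed_le continuous_norm ((hom_continuous (X ◁ g)).norm.const_mul _)) fun t => ?_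
  rw [whiskerLeft_ofAlg]
  refine le_of_forall_pos_le_add fun ε hε => ?_
  have h1 : ∀ M, RepBound (A := X) (B := A) (LinearMap.lTensor X.carrier (Hom.lin g) t) M →
      ‖ofAlg X K t‖ ≤ C * (2 * M) := fun M hM =>
    (norm_ofAlg t).trans_le (projNorm_le_lTensor g hC hg t hM)
  have h2 := h1 _ (repBound_of_lt (M := projNorm (A := X) (B := A)
    (LinearMap.lTensor X.carrier (Hom.lin g) t) + ε / (C * 2 + 1))
    (lt_add_of_pos_right _ (by positivity)))
  refine h2.trans ?_
  rw [← mul_assoc, mul_add]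
  refine add_le_add (le_of_eq (congrArg _ (norm_ofAlg _).symm)) ?_
  rw [← mul_div_assoc, div_le_iff₀ (by positivity)]
  nlinarith

theorem IsStrictMono.exists_nonneg {g : K ⟶ A} (hg : IsStrictMono g) :
    ∃ C : ℝ, 0 ≤ C ∧ ∀ x, ‖x‖ ≤ C * ‖g x‖ := by
  obtain ⟨C, hC⟩ := hg
  exact ⟨|C|, abs_nonneg C, fun x =>
    (hC x).trans (mul_le_mul_of_nonneg_right (le_abs_self C) (norm_nonneg _))⟩

theorem IsStrictMono.whiskerLeft {g : K ⟶ A} (hg : IsStrictMono g) (X : BanNA k) :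
    IsStrictMono (X ◁ g) := by
  obtain ⟨C, hC, h⟩ := hg.exists_nonneg
  exact ⟨C * 2, norm_le_whiskerLeft X g hC h⟩

theorem IsStrictMono.injective {g : K ⟶ A} (hg : IsStrictMono g) : Function.Injective g := by
  intro x y h
  obtain ⟨C, hC⟩ := hg
  have := hC (x - y)
  rw [map_sub', h, sub_self, norm_zero, mul_zero, norm_le_zero_iff, sub_eq_zero] at this
  exact this

theorem IsStrictMono.isClosed_range {g : K ⟶ A} (hg : IsStrictMono g) :
    IsClosed (Set.range g) := by
  obtain ⟨C, hC, h⟩ := hg.exists_nonneg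
  obtain ⟨D, hD⟩ := Hom.bound g
  exact (AddMonoidHomClass.antilipschitz_of_bound (K := ⟨C, hC⟩) (Hom.lin g) h).isClosed_range
    (AddMonoidHomClass.uniformContinuous_of_bound (Hom.lin g) D hD)

theorem braiding_injective : Function.Injective (β_ A B).hom :=
  Function.LeftInverse.injective (g := (β_ A B).inv) fun x => congr($((β_ A B).hom_inv_id) x)

theorem IsStrictMono.whiskerRight {g : K ⟶ A} (hg : IsStrictMono g) (X : BanNA k) :
    IsStrictMono (g ▷ X) := by
  obtain ⟨C, hC, h⟩ := (hg.whiskerLeft X).exists_nonneg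
  refine ⟨C, fun z => ?_⟩
  have e : g ▷ X ≫ (β_ A X).hom = (β_ K X).hom ≫ X ◁ g :=
    BraidedCategory.braiding_naturality_left g X
  have h1 : ‖z‖ ≤ ‖(β_ K X).hom z‖ := by
    have : (β_ X K).hom ((β_ K X).hom z) = z := congr($(SymmetricCategory.symmetry K X) z)
    conv_lhs => rw [← this]
    exact isContr_braiding _
  refine h1.trans ((h _).trans (mul_le_mul_of_nonneg_left ?_ hC))
  rw [← comp_apply, ← e]
  exact isContr_braiding _

variable (k) in
/-- The line spanned by a vector. -/
def line (e : A) : BanNA k :=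
  haveI : CompleteSpace (Submodule.span k {e} : Submodule k A) := by
    have := isClosed_sup_span (k := k) (⊥ : Submodule k A) isClosed_singleton e
    rw [bot_sup_eq] at this
    exact this.completeSpace_coe
  ⟨(Submodule.span k {e} : Submodule k A)⟩

/-- The inclusion of the line spanned by a vector. -/
def lineIncl (e : A) : line k e ⟶ A :=
  ⟨(Submodule.span k {e} : Submodule k A).subtype, 1, fun x => (one_mul ‖x‖).ge⟩

theorem lineIncl_mem (e : A) (x : line k e) : lineIncl e x ∈ Submodule.span k {e} := x.2

theorem norm_lineIncl (e : A) (x : line k e) : ‖lineIncl e x‖ = ‖x‖ := rfl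

/-- A line is zero or isomorphic to k, though not isometrically. Being a retract of the unit object
covers both cases and is enough to preserve injectivity. -/
theorem line_retract (e : A) : ∃ (φ : line k e ⟶ 𝟙_ (BanNA k)) (ψ : 𝟙_ (BanNA k) ⟶ line k e),
    φ ≫ ψ = 𝟙 _ := by
  by_cases h : e = 0
  · refine ⟨0, 0, hom_ext fun x => Subtype.ext ?_⟩
    obtain ⟨r, hr⟩ := Submodule.mem_span_singleton.1 (lineIncl_mem e x)
    have h0 : r • e = 0 := by rw [h, smul_zero]
    exact (hr.symm.trans h0).symm
  · let E := LinearEquiv.toSpanNonzeroSingleton k A e h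
    have hE : ∀ c : k, ((E c : Submodule.span k {e}) : A) = c • e := fun c => rfl
    refine ⟨⟨E.symm.toLinearMap, ‖e‖⁻¹, fun x => ?_⟩,
      pt (⟨e, Submodule.mem_span_singleton_self e⟩ : Submodule.span k {e}), hom_ext fun x => ?_⟩
    · obtain ⟨c, rfl⟩ := E.surjective x
      change ‖E.symm (E c)‖ ≤ ‖e‖⁻¹ * ‖c • e‖
      rw [E.symm_apply_apply, norm_smul, mul_comm ‖c‖,
        inv_mul_cancel_left₀ (norm_ne_zero_iff.2 h)]
    · obtain ⟨c, rfl⟩ := E.surjective x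
      refine Subtype.ext ?_
      change E.symm (E c) • e = c • e
      rw [E.symm_apply_apply]

theorem whiskerLeft_injective_of_retract {L : BanNA k} {φ : L ⟶ 𝟙_ (BanNA k)}
    {ψ : 𝟙_ (BanNA k) ⟶ L} (h : φ ≫ ψ = 𝟙 _) {f : A ⟶ B} (hf : Function.Injective f)
    {z : (L ⊗ A : BanNA k)} (hz : (L ◁ f) z = 0) : z = 0 := by
  have e1 : L ◁ f ≫ φ ▷ B ≫ (λ_ B).hom = φ ▷ A ≫ (λ_ A).hom ≫ f := by
    rw [whisker_exchange_assoc, leftUnitor_naturality]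
  have e2 : φ ▷ A ≫ (λ_ A).hom ≫ (λ_ A).inv ≫ ψ ▷ A = 𝟙 _ := by
    rw [Iso.hom_inv_id_assoc, ← comp_whiskerRight, h, id_whiskerRight]
  have h1 : f ((φ ▷ A ≫ (λ_ A).hom) z) = 0 := by
    refine (congr($e1 z).symm).trans ?_
    rw [comp_apply, hz, map_zero']
  have h2 : (φ ▷ A ≫ (λ_ A).hom) z = 0 := hf (h1.trans (map_zero' f).symm)
  refine congr($e2 z).symm.trans ?_
  change ((λ_ A).inv ≫ ψ ▷ A) ((φ ▷ A ≫ (λ_ A).hom) z) = 0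
  rw [h2, map_zero']

/-- The map from an orthogonal sum of lines. -/
def orthSum (s : ℕ → X) : contrCoprod (fun n => line k (orthSeq k s n)) ⟶ X :=
  desc (fun n => lineIncl (orthSeq k s n)) 1 zero_le_one fun _ a =>
    (one_mul ‖a‖).ge.trans' (norm_lineIncl _ a).le

theorem orthSum_incl (s : ℕ → X) (n : ℕ) (a : line k (orthSeq k s n)) :
    orthSum s (incl _ n a) = lineIncl _ a :=
  desc_incl (E := fun n => line k (orthSeq k s n)) (fun n => lineIncl (orthSeq k s n)) 1
    zero_le_one (fun _ a => (one_mul ‖a‖).ge.trans' (norm_lineIncl _ a).le) n a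

/-- Each component is bounded by twice the partial sums, with a constant independent of their
length, and the estimate survives in the limit. -/
theorem isStrictMono_orthSum (s : ℕ → X) : IsStrictMono (orthSum (k := k) s) := by
  refine ⟨2, fun x => norm_le_of_coord fun l => ?_⟩
  have hsum := (hasSum_incl x).map (Hom.lin (orthSum s)) (hom_continuous (orthSum s))
  have hlim := (hsum.tendsto_sum_nat.norm).const_mul 2
  refine ge_of_tendsto hlim ?_
  filter_upwards [eventually_gt_atTop l] with n hn
  have := norm_le_sum_orthSeq (k := k) s (fun l => lineIncl _ (coord x l))
    (fun l => lineIncl_mem _ _) n l hn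
  refine (norm_lineIncl _ (coord x l)).symm.le.trans (this.trans ?_)
  refine (mul_le_mul_of_nonneg_right (orthConst_le_two n) (norm_nonneg _)).trans_eq ?_
  congr 2
  exact Finset.sum_congr rfl fun i _ => (orthSum_incl s i _).symm

theorem mem_range_orthSum (s : ℕ → X) (n : ℕ) : s n ∈ Set.range (orthSum (k := k) s) := by
  have key : ∀ n, spanLT k s n ≤ LinearMap.range (Hom.lin (orthSum (k := k) s)) := by
    intro n
    induction n with
    | zero => rw [spanLT_zero]; exact bot_le
    | succ n ih =>
      rw [spanLT_succ_orthSeq]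
      refine sup_le ih ?_
      rw [Submodule.span_singleton_le_iff_mem]
      exact ⟨incl _ n ⟨_, Submodule.mem_span_singleton_self _⟩, orthSum_incl s n _⟩
  exact key (n + 1) (mem_spanLT (Nat.lt_succ_self n))

/-- Every element of a completed tensor product comes from a nearly orthogonal sequence. -/
theorem exists_mem_range_orthSum (z : (X ⊗ A : BanNA k)) :
    ∃ s : ℕ → X, z ∈ Set.range (orthSum (k := k) s ▷ A) := by
  have hz : z ∈ closure (Set.range (ofAlg X A)) := denseRange_ofAlg X A z
  obtain ⟨t, ht, hlim⟩ := mem_closure_iff_seq_limit.1 hz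
  choose t' ht' using ht
  have hrep := fun n => exists_repBound (t' n : AlgTensor k X A)
  choose M hM0 l hl hb using hrep
  -- Approximate z by algebraic tensors; their left entries form a countable set. The vector 0 is
  -- added to make it nonempty, so that it is the range of a sequence.
  let S : Set X := {0} ∪ ⋃ n, {x | x ∈ (l n).map Prod.fst}
  have hS : S.Countable := (Set.countable_singleton 0).union
    (Set.countable_iUnion fun n => (List.finite_toSet _).countable)
  obtain ⟨s, hs⟩ := hS.exists_eq_range ⟨0, Or.inl rfl⟩
  refine ⟨s, ?_⟩
  -- The range is closed because strictness survives tensoring, so it contains the limit of the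
  -- approximating tensors.
  have hcl := ((isStrictMono_orthSum (k := k) s).whiskerRight A).isClosed_range
  refine hcl.mem_of_tendsto hlim (Eventually.of_forall fun n => ?_)
  rw [← ht' n, ← hl n, map_list_sum, List.map_map]
  refine list_sum_mem (S := LinearMap.range (Hom.lin (orthSum (k := k) s ▷ A))) fun y hy => ?_
  obtain ⟨p, hp, rfl⟩ := List.mem_map.1 hy
  have hpS : p.1 ∈ S := Or.inr (Set.mem_iUnion.2 ⟨n, List.mem_map.2 ⟨p, hp, rfl⟩⟩)
  rw [hs] at hpS
  obtain ⟨i, hi⟩ := hpS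
  obtain ⟨w, hw⟩ := mem_range_orthSum (k := k) s i
  refine ⟨tmul w p.2, ?_⟩
  refine (whiskerRight_tmul _ _ _ _).trans ?_
  rw [hw, hi]; rfl

/-- Tensoring with a non-Archimedean Banach space preserves injective maps. -/
theorem whiskerLeft_injective (X : BanNA k) {f : A ⟶ B} (hf : Function.Injective f) :
    Function.Injective (X ◁ f) := by
  refine (injective_iff_map_eq_zero (Hom.lin (X ◁ f))).2 fun z hz => ?_
  -- X may be replaced by an orthogonal sum of lines: the map into X ⊗ B stays injective, and on the
  -- sum the claim is checked line by line.
  obtain ⟨s, z', rfl⟩ := exists_mem_range_orthSum z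
  have h1 : (orthSum (k := k) s ▷ B) ((contrCoprod _ ◁ f) z') = 0 := by
    refine Eq.trans ?_ hz
    exact congr($(whisker_exchange (orthSum (k := k) s) f) z')
  have h2 := ((isStrictMono_orthSum (k := k) s).whiskerRight B).injective
    (h1.trans (map_zero' _).symm)
  have h3 : z' = 0 := proj_whiskerRight_ext fun n => by
    obtain ⟨φ, ψ, h⟩ := line_retract (k := k) (orthSeq k s n)
    rw [map_zero']
    refine whiskerLeft_injective_of_retract h hf ?_
    have := congr($(whisker_exchange (proj (fun n => line k (orthSeq k s n)) n) f) z')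
    refine this.symm.trans ?_
    rw [comp_apply, h2, map_zero']
  rw [h3, map_zero']

theorem whiskerRight_injective (X : BanNA k) {f : A ⟶ B} (hf : Function.Injective f) :
    Function.Injective (f ▷ X) := by
  have e : f ▷ X ≫ (β_ B X).hom = (β_ A X).hom ≫ X ◁ f :=
    BraidedCategory.braiding_naturality_left f X
  have h : Function.Injective (f ▷ X ≫ (β_ B X).hom) := by
    rw [e]; exact (whiskerLeft_injective X hf).comp braiding_injective
  exact Function.Injective.of_comp h

theorem tensorHom_injective {A' B' : BanNA k} {f : A ⟶ B} {g : A' ⟶ B'}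
    (hf : Function.Injective f) (hg : Function.Injective g) : Function.Injective (f ⊗ₘ g) := by
  rw [MonoidalCategory.tensorHom_def]
  exact (whiskerLeft_injective _ hg).comp (whiskerRight_injective _ hf)

/-! ### Universal properties of quotients and of their tensor products -/

section Quotient

variable (I : Submodule k A) (hI : IsClosed (I : Set A))

/-- The universal property of a quotient. -/
theorem exists_quotient_desc (g : A ⟶ B) (hg : ∀ a ∈ I, g a = 0) :
    ∃ h : quotient I hI ⟶ B, quotientMap I hI ≫ h = g := by
  obtain ⟨C, hC, hb⟩ := exists_bound g
  refine ⟨⟨I.liftQ (Hom.lin g) hg, C, fun y => ?_⟩, hom_ext fun a => rfl⟩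
  refine le_of_forall_pos_le_add fun ε hε => ?_
  obtain ⟨a, rfl, ha⟩ := Submodule.Quotient.norm_mk_lt y
    (show 0 < ε / (C + 1) by positivity)
  refine (hb a).trans ?_
  refine (mul_le_mul_of_nonneg_left ha.le hC).trans ?_
  rw [mul_add]
  refine add_le_add le_rfl ?_
  rw [← mul_div_assoc, div_le_iff₀ (by positivity)]
  nlinarith

theorem quotientMap_surjective : Function.Surjective (quotientMap I hI) := I.mkQ_surjective

theorem quotientMap_eq_zero_iff (a : A) : quotientMap I hI a = 0 ↔ a ∈ I :=
  Submodule.Quotient.mk_eq_zero I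

theorem exists_norm_lt_quotientMap (y : quotient I hI) {ε : ℝ} (hε : 0 < ε) :
    ∃ a, quotientMap I hI a = y ∧ ‖a‖ < ‖y‖ + ε := Submodule.Quotient.norm_mk_lt y hε

/-- The universal property of the tensor product with a quotient. -/
theorem exists_tensor_quotient_desc (g : X ⊗ A ⟶ Y) (hg : ∀ x, ∀ a ∈ I, g (tmul x a) = 0) :
    ∃ h : X ⊗ quotient I hI ⟶ Y, X ◁ quotientMap I hI ≫ h = g := by
  obtain ⟨C, hC, hb⟩ := exists_bound g
  let F : X →ₗ[k] quotient I hI →ₗ[k] Y :=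
    { toFun := fun x => I.liftQ (Hom.lin (tmulL A x ≫ g)) (hg x)
      map_add' := fun x x' => by
        refine LinearMap.ext fun y => ?_
        obtain ⟨a, rfl⟩ := quotientMap_surjective I hI y
        change g (tmul (x + x') a) = g (tmul x a) + g (tmul x' a)
        rw [add_tmul, map_add']
      map_smul' := fun r x => by
        refine LinearMap.ext fun y => ?_
        obtain ⟨a, rfl⟩ := quotientMap_surjective I hI y
        change g (tmul (r • x) a) = r • g (tmul x a)
        rw [smul_tmul, map_smul'] }
  have hF : ∀ x a, F x (quotientMap I hI a) = g (tmul x a) := fun x a => rfl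
  obtain ⟨h, hh, -⟩ := exists_lift F hC fun x y => by
    refine le_of_forall_pos_le_add fun ε hε => ?_
    obtain ⟨a, rfl, ha⟩ := exists_norm_lt_quotientMap I hI y
      (show 0 < ε / (C * ‖x‖ + 1) by positivity)
    rw [hF]
    refine (hb _).trans ((mul_le_mul_of_nonneg_left (norm_tmul_le x a) hC).trans ?_)
    rw [← mul_assoc, ← mul_assoc]
    refine (mul_le_mul_of_nonneg_left ha.le (by positivity)).trans ?_
    rw [mul_add]
    refine add_le_add le_rfl ?_
    rw [← mul_div_assoc, div_le_iff₀ (by positivity)]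
    nlinarith [mul_nonneg hC (norm_nonneg x)]
  refine ⟨h, tensor_ext fun x a => ?_⟩
  rw [comp_apply, whiskerLeft_tmul]
  exact (hh x _).trans (hF x a)

end Quotient

/-- Every non-Archimedean Banach space is flat. -/
theorem isFlat (X : BanNA k) : IsFlat X := by
  intro K A B i f hif
  obtain ⟨hi, hr⟩ := hif
  refine ⟨hi.whiskerLeft X, Set.Subset.antisymm ?_ fun z hz => ?_⟩
  · rintro _ ⟨z, rfl⟩
    have : i ≫ f = 0 := hom_ext fun x => (hr.subset ⟨x, rfl⟩ :)
    have h2 : X ◁ i ≫ X ◁ f = 0 := by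
      rw [← MonoidalCategory.whiskerLeft_comp, this, MonoidalPreadditive.whiskerLeft_zero]
    exact congr($h2 z)
  · let I : Submodule k A := LinearMap.ker (Hom.lin f)
    have hI : IsClosed (I : Set A) := isClosed_singleton.preimage (hom_continuous f)
    obtain ⟨f', hf'⟩ := exists_quotient_desc I hI f fun a ha => ha
    have hinj : Function.Injective f' := by
      refine (injective_iff_map_eq_zero (Hom.lin f')).2 fun y hy => ?_
      obtain ⟨a, rfl⟩ := quotientMap_surjective I hI y
      exact (quotientMap_eq_zero_iff I hI a).2 (congr($hf' a).symm.trans hy)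
    have h1 : (X ◁ quotientMap I hI) z = 0 := by
      refine whiskerLeft_injective X hinj ?_
      rw [map_zero', ← comp_apply, ← MonoidalCategory.whiskerLeft_comp, hf']
      exact hz
    -- The quotient map by the closed range N of X ⊗ K kills X ⊗ ker f, hence factors through X ⊗
    -- (A/ker f). As z vanishes there, it lies in N.
    let N : Submodule k (X ⊗ A : BanNA k) := LinearMap.range (Hom.lin (X ◁ i))
    have hN : IsClosed (N : Set (X ⊗ A : BanNA k)) := (hi.whiskerLeft X).isClosed_range
    obtain ⟨h, hh⟩ := exists_tensor_quotient_desc I hI (quotientMap N hN) fun x a ha => by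
      obtain ⟨y, rfl⟩ := hr.superset ha
      exact (quotientMap_eq_zero_iff N hN _).2 ⟨tmul x y, whiskerLeft_tmul X i x y⟩
    have h2 : quotientMap N hN z = 0 := by
      rw [← hh, comp_apply, h1, map_zero']
    exact (quotientMap_eq_zero_iff N hN z).1 h2

end Flat

end BanNA

end

noncomputable section

namespace BanNA

/-! ### Hopf structures on quotients -/

section Descent

open MonObj ComonObj

variable {k : Type u} [NormedField k] [IsUltrametricDist k] [CompleteSpace k]
  {A B C D X Y Z : BanNA k}

theorem epi_of_surjective (f : A ⟶ B) (hf : Function.Surjective f) : Epi f :=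
  ⟨fun g h e => hom_ext fun b => by
    obtain ⟨a, rfl⟩ := hf b
    exact congr($e a)⟩

/-- Fix the other entry of a pure tensor and cancel f in the remaining variable. -/
instance epi_whiskerRight (f : A ⟶ B) [Epi f] (W : BanNA k) : Epi (f ▷ W) :=
  ⟨fun g h e => tensor_ext fun b w => by
    have : f ≫ tmulR B w ≫ g = f ≫ tmulR B w ≫ h := hom_ext fun a => by
      have := congr($e (tmul a w))
      rwa [comp_apply, comp_apply, whiskerRight_tmul] at this
    exact congr($((cancel_epi f).1 this) b)⟩

instance epi_whiskerLeft (f : A ⟶ B) [Epi f] (W : BanNA k) : Epi (W ◁ f) :=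
  ⟨fun g h e => tensor_ext fun w b => by
    have : f ≫ tmulL B w ≫ g = f ≫ tmulL B w ≫ h := hom_ext fun a => by
      have := congr($e (tmul w a))
      rwa [comp_apply, comp_apply, whiskerLeft_tmul] at this
    exact congr($((cancel_epi f).1 this) b)⟩

instance epi_tensorHom (f : A ⟶ B) (g : C ⟶ D) [Epi f] [Epi g] : Epi (f ⊗ₘ g) := by
  rw [MonoidalCategory.tensorHom_def]
  exact epi_comp _ _

/-! ### Pasting commutative squares -/

section Squares

variable {A' B' C' D' W W' : BanNA k} {a : A ⟶ A'} {b : B ⟶ B'} {c : C ⟶ C'} {d : D ⟶ D'}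
  {w : W ⟶ W'}

theorem square_comp {f' : A' ⟶ B'} {f : A ⟶ B} {g' : B' ⟶ C'} {g : B ⟶ C}
    (h₁ : a ≫ f' = f ≫ b) (h₂ : b ≫ g' = g ≫ c) : a ≫ f' ≫ g' = (f ≫ g) ≫ c := by
  rw [← Category.assoc, h₁, Category.assoc, h₂, Category.assoc]

theorem square_whiskerRight {f' : A' ⟶ B'} {f : A ⟶ B} (h : a ≫ f' = f ≫ b) :
    (a ⊗ₘ w) ≫ f' ▷ W' = f ▷ W ≫ (b ⊗ₘ w) := by
  rw [← tensorHom_id, ← tensorHom_id, MonoidalCategory.tensorHom_comp_tensorHom,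
    MonoidalCategory.tensorHom_comp_tensorHom, h, Category.comp_id, Category.id_comp]

theorem square_whiskerLeft {f' : A' ⟶ B'} {f : A ⟶ B} (h : a ≫ f' = f ≫ b) :
    (w ⊗ₘ a) ≫ W' ◁ f' = W ◁ f ≫ (w ⊗ₘ b) := by
  rw [← id_tensorHom, ← id_tensorHom, MonoidalCategory.tensorHom_comp_tensorHom,
    MonoidalCategory.tensorHom_comp_tensorHom, h, Category.comp_id, Category.id_comp]

theorem square_tensorHom {f' : A' ⟶ B'} {f : A ⟶ B} {g' : C' ⟶ D'} {g : C ⟶ D}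
    (h₁ : a ≫ f' = f ≫ b) (h₂ : c ≫ g' = g ≫ d) :
    (a ⊗ₘ c) ≫ (f' ⊗ₘ g') = (f ⊗ₘ g) ≫ (b ⊗ₘ d) := by
  rw [MonoidalCategory.tensorHom_comp_tensorHom, MonoidalCategory.tensorHom_comp_tensorHom,
    h₁, h₂]

theorem square_refl (f : A ⟶ B) : 𝟙 A ≫ f = f ≫ 𝟙 B := by simp

theorem square_associator_hom :
    ((a ⊗ₘ b) ⊗ₘ c) ≫ (α_ A' B' C').hom = (α_ A B C).hom ≫ (a ⊗ₘ b ⊗ₘ c) :=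
  associator_naturality _ _ _

theorem square_associator_inv :
    (a ⊗ₘ b ⊗ₘ c) ≫ (α_ A' B' C').inv = (α_ A B C).inv ≫ ((a ⊗ₘ b) ⊗ₘ c) :=
  associator_inv_naturality _ _ _

theorem square_leftUnitor_hom : (𝟙 _ ⊗ₘ a) ≫ (λ_ A').hom = (λ_ A).hom ≫ a := by
  rw [id_tensorHom, leftUnitor_naturality]

theorem square_leftUnitor_inv : a ≫ (λ_ A').inv = (λ_ A).inv ≫ (𝟙 _ ⊗ₘ a) := by
  rw [id_tensorHom, leftUnitor_inv_naturality]

theorem square_rightUnitor_hom : (a ⊗ₘ 𝟙 _) ≫ (ρ_ A').hom = (ρ_ A).hom ≫ a := by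
  rw [tensorHom_id, rightUnitor_naturality]

theorem square_rightUnitor_inv : a ≫ (ρ_ A').inv = (ρ_ A).inv ≫ (a ⊗ₘ 𝟙 _) := by
  rw [tensorHom_id, rightUnitor_inv_naturality]

/-- If two squares have the same left epimorphic and the same right side, an equation between the
tops carries over to the bottoms. -/
theorem square_transfer [Epi a] {f' g' : A' ⟶ B'} {f g : A ⟶ B} (e : f = g)
    (h₁ : a ≫ f' = f ≫ b) (h₂ : a ≫ g' = g ≫ b) : f' = g' := by
  rw [← cancel_epi a, h₁, h₂, e]

end Squares

namespace GradedHopf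

/-- Structure maps on `Y` that are compatible with those of a graded Hopf algebra `H` along `q`. -/
structure Descent (H : GradedHopf X) (q : X ⟶ Y) where
  one : 𝟙_ (BanNA k) ⟶ Y
  mul : Y ⊗ Y ⟶ Y
  counit : Y ⟶ 𝟙_ (BanNA k)
  comul : Y ⟶ Y ⊗ Y
  braid : Y ⊗ Y ⟶ Y ⊗ Y
  antipode : Y ⟶ Y
  coact : Y ⟶ disk k ⊗ Y
  -- Identities are kept on the sides where nothing is divided out, so that every compatibility has
  -- the shape of a square and can be pasted.
  one_eq : 𝟙 _ ≫ one = H.mon.one ≫ q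
  mul_eq : (q ⊗ₘ q) ≫ mul = H.mon.mul ≫ q
  counit_eq : q ≫ counit = H.comon.counit ≫ 𝟙 _
  comul_eq : q ≫ comul = H.comon.comul ≫ (q ⊗ₘ q)
  braid_eq : (q ⊗ₘ q) ≫ braid = H.braid ≫ (q ⊗ₘ q)
  antipode_eq : q ≫ antipode = H.antipode ≫ q
  coact_eq : q ≫ coact = H.coact ≫ (𝟙 _ ⊗ₘ q)

/-! ### Transfer of the axioms along an epimorphism -/

namespace Descent

variable {H : GradedHopf X} {q : X ⟶ Y} [Epi q] (E : Descent H q)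

/-- The algebra structure on the quotient. -/
@[reducible]
def mon : MonObj Y where
  one := E.one
  mul := E.mul
  one_mul := by
    let _ := H.mon
    exact square_transfer (a := 𝟙 _ ⊗ₘ q) (MonObj.one_mul X)
      (square_comp (square_whiskerRight E.one_eq) E.mul_eq) square_leftUnitor_hom
  mul_one := by
    let _ := H.mon
    exact square_transfer (a := q ⊗ₘ 𝟙 _) (MonObj.mul_one X)
      (square_comp (square_whiskerLeft E.one_eq) E.mul_eq) square_rightUnitor_hom
  mul_assoc := by
    let _ := H.mon
    exact square_transfer (a := (q ⊗ₘ q) ⊗ₘ q) (MonObj.mul_assoc X)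
      (square_comp (square_whiskerRight E.mul_eq) E.mul_eq)
      (square_comp square_associator_hom (square_comp (square_whiskerLeft E.mul_eq) E.mul_eq))

/-- The coalgebra structure on the quotient. -/
@[reducible]
def comon : ComonObj Y where
  counit := E.counit
  comul := E.comul
  counit_comul := by
    let _ := H.comon
    exact square_transfer (a := q) (ComonObj.counit_comul X)
      (square_comp E.comul_eq (square_whiskerRight E.counit_eq)) square_leftUnitor_inv
  comul_counit := by
    let _ := H.comon
    exact square_transfer (a := q) (ComonObj.comul_counit X)
      (square_comp E.comul_eq (square_whiskerLeft E.counit_eq)) square_rightUnitor_inv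
  comul_assoc := by
    let _ := H.comon
    exact square_transfer (a := q) (ComonObj.comul_assoc X)
      (square_comp E.comul_eq (square_whiskerLeft E.comul_eq))
      (square_comp E.comul_eq (square_comp (square_whiskerRight E.comul_eq)
        square_associator_hom))

theorem square_midMap : ((q ⊗ₘ q) ⊗ₘ (q ⊗ₘ q)) ≫ midMap E.braid =
    midMap H.braid ≫ ((q ⊗ₘ q) ⊗ₘ (q ⊗ₘ q)) :=
  square_comp square_associator_hom <| square_comp (square_whiskerLeft square_associator_inv) <|
    square_comp (square_whiskerLeft (square_whiskerRight E.braid_eq)) <|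
    square_comp (square_whiskerLeft square_associator_hom) square_associator_inv

theorem square_coaction₂ : (q ⊗ₘ q) ≫ coaction₂ E.coact =
    coaction₂ H.coact ≫ ((𝟙 _ ⊗ₘ 𝟙 _) ⊗ₘ (q ⊗ₘ q)) :=
  square_comp (square_tensorHom E.coact_eq E.coact_eq) (tensorμ_natural _ _ _ _)

theorem square_braid_whiskerRight : ((q ⊗ₘ q) ⊗ₘ q) ≫ E.braid ▷ Y =
    H.braid ▷ X ≫ ((q ⊗ₘ q) ⊗ₘ q) := square_whiskerRight E.braid_eq

theorem square_braid_whiskerLeft : (q ⊗ₘ (q ⊗ₘ q)) ≫ Y ◁ E.braid =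
    X ◁ H.braid ≫ (q ⊗ₘ (q ⊗ₘ q)) := square_whiskerLeft E.braid_eq

theorem isPreBraidedBialgebra :
    letI := E.mon
    letI := E.comon
    IsPreBraidedBialgebra Y E.braid := by
  let _ := E.mon
  let _ := E.comon
  let _ := H.mon
  let _ := H.comon
  have h := H.bialgebra
  have hr := E.square_braid_whiskerRight
  have hl := E.square_braid_whiskerLeft
  have ha : ((q ⊗ₘ q) ⊗ₘ q) ≫ (α_ Y Y Y).hom = (α_ X X X).hom ≫ (q ⊗ₘ (q ⊗ₘ q)) :=
    square_associator_hom
  have hi : (q ⊗ₘ (q ⊗ₘ q)) ≫ (α_ Y Y Y).inv = (α_ X X X).inv ≫ ((q ⊗ₘ q) ⊗ₘ q) :=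
    square_associator_inv
  exact
  { preBraiding := square_transfer (a := (q ⊗ₘ q) ⊗ₘ q) (b := q ⊗ₘ (q ⊗ₘ q)) h.preBraiding
      (square_comp hr <| square_comp ha <| square_comp hl <| square_comp hi <| square_comp hr ha)
      (square_comp ha <| square_comp hl <| square_comp hi <| square_comp hr <| square_comp ha hl)
    one_left := square_transfer (a := 𝟙 _ ⊗ₘ q) (b := q ⊗ₘ q) h.one_left
      (square_comp (square_whiskerRight E.one_eq) E.braid_eq)
      (square_comp square_leftUnitor_hom <| square_comp square_rightUnitor_inv <|
        square_whiskerLeft E.one_eq)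
    one_right := square_transfer (a := q ⊗ₘ 𝟙 _) (b := q ⊗ₘ q) h.one_right
      (square_comp (square_whiskerLeft E.one_eq) E.braid_eq)
      (square_comp square_rightUnitor_hom <| square_comp square_leftUnitor_inv <|
        square_whiskerRight E.one_eq)
    mul_left := square_transfer (a := (q ⊗ₘ q) ⊗ₘ q) (b := q ⊗ₘ q) h.mul_left
      (square_comp (square_whiskerRight E.mul_eq) E.braid_eq)
      (square_comp ha <| square_comp hl <| square_comp hi <| square_comp hr <| square_comp ha <|
        square_whiskerLeft E.mul_eq)
    mul_right := square_transfer (a := q ⊗ₘ (q ⊗ₘ q)) (b := q ⊗ₘ q) h.mul_right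
      (square_comp (square_whiskerLeft E.mul_eq) E.braid_eq)
      (square_comp hi <| square_comp hr <| square_comp ha <| square_comp hl <| square_comp hi <|
        square_whiskerRight E.mul_eq)
    counit_left := square_transfer (a := q ⊗ₘ q) (b := q) h.counit_left
      (square_comp E.braid_eq <| square_comp (square_whiskerRight E.counit_eq)
        square_leftUnitor_hom)
      (square_comp (square_whiskerLeft E.counit_eq) square_rightUnitor_hom)
    counit_right := square_transfer (a := q ⊗ₘ q) (b := q) h.counit_right
      (square_comp E.braid_eq <| square_comp (square_whiskerLeft E.counit_eq)
        square_rightUnitor_hom)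
      (square_comp (square_whiskerRight E.counit_eq) square_leftUnitor_hom)
    comul_left := square_transfer (a := q ⊗ₘ q) (b := q ⊗ₘ (q ⊗ₘ q)) h.comul_left
      (square_comp (square_whiskerRight E.comul_eq) <| square_comp ha <| square_comp hl <|
        square_comp hi <| square_comp hr ha)
      (square_comp E.braid_eq (square_whiskerLeft E.comul_eq))
    comul_right := square_transfer (a := q ⊗ₘ q) (b := (q ⊗ₘ q) ⊗ₘ q) h.comul_right
      (square_comp (square_whiskerLeft E.comul_eq) <| square_comp hi <| square_comp hr <|
        square_comp ha <| square_comp hl hi)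
      (square_comp E.braid_eq (square_whiskerRight E.comul_eq))
    mul_comul := square_transfer (a := q ⊗ₘ q) (b := q ⊗ₘ q) h.mul_comul
      (square_comp E.mul_eq E.comul_eq)
      (square_comp (square_tensorHom E.comul_eq E.comul_eq) <| square_comp E.square_midMap <|
        square_tensorHom E.mul_eq E.mul_eq)
    one_comul := square_transfer (a := 𝟙 _) (b := q ⊗ₘ q) h.one_comul
      (square_comp E.one_eq E.comul_eq)
      (square_comp square_leftUnitor_inv (square_tensorHom E.one_eq E.one_eq))
    one_counit := square_transfer (a := 𝟙 _) (b := 𝟙 _) h.one_counit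
      (square_comp E.one_eq E.counit_eq) (square_refl _)
    mul_counit := square_transfer (a := q ⊗ₘ q) (b := 𝟙 _) h.mul_counit
      (square_comp E.mul_eq E.counit_eq)
      (square_comp (square_tensorHom E.counit_eq E.counit_eq) square_leftUnitor_hom) }

theorem isCoaction : IsCoaction E.coact where
  coassoc := square_transfer (a := q) (b := 𝟙 _ ⊗ₘ (𝟙 _ ⊗ₘ q)) H.isCoaction.coassoc
    (square_comp E.coact_eq (square_whiskerLeft E.coact_eq))
    (square_comp E.coact_eq <| square_comp
      (square_whiskerRight (b := 𝟙 _ ⊗ₘ 𝟙 _) (by rw [id_tensorHom_id]; exact square_refl _))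
      square_associator_hom)
  counit := square_transfer (a := q) (b := 𝟙 _ ⊗ₘ q) H.isCoaction.counit
    (square_comp E.coact_eq (square_whiskerRight (square_refl _))) square_leftUnitor_inv

/-- The graded Hopf algebra structure on a quotient. -/
def hopf : GradedHopf Y where
  mon := E.mon
  comon := E.comon
  braid := E.braid
  coact := E.coact
  antipode := E.antipode
  bialgebra := E.isPreBraidedBialgebra
  antipode_left := square_transfer (a := q) (b := q) H.antipode_left
    (square_comp E.comul_eq <| square_comp (square_whiskerRight E.antipode_eq) E.mul_eq)
    (square_comp E.counit_eq E.one_eq)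
  antipode_right := square_transfer (a := q) (b := q) H.antipode_right
    (square_comp E.comul_eq <| square_comp (square_whiskerLeft E.antipode_eq) E.mul_eq)
    (square_comp E.counit_eq E.one_eq)
  isCoaction := E.isCoaction
  one_graded := square_transfer (a := 𝟙 _) (b := 𝟙 _ ⊗ₘ q) H.one_graded
    (square_comp E.one_eq E.coact_eq)
    (square_comp square_leftUnitor_inv (square_tensorHom (square_refl _) E.one_eq))
  mul_graded := square_transfer (a := q ⊗ₘ q) (b := 𝟙 _ ⊗ₘ q) H.mul_graded
    (square_comp E.mul_eq E.coact_eq)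
    (square_comp E.square_coaction₂
      (square_tensorHom (by rw [id_tensorHom_id]; exact square_refl _) E.mul_eq))
  counit_graded := square_transfer (a := q) (b := 𝟙 _ ⊗ₘ 𝟙 _) H.counit_graded
    (square_comp E.coact_eq (square_whiskerLeft E.counit_eq))
    (square_comp E.counit_eq <| square_comp square_leftUnitor_inv
      (square_whiskerRight (square_refl _)))
  comul_graded := square_transfer (a := q) (b := 𝟙 _ ⊗ₘ (q ⊗ₘ q)) H.comul_graded
    (square_comp E.coact_eq (square_whiskerLeft E.comul_eq))
    (square_comp E.comul_eq <| square_comp E.square_coaction₂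
      (square_whiskerRight (by rw [id_tensorHom_id]; exact square_refl _)))
  braid_graded := square_transfer (a := q ⊗ₘ q) (b := (𝟙 _ ⊗ₘ 𝟙 _) ⊗ₘ (q ⊗ₘ q)) H.braid_graded
    (square_comp E.braid_eq E.square_coaction₂)
    (square_comp E.square_coaction₂
      (square_tensorHom (by rw [id_tensorHom_id]; exact square_refl _) E.braid_eq))
  antipode_graded := square_transfer (a := q) (b := 𝟙 _ ⊗ₘ q) H.antipode_graded
    (square_comp E.antipode_eq E.coact_eq)
    (square_comp E.coact_eq (square_whiskerLeft E.antipode_eq))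

theorem isHom : IsHom H E.hopf q where
  one := E.one_eq.symm.trans (Category.id_comp _)
  mul := E.mul_eq.symm
  counit := E.counit_eq.trans (Category.comp_id _)
  comul := E.comul_eq
  braid := E.braid_eq.symm
  antipode := E.antipode_eq.symm
  coact := E.coact_eq.trans (by rw [id_tensorHom])

end Descent

end GradedHopf

end Descent

end BanNA

end

noncomputable section

namespace BanNA

/-! ### The largest Nichols ideal -/

section Ideal

variable {k : Type u} [NormedField k] [IsUltrametricDist k] [CompleteSpace k]
  {A B X Y V W : BanNA k} {c : V ⊗ V ⟶ V ⊗ V} (hc : IsContr c)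

/-- The universal property in one tensor factor, used twice with the symmetry in between. -/
theorem exists_tensorHom_quotient_desc (I : Submodule k A) (hI : IsClosed (I : Set A))
    (g : A ⊗ A ⟶ Y) (hl : ∀ a ∈ I, ∀ x, g (tmul a x) = 0) (hr : ∀ x, ∀ a ∈ I, g (tmul x a) = 0) :
    ∃ h : quotient I hI ⊗ quotient I hI ⟶ Y, (quotientMap I hI ⊗ₘ quotientMap I hI) ≫ h = g := by
  obtain ⟨g', hg'⟩ := exists_tensor_quotient_desc I hI g hr
  obtain ⟨h, hh⟩ := exists_tensor_quotient_desc I hI ((β_ _ _).hom ≫ g') fun y a ha => by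
    obtain ⟨x, rfl⟩ := quotientMap_surjective I hI y
    rw [comp_apply, braiding_hom_tmul]
    have := congr($hg' (tmul a x))
    rw [comp_apply, whiskerLeft_tmul, hl a ha x] at this
    exact this
  refine ⟨(β_ _ _).hom ≫ h, tensor_ext fun a b => ?_⟩
  have h1 := congr($hh (tmul (quotientMap I hI b) a))
  have h2 := congr($hg' (tmul a b))
  simp only [comp_apply, whiskerLeft_tmul, braiding_hom_tmul] at h1 h2
  rw [comp_apply, tensorHom_tmul, comp_apply, braiding_hom_tmul, h1, h2]

theorem hasSum_degProj (x : tensorAlg V) : HasSum (fun n => degProj V n x) x :=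
  hasSum_incl (E := tensorPow V) x

theorem eq_zero_of_degProj (g : tensorAlg V ⟶ Y) (x : tensorAlg V)
    (h : ∀ n, g (degProj V n x) = 0) : g x = 0 := by
  have := (hasSum_degProj x).map (Hom.lin g) (hom_continuous g)
  refine this.unique ?_
  convert hasSum_zero using 1
  exact funext h

theorem degProj_whiskerLeft_ext {x y : (W ⊗ tensorAlg V : BanNA k)}
    (h : ∀ p, (W ◁ degProj V p) x = (W ◁ degProj V p) y) : x = y := by
  refine braiding_injective (degProj_whiskerRight_ext fun p => ?_)
  have e : (β_ W (tensorAlg V)).hom ≫ degProj V p ▷ W = W ◁ degProj V p ≫ (β_ _ _).hom :=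
    (BraidedCategory.braiding_naturality_right W (degProj V p)).symm
  exact congr($e x).trans ((congrArg (β_ W (tensorAlg V)).hom (h p)).trans congr($e y).symm)

/-- An element of `T(V) ⊗ W` without components of degree `> n` is the sum of its components. -/
theorem eq_sum_degProj_whiskerRight (n : ℕ) (z : (tensorAlg V ⊗ W : BanNA k))
    (h : ∀ p, n < p → (degProj V p ▷ W) z = 0) :
    z = ∑ p ∈ Finset.range (n + 1), (degProj V p ▷ W) z := by
  refine degProj_whiskerRight_ext fun m => ?_
  have hm : ∀ p, (degProj V m ▷ W) ((degProj V p ▷ W) z) =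
      if p = m then (degProj V m ▷ W) z else 0 := by
    intro p
    rw [← comp_apply, ← comp_whiskerRight]
    split_ifs with hp
    · rw [hp, degProj_comp_self]
    · rw [degProj_comp_ne (Ne.symm hp), MonoidalPreadditive.zero_whiskerRight]; rfl
  refine Eq.trans ?_ (map_sum (Hom.lin (degProj V m ▷ W)) _ _).symm
  rw [Finset.sum_congr rfl fun p _ => hm p, Finset.sum_ite_eq']
  split_ifs with hmn
  · rfl
  · exact h m (by simpa [Nat.lt_succ_iff] using hmn)

theorem tensorHom_eq_zero {f : A ⟶ X} {g : B ⟶ Y} {a : A} {b : B} (h : f a = 0 ∨ g b = 0) :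
    (f ⊗ₘ g) (tmul a b) = 0 := by
  rw [tensorHom_tmul]
  rcases h with h | h
  · rw [h, zero_tmul]
  · rw [h, tmul_zero]

/-- The kernel of the quantum symmetrizer. -/
def nicholsIdeal : Submodule k (tensorAlg V) := LinearMap.ker (Hom.lin (symmetrizer hc))

theorem mem_nicholsIdeal {x : tensorAlg V} : x ∈ nicholsIdeal hc ↔ symmetrizer hc x = 0 := Iff.rfl

theorem isClosed_nicholsIdeal : IsClosed (nicholsIdeal hc : Set (tensorAlg V)) :=
  isClosed_singleton.preimage (hom_continuous (symmetrizer hc))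

theorem symmetrizer_degProj_apply (n : ℕ) (x : tensorAlg V) :
    symmetrizer hc (degProj V n x) = degProj V n (symmetrizer hc x) :=
  congr($(degProj_symmetrizer_comm hc n) x)

theorem degProj_mem_nicholsIdeal {x : tensorAlg V} (hx : x ∈ nicholsIdeal hc) (n : ℕ) :
    degProj V n x ∈ nicholsIdeal hc := by
  rw [mem_nicholsIdeal] at hx ⊢
  rw [symmetrizer_degProj_apply, hx, map_zero']

theorem one_symmetrizer : emptyWord V ≫ symmetrizer hc = emptyWord V := by
  have h : symmetrizer hc = tensorCounit V ≫ emptyWord V +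
    tensorDeriv hc ≫ symmetrizer hc ▷ tensorAlg V ≫ concat V := symmetrizer_eq hc
  rw [h, Preadditive.comp_add, ← Category.assoc, one_tensorCounit, Category.id_comp,
    ← Category.assoc (emptyWord V) (tensorDeriv hc), one_tensorDeriv, Limits.zero_comp, add_zero]

theorem degProj_one_letter (v : V) : degProj V 1 (letter V v) = letter V v := by
  have h := congr($(letter_eq_oneLetter (V := V)) v)
  rw [h]
  exact degProj_inclT_self 1 _

theorem tensorCounit_letter (v : V) : tensorCounit V (letter V v) = 0 :=
  (congrArg (tensorCounit V) congr($(letter_eq_oneLetter (V := V)) v)).trans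
    (tensorCounit_inclT_succ 0 _)

theorem degProj_emptyWord {n : ℕ} (hn : n ≠ 0) : degProj V n (emptyWord V (sOne k)) = 0 :=
  degProj_inclT_ne hn _

theorem symmetrizer_emptyWord :
    symmetrizer hc (emptyWord V (sOne k)) = emptyWord V (sOne k) :=
  congr($(one_symmetrizer hc) (sOne k))

theorem symmetrizer_apply (x : tensorAlg V) : symmetrizer hc x = emptyWord V (tensorCounit V x) +
    concat V ((symmetrizer hc ⊗ₘ degProj V 1) (tensorComul hc x)) := by
  have h := congr($(symmetrizer_eq hc) x)
  rw [tensorDeriv, Category.assoc, ← MonoidalCategory.tensorHom_def'_assoc] at h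
  exact h

theorem symmetrizer_letter (hb : IsPreBraiding c) (v : V) :
    symmetrizer hc (letter V v) = letter V v := by
  rw [symmetrizer_apply, tensorCounit_letter, map_zero', zero_add, tensorComul_letter, map_add',
    tensorHom_tmul, tensorHom_tmul, degProj_emptyWord one_ne_zero, tmul_zero, add_zero,
    degProj_one_letter, symmetrizer_emptyWord, concat_one_left hc _ hb]

theorem symmetrizer_degProj_succ (n : ℕ) (x : tensorAlg V) :
    symmetrizer hc (degProj V (n + 1) x) =
      concat V (((degProj V n ≫ symmetrizer hc) ⊗ₘ degProj V 1) (tensorComul hc x)) := by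
  have h1 := congr($(symmetrizer_eq hc) (degProj V (n + 1) x))
  have h2 := congr($(degProj_tensorCounit (V := V) n) x)
  have h3 := congr($(degProj_tensorDeriv hc n) x)
  have h4 : tensorComul hc ≫ ((degProj V n ≫ symmetrizer hc) ⊗ₘ degProj V 1) =
      tensorDeriv hc ≫ degProj V n ▷ tensorAlg V ≫ symmetrizer hc ▷ tensorAlg V := by
    rw [tensorDeriv, MonoidalCategory.tensorHom_def', comp_whiskerRight, Category.assoc]
  simp only [comp_apply, add_apply] at h1 h2 h3
  rw [h1, h2, h3, zero_apply, map_zero', zero_add]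
  exact congrArg (concat V) congr($h4 x).symm

theorem degProj_zero_symmetrizer : degProj V 0 ≫ symmetrizer hc = degProj V 0 := by
  rw [degProj_zero, Category.assoc, one_symmetrizer]

theorem degProj_one_eq_letter (x : tensorAlg V) : ∃ v, degProj V 1 x = letter V v := by
  obtain ⟨v, hv⟩ := oneLetter_surjective (projT V 1 x)
  refine ⟨v, Eq.trans ?_ congr($(letter_eq_oneLetter (V := V)) v).symm⟩
  exact congrArg (inclT V 1) hv

theorem degProj_one_symmetrizer (hb : IsPreBraiding c) :
    degProj V 1 ≫ symmetrizer hc = degProj V 1 := hom_ext fun x => by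
  obtain ⟨v, hv⟩ := degProj_one_eq_letter x
  rw [comp_apply, hv, symmetrizer_letter hc hb]

theorem coord_eq_zero_of_degProj {n : ℕ} {x : tensorAlg V} (h : degProj V n x = 0) :
    coord (E := tensorPow V) x n = 0 := by
  have := congr($(degProj_projT_self (V := V) n) x)
  rw [comp_apply, h, map_zero'] at this
  exact this.symm

theorem degProj_of_coord_eq_zero {n : ℕ} {x : tensorAlg V}
    (h : coord (E := tensorPow V) x n = 0) : degProj V n x = 0 :=
  (congrArg (inclT V n) h).trans (map_zero' _)

/-- The kernel theorem applies to homogeneous components, and the kernel is homogeneous; continuity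
in each factor then sums over all degrees. -/
theorem concat_mem_nicholsIdeal (hb : IsPreBraiding c) {x y : tensorAlg V}
    (h : x ∈ nicholsIdeal hc ∨ y ∈ nicholsIdeal hc) : concat V (tmul x y) ∈ nicholsIdeal hc := by
  have key : ∀ n m, symmetrizer hc (concat V (tmul (degProj V n x) (degProj V m y))) = 0 := by
    intro n m
    -- A vector is turned into a generalized element, namely a map from the unit object, and is
    -- recovered by evaluation at 1.
    have h1 := (tensorSym hc hb).mul_ker_std n m (pt (tmul x y)) (hom_ext fun r => by
      change ((degProj V n ≫ symmetrizer hc) ⊗ₘ (degProj V m ≫ symmetrizer hc))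
        (toScalar r • tmul x y) = 0
      rw [map_smul', tensorHom_eq_zero, smul_zero]
      rw [comp_apply, comp_apply]
      exact h.imp (degProj_mem_nicholsIdeal hc · n) (degProj_mem_nicholsIdeal hc · m))
    have h2 := congr($h1 (sOne k))
    change symmetrizer hc (concat V ((degProj V n ⊗ₘ degProj V m)
      (toScalar (sOne k) • tmul x y))) = 0 at h2
    rwa [show toScalar (sOne k) = 1 from rfl, one_smul, tensorHom_tmul] at h2
  refine eq_zero_of_degProj (tmulR _ y ≫ concat V ≫ symmetrizer hc) x fun n => ?_
  exact eq_zero_of_degProj (tmulL _ (degProj V n x) ≫ concat V ≫ symmetrizer hc) y fun m => key n m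

theorem symmetrizer_tensorComul (hb : IsPreBraiding c) {x : tensorAlg V}
    (hx : x ∈ nicholsIdeal hc) : (symmetrizer hc ⊗ₘ symmetrizer hc) (tensorComul hc x) = 0 := by
  refine degProj_whiskerLeft_ext fun m => ?_
  rw [map_zero']
  have h1 := (tensorSym hc hb).comul_ker_std m (pt x) (hom_ext fun r => by
    change symmetrizer hc (toScalar r • x) = 0
    rw [map_smul', hx, smul_zero])
  have h2 := congr($h1 (sOne k))
  change (symmetrizer hc ⊗ₘ (degProj V m ≫ symmetrizer hc)) (tensorComul hc
    (toScalar (sOne k) • x)) = 0 at h2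
  rw [show toScalar (sOne k) = 1 from rfl, one_smul, degProj_symmetrizer_comm,
    MonoidalCategory.tensorHom_def, MonoidalCategory.whiskerLeft_comp, ← Category.assoc,
    ← MonoidalCategory.tensorHom_def] at h2
  exact h2

/-- The quotient of the tensor algebra by the kernel of the quantum symmetrizer. -/
def nichols : BanNA k := quotient (nicholsIdeal hc) (isClosed_nicholsIdeal hc)

/-- The quotient map to the Nichols algebra. -/
def toNichols : tensorAlg V ⟶ nichols hc := quotientMap (nicholsIdeal hc) (isClosed_nicholsIdeal hc)

theorem toNichols_surjective : Function.Surjective (toNichols hc) := quotientMap_surjective _ _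

instance epi_toNichols : Epi (toNichols hc) := epi_of_surjective _ (toNichols_surjective hc)

theorem toNichols_eq_zero_iff {x : tensorAlg V} : toNichols hc x = 0 ↔ x ∈ nicholsIdeal hc :=
  quotientMap_eq_zero_iff _ _ x

/-- The embedding of the Nichols algebra in the tensor algebra induced by the quantum
symmetrizer. -/
def ofNichols : nichols hc ⟶ tensorAlg V :=
  (exists_quotient_desc (nicholsIdeal hc) (isClosed_nicholsIdeal hc) (symmetrizer hc)
    fun _ h => h).choose

theorem toNichols_ofNichols : toNichols hc ≫ ofNichols hc = symmetrizer hc :=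
  (exists_quotient_desc (nicholsIdeal hc) (isClosed_nicholsIdeal hc) (symmetrizer hc)
    fun _ h => h).choose_spec

theorem ofNichols_injective : Function.Injective (ofNichols hc) :=
  (injective_iff_map_eq_zero (Hom.lin (ofNichols hc))).2 fun y hy => by
    obtain ⟨x, rfl⟩ := toNichols_surjective hc y
    exact (toNichols_eq_zero_iff hc).2 (congr($(toNichols_ofNichols hc) x).symm.trans hy)

/-- 𝔖 is the quotient map followed by an injective map whose range may fail to be closed. Its tensor
square is still injective, so vanishing in the tensor square of the quotient can be tested with 𝔖 ⊗
𝔖. Every descent involving two tensor factors rests on this. -/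
theorem tensorHom_toNichols_eq_zero_iff {z : (tensorAlg V ⊗ tensorAlg V : BanNA k)} :
    (toNichols hc ⊗ₘ toNichols hc) z = 0 ↔ (symmetrizer hc ⊗ₘ symmetrizer hc) z = 0 := by
  rw [← toNichols_ofNichols, ← MonoidalCategory.tensorHom_comp_tensorHom, comp_apply]
  refine ⟨fun h => by rw [h, map_zero'], fun h => ?_⟩
  exact tensorHom_injective (ofNichols_injective hc) (ofNichols_injective hc)
    (h.trans (map_zero' _).symm)

/-- The coideal generated by a subspace. -/
def coidealSpan (I : Submodule k A) : Submodule k (A ⊗ A : BanNA k) :=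
  Submodule.span k {z | ∃ a b, (a ∈ I ∨ b ∈ I) ∧ z = tmul a b}

theorem map_eq_zero_of_mem_closure_coidealSpan {I : Submodule k A} (g : A ⊗ A ⟶ Y)
    (hg : ∀ a b, (a ∈ I ∨ b ∈ I) → g (tmul a b) = 0) {z : (A ⊗ A : BanNA k)}
    (hz : z ∈ closure (coidealSpan I : Set (A ⊗ A : BanNA k))) : g z = 0 := by
  have hcl : IsClosed {z : (A ⊗ A : BanNA k) | g z = 0} :=
    isClosed_singleton.preimage (hom_continuous g)
  refine closure_minimal ?_ hcl hz
  change coidealSpan I ≤ LinearMap.ker (Hom.lin g)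
  refine Submodule.span_le.2 ?_
  rintro _ ⟨a, b, h, rfl⟩
  exact hg a b h

/-- The quotient by the closure of I ⊗ T + T ⊗ I kills everything with an entry in I, so its
quotient map factors through q ⊗ q. Hence an element killed by q ⊗ q lies in that closure. -/
theorem mem_closure_coidealSpan {z : (tensorAlg V ⊗ tensorAlg V : BanNA k)}
    (hz : (toNichols hc ⊗ₘ toNichols hc) z = 0) :
    z ∈ closure (coidealSpan (nicholsIdeal hc) : Set (tensorAlg V ⊗ tensorAlg V : BanNA k)) := by
  let N := (coidealSpan (nicholsIdeal hc)).topologicalClosure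
  have hN : IsClosed (N : Set (tensorAlg V ⊗ tensorAlg V : BanNA k)) :=
    Submodule.isClosed_topologicalClosure _
  have hmem : ∀ a b, (a ∈ nicholsIdeal hc ∨ b ∈ nicholsIdeal hc) →
      quotientMap N hN (tmul a b) = 0 := fun a b h =>
    (quotientMap_eq_zero_iff N hN _).2
      (Submodule.le_topologicalClosure _ (Submodule.subset_span ⟨a, b, h, rfl⟩))
  obtain ⟨h, hh⟩ := exists_tensorHom_quotient_desc (nicholsIdeal hc) (isClosed_nicholsIdeal hc)
    (quotientMap N hN) (fun a ha x => hmem a x (Or.inl ha)) fun x a ha => hmem x a (Or.inr ha)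
  refine (quotientMap_eq_zero_iff N hN z).1 (congr($hh z).symm.trans ?_)
  exact (congrArg h hz).trans (map_zero' h)

theorem isNicholsIdeal_nicholsIdeal (hb : IsPreBraiding c) :
    IsNicholsIdeal (tensorHopf hc hb) (nicholsIdeal hc) where
  closed := isClosed_nicholsIdeal hc
  homogeneous x hx n := degProj_mem_nicholsIdeal hc hx n
  degree_ge_two x hx := by
    constructor
    · refine coord_eq_zero_of_degProj ?_
      rw [← degProj_zero_symmetrizer hc]
      exact degProj_mem_nicholsIdeal hc hx 0
    · refine coord_eq_zero_of_degProj ?_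
      rw [← degProj_one_symmetrizer hc hb]
      exact degProj_mem_nicholsIdeal hc hx 1
  mul_left a x hx := concat_mem_nicholsIdeal hc hb (Or.inr hx)
  mul_right x hx a := concat_mem_nicholsIdeal hc hb (Or.inl hx)
  counit x hx := by
    change tensorCounit V x = 0
    have h1 : degProj V 0 x = 0 := by
      rw [← degProj_zero_symmetrizer hc]
      exact degProj_mem_nicholsIdeal hc hx 0
    have h2 : degProj V 0 ≫ tensorCounit V = tensorCounit V := by
      rw [degProj_zero, Category.assoc, one_tensorCounit, Category.comp_id]
    rw [← h2, comp_apply, h1, map_zero']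
  comul x hx := mem_closure_coidealSpan hc
    ((tensorHom_toNichols_eq_zero_iff hc).2 (symmetrizer_tensorComul hc hb hx))

/-- For an admissible J, induct on the degree. In degree n + 1, 𝔖x is computed from (π_n𝔖 ⊗ π₁)Δx,
and Δx is a limit of sums of tensors with an entry in J. A left entry in J dies by induction, a
right one because J starts in degree two. -/
theorem isGreatest_nicholsIdeal (hb : IsPreBraiding c) :
    IsGreatest {J | IsNicholsIdeal (tensorHopf hc hb) J} (nicholsIdeal hc) := by
  refine ⟨isNicholsIdeal_nicholsIdeal hc hb, fun J hJ => ?_⟩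
  have key : ∀ n, ∀ x ∈ J, symmetrizer hc (degProj V n x) = 0 := by
    intro n
    induction n with
    | zero =>
      intro x hx
      rw [degProj_of_coord_eq_zero (hJ.degree_ge_two x hx).1, map_zero']
    | succ n ih =>
      intro x hx
      rw [symmetrizer_degProj_succ]
      refine Eq.trans (congrArg (concat V) ?_) (map_zero' (concat V))
      refine map_eq_zero_of_mem_closure_coidealSpan _ (fun a b h => tensorHom_eq_zero ?_)
        (hJ.comul x hx)
      exact h.imp (ih a) fun hb => degProj_of_coord_eq_zero (hJ.degree_ge_two b hb).2
  exact fun x hx => eq_zero_of_degProj (symmetrizer hc) x fun n => key n x hx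

end Ideal

end BanNA

end

noncomputable section

namespace BanNA

/-! ### The Nichols algebra -/

section NicholsAlgebra

variable {k : Type u} [NormedField k] [IsUltrametricDist k] [CompleteSpace k]
  {A B X Y V W : BanNA k} {c : V ⊗ V ⟶ V ⊗ V} (hc : IsContr c)

theorem tensorComul_degProj_whiskerRight_lt {n p : ℕ} (h : n < p) (x : tensorAlg V) :
    (degProj V p ▷ tensorAlg V) (tensorComul hc (degProj V n x)) = 0 := by
  refine degProj_whiskerLeft_ext fun m => ?_
  rw [map_zero', ← comp_apply, ← MonoidalCategory.tensorHom_def]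
  exact tensorComul_degProj hc (by omega) _

/-- If the left factor has the full degree n, the right one has degree zero, where the projection is
the counit followed by the unit. -/
theorem tensorComul_degProj_whiskerRight_self (hb : IsPreBraiding c) (n : ℕ) (x : tensorAlg V) :
    (degProj V n ▷ tensorAlg V) (tensorComul hc (degProj V n x)) =
      tmul (degProj V n x) (emptyWord V (sOne k)) := by
  have h1 : (degProj V n ⊗ₘ degProj V 0) (tensorComul hc (degProj V n x)) =
      (degProj V n ▷ tensorAlg V) (tensorComul hc (degProj V n x)) := by
    refine degProj_whiskerLeft_ext fun m => ?_
    change ((degProj V n ⊗ₘ degProj V 0) ≫ tensorAlg V ◁ degProj V m) _ =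
      (degProj V n ▷ tensorAlg V ≫ tensorAlg V ◁ degProj V m) _
    rw [← MonoidalCategory.tensorHom_def, MonoidalCategory.tensorHom_def, Category.assoc,
      ← MonoidalCategory.whiskerLeft_comp]
    by_cases hm : m = 0
    · subst hm
      rw [degProj_comp_self, ← MonoidalCategory.tensorHom_def]
    · rw [degProj_comp_ne hm]
      refine Eq.trans ?_ (tensorComul_degProj hc (by omega) _).symm
      rw [MonoidalPreadditive.whiskerLeft_zero, Limits.comp_zero]; rfl
  have h2 : tensorComul hc ≫ (degProj V n ⊗ₘ degProj V 0) =
      (ρ_ _).inv ≫ (degProj V n ⊗ₘ emptyWord V) := by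
    have := congr($((tensorData hc hb).comul_counit_std) ≫ (degProj V n ⊗ₘ emptyWord V))
    rw [← this, degProj_zero]
    change _ = (tensorComul hc ≫ _ ◁ tensorCounit V) ≫ _
    simp [MonoidalCategory.tensorHom_def']
  rw [← h1]
  refine congr($h2 (degProj V n x)).trans ?_
  rw [comp_apply, rightUnitor_inv_apply, tensorHom_tmul, ← comp_apply, degProj_comp_self]

theorem toNichols_concat (hb : IsPreBraiding c) : ∃ μ : nichols hc ⊗ nichols hc ⟶ nichols hc,
    (toNichols hc ⊗ₘ toNichols hc) ≫ μ = concat V ≫ toNichols hc :=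
  exists_tensorHom_quotient_desc _ _ _
    (fun _ h _ => (toNichols_eq_zero_iff hc).2 (concat_mem_nicholsIdeal hc hb (Or.inl h)))
    fun _ _ h => (toNichols_eq_zero_iff hc).2 (concat_mem_nicholsIdeal hc hb (Or.inr h))

/-- 𝔖 ⊗ 𝔖 commutes with the pre-braiding, so the pre-braiding preserves the kernel of 𝔖 ⊗ 𝔖, which
is that of q ⊗ q. -/
theorem toNichols_tensorBraid (hb : IsPreBraiding c) :
    ∃ β : nichols hc ⊗ nichols hc ⟶ nichols hc ⊗ nichols hc,
      (toNichols hc ⊗ₘ toNichols hc) ≫ β = tensorBraid hc ≫ (toNichols hc ⊗ₘ toNichols hc) := by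
  have hr : _ ◁ symmetrizer hc ≫ tensorBraid hc = tensorBraid hc ≫ symmetrizer hc ▷ _ :=
    (tensorSym hc hb).𝔖_β_right_std
  have hl : symmetrizer hc ▷ _ ≫ tensorBraid hc = tensorBraid hc ≫ _ ◁ symmetrizer hc :=
    (tensorSym hc hb).𝔖_β_left_std
  have h : (symmetrizer hc ⊗ₘ symmetrizer hc) ≫ tensorBraid hc =
      tensorBraid hc ≫ (symmetrizer hc ⊗ₘ symmetrizer hc) := by
    rw [MonoidalCategory.tensorHom_def, Category.assoc, hr, ← Category.assoc, hl, Category.assoc,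
      ← MonoidalCategory.tensorHom_def', ← MonoidalCategory.tensorHom_def]
  have key : ∀ x y, (x ∈ nicholsIdeal hc ∨ y ∈ nicholsIdeal hc) →
      (tensorBraid hc ≫ (toNichols hc ⊗ₘ toNichols hc)) (tmul x y) = 0 := fun x y hxy => by
    rw [comp_apply, tensorHom_toNichols_eq_zero_iff]
    refine congr($h (tmul x y)).symm.trans ?_
    rw [comp_apply, tensorHom_eq_zero hxy, map_zero']
  exact exists_tensorHom_quotient_desc _ _ _ (fun x h y => key x y (Or.inl h))
    fun x y h => key x y (Or.inr h)

theorem tensorComul_toNichols (hb : IsPreBraiding c) :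
    ∃ Δ : nichols hc ⟶ nichols hc ⊗ nichols hc,
      toNichols hc ≫ Δ = tensorComul hc ≫ (toNichols hc ⊗ₘ toNichols hc) :=
  exists_quotient_desc _ _ _ fun _ h =>
    (tensorHom_toNichols_eq_zero_iff hc).2 (symmetrizer_tensorComul hc hb h)

theorem tensorCoact_degProj (n : ℕ) (x : tensorAlg V) :
    tensorCoact V (degProj V n x) = tmul (tElt k n) (degProj V n x) := tensorCoact_inclT n _

theorem symmetrizer_tensorCoact :
    symmetrizer hc ≫ tensorCoact V = tensorCoact V ≫ disk k ◁ symmetrizer hc :=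
  inclT_ext fun n => hom_ext fun a => by
    simp only [comp_apply]
    rw [← degProj_inclT_self, symmetrizer_degProj_apply, tensorCoact_degProj, tensorCoact_degProj,
      whiskerLeft_tmul, symmetrizer_degProj_apply]

theorem tensorCoact_toNichols : ∃ ρ : nichols hc ⟶ disk k ⊗ nichols hc,
    toNichols hc ≫ ρ = tensorCoact V ≫ disk k ◁ toNichols hc := by
  refine exists_quotient_desc _ _ _ fun x hx => ?_
  refine whiskerLeft_injective (disk k) (ofNichols_injective hc) ?_
  rw [map_zero', ← comp_apply, Category.assoc, ← MonoidalCategory.whiskerLeft_comp,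
    toNichols_ofNichols, ← symmetrizer_tensorCoact, comp_apply, (mem_nicholsIdeal hc).1 hx,
    map_zero']

/-- Strong induction on n. Split Δ of the degree n part x into x ⊗ 1 and terms of left degree p < n.
In degrees p < n the antipode already descends, and (q ⊗ q)Δx = 0, so these terms contribute nothing
to q(S(x₁)x₂). As ε(x) = 0, the antipode identity leaves q(S(x)) = 0. -/
theorem toNichols_antipode_degProj (hb : IsPreBraiding c) (n : ℕ) :
    ∀ x ∈ nicholsIdeal hc, toNichols hc (tensorAntipode hc (degProj V n x)) = 0 := by
  induction n using Nat.strong_induction_on with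
  | _ n ih =>
    intro x hx
    obtain ⟨μ, hμ⟩ := toNichols_concat hc hb
    have hy := degProj_mem_nicholsIdeal hc hx n
    have hx0 := (isNicholsIdeal_nicholsIdeal hc hb).counit _ hy
    have h1 : toNichols hc (concat V ((tensorAntipode hc ▷ tensorAlg V)
        (tensorComul hc (degProj V n x)))) = 0 := by
      have := congr($((tensorHopf hc hb).antipode_left) (degProj V n x))
      refine (congrArg (toNichols hc) this).trans ?_
      refine (congrArg (toNichols hc) (congrArg (emptyWord V) hx0)).trans ?_
      rw [map_zero', map_zero']
    have h2 := eq_sum_degProj_whiskerRight n (tensorComul hc (degProj V n x))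
      fun p hp => tensorComul_degProj_whiskerRight_lt hc hp x
    rw [Finset.sum_range_succ, tensorComul_degProj_whiskerRight_self hc hb] at h2
    have h3 : ∀ p < n, (tensorAntipode hc ▷ tensorAlg V ≫ concat V ≫ toNichols hc)
        ((degProj V p ▷ tensorAlg V) (tensorComul hc (degProj V n x))) = 0 := by
      intro p hp
      obtain ⟨s, hs⟩ : ∃ s : nichols hc ⟶ nichols hc,
          toNichols hc ≫ s = degProj V p ≫ tensorAntipode hc ≫ toNichols hc :=
        exists_quotient_desc _ _ _ (ih p hp)
      have e : degProj V p ▷ tensorAlg V ≫ tensorAntipode hc ▷ tensorAlg V ≫ concat V ≫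
          toNichols hc = (toNichols hc ⊗ₘ toNichols hc) ≫ s ▷ nichols hc ≫ μ := by
        have e1 : toNichols hc ▷ nichols hc ≫ s ▷ nichols hc =
            (degProj V p ≫ tensorAntipode hc ≫ toNichols hc) ▷ nichols hc := by
          rw [← comp_whiskerRight, hs]
        rw [MonoidalCategory.tensorHom_def', Category.assoc, Tail.comp_eq e1, ← hμ,
          MonoidalCategory.tensorHom_def', Category.assoc]
        simp only [comp_whiskerRight, Category.assoc, whisker_exchange_assoc]
      refine congr($e _).trans ?_
      rw [comp_apply, (tensorHom_toNichols_eq_zero_iff hc).2 (symmetrizer_tensorComul hc hb hy),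
        map_zero']
    have h4 : (tensorAntipode hc ▷ tensorAlg V ≫ concat V ≫ toNichols hc)
        (∑ p ∈ Finset.range n, (degProj V p ▷ tensorAlg V)
          (tensorComul hc (degProj V n x))) = 0 :=
      (map_sum (Hom.lin _) _ _).trans (Finset.sum_eq_zero fun p hp => h3 p (Finset.mem_range.1 hp))
    rw [h2, map_add', map_add', map_add', whiskerRight_tmul, concat_one_right] at h1
    refine Eq.trans ?_ h1
    refine ((congrArg (· + _) h4).trans (zero_add _)).symm

theorem tensorAntipode_toNichols (hb : IsPreBraiding c) : ∃ S : nichols hc ⟶ nichols hc,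
    toNichols hc ≫ S = tensorAntipode hc ≫ toNichols hc :=
  exists_quotient_desc _ _ _ fun x hx =>
    eq_zero_of_degProj (tensorAntipode hc ≫ toNichols hc) x fun n =>
      toNichols_antipode_degProj hc hb n x hx

/-- Since q is an epimorphism, so are its tensor powers, and the descended maps are unique; choosing
them involves no freedom. -/
theorem exists_descent (hb : IsPreBraiding c) :
    Nonempty (GradedHopf.Descent (tensorHopf hc hb) (toNichols hc)) := by
  obtain ⟨μ, hμ⟩ := toNichols_concat hc hb
  obtain ⟨β, hβ⟩ := toNichols_tensorBraid hc hb
  obtain ⟨Δ, hΔ⟩ := tensorComul_toNichols hc hb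
  obtain ⟨ρ, hρ⟩ := tensorCoact_toNichols hc
  obtain ⟨S, hS⟩ := tensorAntipode_toNichols hc hb
  obtain ⟨ε, hε⟩ := exists_quotient_desc (nicholsIdeal hc) (isClosed_nicholsIdeal hc)
    (tensorCounit V) (isNicholsIdeal_nicholsIdeal hc hb).counit
  exact ⟨{
    one := emptyWord V ≫ toNichols hc
    mul := μ
    counit := ε
    comul := Δ
    braid := β
    antipode := S
    coact := ρ
    one_eq := Category.id_comp _
    mul_eq := hμ
    counit_eq := hε.trans (Category.comp_id _).symm
    comul_eq := hΔ
    braid_eq := hβ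
    antipode_eq := hS
    coact_eq := hρ.trans (by rw [id_tensorHom]; rfl) }⟩

/-- The graded Hopf algebra structure of the Nichols algebra. -/
def nicholsHopf (hb : IsPreBraiding c) : GradedHopf (nichols hc) := (exists_descent hc hb).some.hopf

theorem isHom_toNichols (hb : IsPreBraiding c) :
    GradedHopf.IsHom (tensorHopf hc hb) (nicholsHopf hc hb) (toNichols hc) :=
  (exists_descent hc hb).some.isHom

end NicholsAlgebra

end BanNA

end

noncomputable section

namespace BanNA

/-! ### Graded pieces, primitive elements and generation of the Nichols algebra -/

section NicholsProperties

variable {k : Type u} [NormedField k] [IsUltrametricDist k] [CompleteSpace k]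
  {A B X Y V W : BanNA k} {c : V ⊗ V ⟶ V ⊗ V} (hc : IsContr c)

theorem isStrictMono_of_retraction {i : A ⟶ B} {r : B ⟶ A} (h : i ≫ r = 𝟙 A) :
    IsStrictMono i := by
  obtain ⟨C, hC⟩ := Hom.bound r
  exact ⟨C, fun x => (congrArg norm congr($h x).symm).trans_le (hC (i x))⟩

theorem tensorCoact_diskProj (n : ℕ) :
    tensorCoact V ≫ diskProj k n ▷ tensorAlg V ≫ (λ_ _).hom = degProj V n :=
  inclT_ext fun m => hom_ext fun a => by
    change (diskProj k n ▷ tensorAlg V ≫ (λ_ _).hom) (tensorCoact V (inclT V m a)) =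
      degProj V n (inclT V m a)
    rw [tensorCoact_inclT, tmul_tElt_coeff]
    split_ifs with h
    · subst h; exact (degProj_inclT_self m a).symm
    · exact (degProj_inclT_ne (Ne.symm h) a).symm

theorem nicholsHopf_one (hb : IsPreBraiding c) :
    (nicholsHopf hc hb).one = toNichols hc (emptyWord V (sOne k)) :=
  congr($((isHom_toNichols hc hb).one) (sOne k)).symm

theorem nicholsHopf_mul (hb : IsPreBraiding c) (x y : tensorAlg V) :
    (nicholsHopf hc hb).mul (toNichols hc x) (toNichols hc y) =
      toNichols hc (concat V (tmul x y)) := by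
  have := congr($((isHom_toNichols hc hb).mul) (tmul x y))
  rw [comp_apply, comp_apply, tensorHom_tmul] at this
  exact this.symm

theorem nicholsHopf_comul (hb : IsPreBraiding c) (x : tensorAlg V) :
    (nicholsHopf hc hb).comul (toNichols hc x) =
      (toNichols hc ⊗ₘ toNichols hc) (tensorComul hc x) :=
  congr($((isHom_toNichols hc hb).comul) x)

theorem nicholsHopf_coact (hb : IsPreBraiding c) (x : tensorAlg V) :
    (nicholsHopf hc hb).coact (toNichols hc x) = (disk k ◁ toNichols hc) (tensorCoact V x) :=
  congr($((isHom_toNichols hc hb).coact) x)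

theorem toNichols_degProj_mem_piece (hb : IsPreBraiding c) (n : ℕ) (x : tensorAlg V) :
    toNichols hc (degProj V n x) ∈ (nicholsHopf hc hb).piece n := by
  change (nicholsHopf hc hb).coact _ = _
  rw [nicholsHopf_coact, tensorCoact_degProj, whiskerLeft_tmul]

theorem toNichols_degProj_of_mem_piece (hb : IsPreBraiding c) {n : ℕ} {x : tensorAlg V}
    (h : toNichols hc x ∈ (nicholsHopf hc hb).piece n) :
    toNichols hc (degProj V n x) = toNichols hc x := by
  change (nicholsHopf hc hb).coact _ = _ at h
  rw [nicholsHopf_coact] at h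
  have e : disk k ◁ toNichols hc ≫ diskProj k n ▷ nichols hc ≫ (λ_ _).hom =
      (diskProj k n ▷ tensorAlg V ≫ (λ_ _).hom) ≫ toNichols hc := by
    rw [whisker_exchange_assoc, leftUnitor_naturality, Category.assoc]
  have h1 := congrArg (diskProj k n ▷ nichols hc ≫ (λ_ _).hom) h
  rw [tmul_tElt_coeff, if_pos rfl, ← comp_apply, e, comp_apply, ← comp_apply (tensorCoact V),
    tensorCoact_diskProj] at h1
  exact h1

theorem degProj_zero_emptyWord (r : (𝟙_ (BanNA k) : BanNA k)) :
    degProj V 0 (emptyWord V r) = emptyWord V r := degProj_inclT_self 0 r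

/-- The linear part of an element of the tensor algebra. -/
def linearPart (V : BanNA k) : tensorAlg V ⟶ V := projT V 1 ≫ (show tensorPow V 1 ⟶ V from (λ_ V).hom)

theorem letter_linearPart : letter V ≫ linearPart V = 𝟙 V := by
  rw [linearPart, letter_eq_oneLetter, Category.assoc, ← Category.assoc (inclT V 1),
    inclT_projT_self, Category.id_comp]
  exact (λ_ V).inv_hom_id

/-- The inclusion of the scalars in the Nichols algebra. -/
def nicholsUnit : 𝟙_ (BanNA k) ⟶ nichols hc := emptyWord V ≫ toNichols hc

/-- The inclusion of the generating space in the Nichols algebra. -/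
def nicholsLetter : V ⟶ nichols hc := letter V ≫ toNichols hc

/-- 𝔖 is the identity in degrees zero and one, so the embedding into T(V) followed by a projection
is a bounded retraction. The same argument treats V. -/
theorem isStrictMono_nicholsUnit : IsStrictMono (nicholsUnit hc) :=
  isStrictMono_of_retraction (r := ofNichols hc ≫ tensorCounit V) <| by
    rw [nicholsUnit, Category.assoc, ← Category.assoc (toNichols hc), toNichols_ofNichols,
      ← Category.assoc, one_symmetrizer, one_tensorCounit]

theorem isStrictMono_nicholsLetter (hb : IsPreBraiding c) : IsStrictMono (nicholsLetter hc) :=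
  isStrictMono_of_retraction (r := ofNichols hc ≫ linearPart V) <| by
    have h : letter V ≫ symmetrizer hc = letter V := hom_ext (symmetrizer_letter hc hb)
    rw [nicholsLetter, Category.assoc, ← Category.assoc (toNichols hc), toNichols_ofNichols,
      ← Category.assoc, h, letter_linearPart]

theorem range_nicholsUnit (hb : IsPreBraiding c) :
    Set.range (nicholsUnit hc) = (nicholsHopf hc hb).piece 0 := by
  refine Set.Subset.antisymm ?_ fun y hy => ?_
  · rintro _ ⟨r, rfl⟩
    have := toNichols_degProj_mem_piece hc hb 0 (emptyWord V r)
    rwa [degProj_zero_emptyWord] at this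
  · obtain ⟨x, rfl⟩ := toNichols_surjective hc y
    exact ⟨projT V 0 x, toNichols_degProj_of_mem_piece hc hb hy⟩

theorem range_nicholsLetter (hb : IsPreBraiding c) :
    Set.range (nicholsLetter hc) = (nicholsHopf hc hb).piece 1 := by
  refine Set.Subset.antisymm ?_ fun y hy => ?_
  · rintro _ ⟨v, rfl⟩
    have := toNichols_degProj_mem_piece hc hb 1 (letter V v)
    rwa [degProj_one_letter] at this
  · obtain ⟨x, rfl⟩ := toNichols_surjective hc y
    obtain ⟨v, hv⟩ := degProj_one_eq_letter x
    refine ⟨v, ?_⟩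
    rw [← toNichols_degProj_of_mem_piece hc hb hy, hv]
    rfl

theorem letter_whiskerRight_braidLetter :
    letter V ▷ V ≫ braidLetter hc = c ≫ V ◁ letter V := by
  calc _ = ((λ_ V).inv ≫ emptyWord V ▷ V) ▷ V ≫ append V ▷ V ≫ braidLetter hc := by
        rw [letter]; simp only [comp_whiskerRight, Category.assoc]
    _ = 𝟙 _ ⊗≫ (emptyWord V ▷ (V ⊗ V) ≫ tensorAlg V ◁ c) ⊗≫ braidLetter hc ▷ V ⊗≫
          V ◁ append V := by rw [append_braidLetter]; monoidal
    _ = 𝟙 _ ⊗≫ c ⊗≫ (emptyWord V ▷ V ≫ braidLetter hc) ▷ V ⊗≫ V ◁ append V := by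
        rw [← whisker_exchange]; monoidal
    _ = _ := by rw [one_braidLetter, letter]; monoidal

theorem whiskerLeft_letter_tensorBraid :
    tensorAlg V ◁ letter V ≫ tensorBraid hc = braidLetter hc ≫ letter V ▷ tensorAlg V := by
  calc _ = tensorAlg V ◁ ((λ_ V).inv ≫ emptyWord V ▷ V) ≫ tensorAlg V ◁ append V ≫
          tensorBraid hc := by
        rw [letter]; simp only [MonoidalCategory.whiskerLeft_comp, Category.assoc]
    _ = 𝟙 _ ⊗≫ (tensorAlg V ◁ emptyWord V ≫ tensorBraid hc) ▷ V ⊗≫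
          tensorAlg V ◁ braidLetter hc ⊗≫ append V ▷ tensorAlg V := by
        rw [append_tensorBraid]; monoidal
    _ = 𝟙 _ ⊗≫ (emptyWord V ▷ (tensorAlg V ⊗ V) ≫ tensorAlg V ◁ braidLetter hc) ⊗≫
          append V ▷ tensorAlg V := by rw [one_tensorBraid]; monoidal
    _ = _ := by rw [← whisker_exchange, letter]; monoidal

theorem letter_tensorBraid :
    (letter V ⊗ₘ letter V) ≫ tensorBraid hc = c ≫ (letter V ⊗ₘ letter V) := by
  rw [MonoidalCategory.tensorHom_def, Category.assoc, whiskerLeft_letter_tensorBraid,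
    ← Category.assoc, letter_whiskerRight_braidLetter, Category.assoc,
    whisker_exchange]

theorem symmetrizer_tensorCounit : symmetrizer hc ≫ tensorCounit V = tensorCounit V := by
  have h : degProj V 0 ≫ tensorCounit V = tensorCounit V := by
    rw [degProj_zero, Category.assoc, one_tensorCounit, Category.comp_id]
  conv_lhs => rw [← h]
  rw [← Category.assoc, ← degProj_symmetrizer_comm, degProj_zero_symmetrizer, h]

theorem tensorComul_symmetrizer_counit (hb : IsPreBraiding c) :
    tensorComul hc ≫ (symmetrizer hc ⊗ₘ symmetrizer hc) ≫ tensorAlg V ◁ tensorCounit V ≫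
      (ρ_ _).hom = symmetrizer hc := by
  have h : tensorComul hc ≫ tensorAlg V ◁ tensorCounit V = (ρ_ _).inv :=
    (tensorData hc hb).comul_counit_std
  rw [MonoidalCategory.tensorHom_def, Category.assoc, ← MonoidalCategory.whiskerLeft_comp_assoc,
    symmetrizer_tensorCounit, ← whisker_exchange_assoc, Tail.comp_eq h, rightUnitor_naturality,
    Iso.inv_hom_id_assoc]

theorem nicholsLetter_braid (hb : IsPreBraiding c) :
    c ≫ (nicholsLetter hc ⊗ₘ nicholsLetter hc) =
      (nicholsLetter hc ⊗ₘ nicholsLetter hc) ≫ (nicholsHopf hc hb).braid := by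
  have h : tensorBraid hc ≫ (toNichols hc ⊗ₘ toNichols hc) =
    (toNichols hc ⊗ₘ toNichols hc) ≫ (nicholsHopf hc hb).braid := (isHom_toNichols hc hb).braid
  rw [nicholsLetter, ← MonoidalCategory.tensorHom_comp_tensorHom, Category.assoc, ← h,
    ← Category.assoc, ← letter_tensorBraid, Category.assoc]

/-- Embedding the primitivity equation in T ⊗ T gives (𝔖 ⊗ 𝔖)Δx = 1 ⊗ 𝔖x + 𝔖x ⊗ 1. Its components of
bidegree (n + 1, 1) determine the part of 𝔖x of degree n + 2, and the counit determines the part of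
degree zero. -/
theorem symmetrizer_eq_degProj_one_of_primitive (hb : IsPreBraiding c) {x : tensorAlg V}
    (hx : toNichols hc x ∈ (nicholsHopf hc hb).primitives) :
    symmetrizer hc x = degProj V 1 x := by
  change (nicholsHopf hc hb).comul _ = _ at hx
  rw [nicholsHopf_comul, nicholsHopf_one] at hx
  have h1 : (symmetrizer hc ⊗ₘ symmetrizer hc) (tensorComul hc x) =
      tmul (emptyWord V (sOne k)) (symmetrizer hc x) +
        tmul (symmetrizer hc x) (emptyWord V (sOne k)) := by
    have := congrArg (ofNichols hc ⊗ₘ ofNichols hc) hx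
    have e : ∀ x, ofNichols hc (toNichols hc x) = symmetrizer hc x := fun x =>
      congr($(toNichols_ofNichols hc) x)
    rw [map_add', tensorHom_tmul, tensorHom_tmul, ← comp_apply,
      MonoidalCategory.tensorHom_comp_tensorHom, toNichols_ofNichols, e, e,
      symmetrizer_emptyWord] at this
    exact this
  -- Both summands have a factor of degree zero, so they have no component of bidegree (n + 1, 1).
  have hbig : ∀ n, degProj V (n + 2) (symmetrizer hc x) = 0 := by
    intro n
    rw [← symmetrizer_degProj_apply, symmetrizer_degProj_succ]
    have e : (degProj V (n + 1) ≫ symmetrizer hc) ⊗ₘ degProj V 1 =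
        (symmetrizer hc ⊗ₘ symmetrizer hc) ≫ (degProj V (n + 1) ⊗ₘ degProj V 1) := by
      rw [MonoidalCategory.tensorHom_comp_tensorHom, ← degProj_symmetrizer_comm,
        ← degProj_symmetrizer_comm, degProj_one_symmetrizer hc hb]
    rw [e, comp_apply, h1, map_add', tensorHom_tmul, tensorHom_tmul,
      degProj_emptyWord n.succ_ne_zero, degProj_emptyWord one_ne_zero, zero_tmul, tmul_zero,
      add_zero, map_zero']
  -- Applying 1 ⊗ ε gives 𝔖x = ε(𝔖x)·1 + 𝔖x, so the scalar part vanishes.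
  have h0 : degProj V 0 (symmetrizer hc x) = 0 := by
    have h2 := congr($(tensorComul_symmetrizer_counit hc hb) x)
    have h3 : tensorCounit V (emptyWord V (sOne k)) = sOne k :=
      congr($(one_tensorCounit (V := V)) (sOne k))
    simp only [comp_apply] at h2
    rw [h1, map_add', map_add', whiskerLeft_tmul, whiskerLeft_tmul, rightUnitor_hom_tmul,
      rightUnitor_hom_tmul, h3, show toScalar (sOne k) = 1 from rfl, one_smul,
      add_eq_right, ← map_smul', toScalar_smul_sOne] at h2
    rw [degProj_zero]
    exact h2
  refine degProj_ext fun n => ?_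
  match n with
  | 0 => rw [h0]; exact congr($(degProj_comp_ne zero_ne_one) x).symm
  | 1 =>
    rw [← symmetrizer_degProj_apply]
    exact congr($((degProj_one_symmetrizer hc hb).trans (degProj_comp_self 1).symm) x)
  | n + 2 => rw [hbig]; exact congr($(degProj_comp_ne (by omega)) x).symm

theorem nicholsHopf_primitives (hb : IsPreBraiding c) :
    (nicholsHopf hc hb).primitives = (nicholsHopf hc hb).piece 1 := by
  rw [← range_nicholsLetter]
  refine Set.Subset.antisymm (fun y hy => ?_) ?_
  · obtain ⟨x, rfl⟩ := toNichols_surjective hc y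
    obtain ⟨v, hv⟩ := degProj_one_eq_letter x
    refine ⟨v, ofNichols_injective hc ?_⟩
    have e := toNichols_ofNichols hc
    refine congr($e (letter V v)).trans (Eq.trans ?_ congr($e x).symm)
    rw [symmetrizer_letter hc hb, symmetrizer_eq_degProj_one_of_primitive hc hb hy, hv]
  · rintro _ ⟨v, rfl⟩
    change (nicholsHopf hc hb).comul (toNichols hc (letter V v)) =
      tmul _ (toNichols hc (letter V v)) + tmul (toNichols hc (letter V v)) _
    rw [nicholsHopf_comul, nicholsHopf_one, tensorComul_letter, map_add', tensorHom_tmul,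
      tensorHom_tmul]

/-- Compose q with the quotient map by the closed subalgebra S. The composite vanishes on every
tensor power, by induction on the length, hence on T(V). -/
theorem generatedBy_piece_one (hb : IsPreBraiding c) :
    (nicholsHopf hc hb).GeneratedBy ((nicholsHopf hc hb).piece 1) := by
  intro S hS h1 hmul hsub
  have key : ∀ n, ∀ a, toNichols hc (inclT V n a) ∈ S := by
    intro n
    induction n with
    | zero =>
      intro a
      obtain ⟨r, hr⟩ := inclT_zero_apply a
      rw [hr, map_smul', ← nicholsHopf_one hc hb]
      exact S.smul_mem r h1
    | succ n ih =>
      intro a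
      rw [← quotientMap_eq_zero_iff S hS]
      -- Passing to the quotient by S turns membership into an equation between bounded maps, which
      -- can be checked on pure tensors; closedness of S is used here.
      have h : inclSucc V n ≫ toNichols hc ≫ quotientMap S hS = 0 := tensor_ext fun b v => by
        refine (quotientMap_eq_zero_iff S hS _).2 ?_
        have e : inclSucc V n (tmul b v) = concat V (tmul (inclT V n b) (letter V v)) := by
          have h1 := congr($(letter_concat (V := V)) (tmul (inclT V n b) v))
          rw [comp_apply, whiskerLeft_tmul] at h1
          exact (h1.trans (append_inclT_apply n b v)).symm
        rw [e, ← nicholsHopf_mul hc hb]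
        refine hmul _ (ih b) _ (hsub ?_)
        rw [← range_nicholsLetter]
        exact ⟨v, rfl⟩
      exact congr($h a)
  have h : toNichols hc ≫ quotientMap S hS = 0 := inclT_ext fun n => hom_ext fun a =>
    (quotientMap_eq_zero_iff S hS _).2 (key n a)
  refine eq_top_iff.2 fun y _ => ?_
  obtain ⟨x, rfl⟩ := toNichols_surjective hc y
  exact (quotientMap_eq_zero_iff S hS _).1 congr($h x)

theorem isAnalyticNichols_nicholsHopf (hb : IsPreBraiding c) :
    IsAnalyticNichols c (nicholsHopf hc hb) where
  flat := isFlat _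
  piece_zero := ⟨_, isStrictMono_nicholsUnit hc, range_nicholsUnit hc hb⟩
  primitives_eq := nicholsHopf_primitives hc hb
  piece_one := ⟨_, isStrictMono_nicholsLetter hc hb, range_nicholsLetter hc hb,
    nicholsLetter_braid hc hb⟩
  generated := generatedBy_piece_one hc hb

end NicholsProperties

end BanNA

end

theorem proposition3p4 {k : Type u} [NormedField k] [IsUltrametricDist k] [CompleteSpace k]
    (V : BanNA k) (c : V ⊗ V ⟶ V ⊗ V) (hc : BanNA.IsPreBraiding c) (hc1 : ∀ x, ‖c x‖ ≤ ‖x‖) :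
    ∃ T : BanNA.GradedHopf (BanNA.tensorAlg V), BanNA.IsTensorHopf c T ∧
      ∃ (I : Submodule k (BanNA.tensorAlg V)) (hI : IsClosed (I : Set (BanNA.tensorAlg V))),
        IsGreatest {J | BanNA.IsNicholsIdeal T J} I ∧
        ∃ R : BanNA.GradedHopf (BanNA.quotient I hI),
          BanNA.GradedHopf.IsHom T R (BanNA.quotientMap I hI) ∧
          BanNA.IsAnalyticNichols c R :=
  ⟨BanNA.tensorHopf hc1 hc, BanNA.isTensorHopf_tensorHopf hc1 hc, BanNA.nicholsIdeal hc1,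
    BanNA.isClosed_nicholsIdeal hc1, BanNA.isGreatest_nicholsIdeal hc1 hc,
    BanNA.nicholsHopf hc1 hc, BanNA.isHom_toNichols hc1 hc,
    BanNA.isAnalyticNichols_nicholsHopf hc1 hc⟩
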